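/- **Setting.** Let $\mathbb T=[-\infty,\infty)$, and for $I\subset\{1,\dots,N\}$ let $\mathbb T^\circ_I\subset\mathbb T^N$ be the stratum of points whose set of infinite coordinates (refined sedentarity) is exactly $I$; identify $\mathbb T_I^\circ\cong\mathbb R^{N-|I|}=\mathbb R^N/\mathbb R^I$. A polyhedral domain is a finite intersection $D$ of closed half-spaces $\{jx\le a\}$ ($j\in\mathbb Z^N$, $a\in\mathbb R$; negative terms of $jx$ are moved to the right-hand side) with $D\cap\mathbb R^N\ne\emptyset$; its mobile faces are the intersections with boundaries of some of these half-spaces that meet $\mathbb R^N$. An $n$-dimensional polyhedral complex $Y\subset\mathbb T^N$ is a finite union of distinct $n$-dimensional domains (facets) such that every intersection of facets is empty or a mobile face of each of them. It is assumed regular at infinity (each mobile face $E$ meets each $\mathbb T_I^\circ$ in the empty set or in dimension $\dim E-|I|$) and balanced (at every mobile face $E$ of dimension $n-1$ the outward primitive integer vectors of the adjacent facets sum to zero in $\mathbb R^N/\mathrm{span}(E)$). A tropical space $X$ is a topological space with a finite cover by open sets $U_\alpha$ and open embeddings $\phi_\alpha:U_\alpha\to Y_\alpha\subset\mathbb T^{N_\alpha}$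 into such complexes, with overlap maps locally induced by integral affine maps $\mathbb T^{N_\alpha}\dashrightarrow\mathbb T^{N_\beta}$, and of finite type: if $x_j\in U_\alpha$ and $\phi_\alpha(x_j)\to y\in\mathbb T^{N_\alpha}$, then $(x_j)$ converges in $X$ or some coordinate is $-\infty$ at $y$ and finite on $\phi_\alpha(U_\alpha)$. **Coefficients.** For $y\in Y$ of refined sedentarity $I$ let $\Sigma(y)\subset\mathbb T_I^\circ$ be the cone of vectors $u$ with $y+\epsilon u\in Y$ for all small $\epsilon>0$, and $W'(y)$ the largest linear space $L$ with $\Sigma(y)+L=\Sigma(y)$. If $y$ is in the relative interior of $E\cap\mathbb T_I$, $E$ a mobile face, then $W(y):=W'(y_m)\subset\mathbb R^N$ for a finite point $y_m$ in the relative interior of $E$, and $W_k(y)=\Lambda^kW(y)$. The group $F_p(y)\subset\Lambda^p(\mathbb Z^N/\mathbb Z^I)$ is generated by the products $v_1\wedge\dots\wedge v_p$ of integer vectors that are all tangent to $D\cap\mathbb T_I^\circ$ for one facet $D\ni y$. Two points of $X$ lie in the same combinatorial stratum if they are joined by a path along which $\dim W$ and the sedentarity $|I|$ are constant. In a chart these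 groups are locally constant on strata; if a stratum $S'$ is adjacent to $S$ (in its closure) there are maps $W_k(S')\to W_k(S)$ (inclusion) and $F_p(S)\to F_p(S')$ (inclusion, or projection along the divisorial directions, i.e. the coordinate directions that become infinite). The wedge $W_k(y)\otimes F_p(y)\to F_{p+k}(y)\otimes\mathbb R$ is taken after projecting $W(y)$ to $\mathbb R^N/\mathbb R^I$. **Chains and cochains.** Consider singular simplices $\sigma:\Delta^q\to X$ whose image lies in a single chart and which map every relatively open face of $\Delta^q$ into a single stratum. Write $F_p(\sigma)$, $W_k(\sigma)$ for the coefficients at the image of the open simplex; values in different charts containing $\sigma$ are identified via the differentials of the overlap maps. $C_q(X;F_p\otimes\mathbb R)$ consists of finite sums $\sum\beta_\sigma\sigma$, $\beta_\sigma\in F_p(\sigma)\otimes\mathbb R$, with the singular boundary followed by the maps $F_p(\sigma)\to F_p(\tau)$ for faces $\tau$; $C^r(X;W_k)$ consists of the functions $\sigma\mapsto\alpha(\sigma)\in W_k(\sigma)$, with the singular coboundary using the maps $W_k(\tau)\to W_k(\sigma)$. Their (co)homology groups are $H_q(X;F_p\otimes\mathbb R)$ and $H^r(X;W_k)$. **Proposition.**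 Let $X$ be a tropical space, $k,p\ge0$ and $0\le r\le q$. The cap product $$\alpha\cap\sum\beta_\sigma\,\sigma=\sum(\alpha(\sigma_{0\dots r})\wedge\beta_\sigma)\,\sigma_{r\dots q},$$ where $\alpha(\sigma_{0\dots r})$ is mapped to $W_k(\sigma)$ and the product is pushed from $\sigma$ to $\sigma_{r\dots q}$, is a well-defined map $C^r(X;W_k)\times C_q(X;F_p\otimes\mathbb R)\to C_{q-r}(X;F_{p+k}\otimes\mathbb R)$. The cap product of a cocycle with a cycle is a cycle, and there is a unique bilinear map $$\cap: H^r(X;W_k)\otimes H_q(X;F_p\otimes\mathbb R)\to H_{q-r}(X;F_{p+k}\otimes\mathbb R)$$ with $[\alpha]\cap[\gamma]=[\alpha\cap\gamma]$ for all cocycles $\alpha$ and cycles $\gamma$. -/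

import Mathlib

open Set Filter Topology

noncomputable section

namespace TropWave

/-- The subquotient `Z / (Z ∩ B)` of a real vector space; it is `Z / B` if `B ⊆ Z`. -/
abbrev SubQuot {M : Type*} [AddCommGroup M] [Module ℝ M] (Z B : Submodule ℝ M) : Type _ :=
  Z ⧸ B.submoduleOf Z

/-- The class of an element of `Z` in `Z / (Z ∩ B)`. -/
def SubQuot.mk {M : Type*} [AddCommGroup M] [Module ℝ M] (Z B : Submodule ℝ M) :
    Z →ₗ[ℝ] SubQuot Z B :=
  (B.submoduleOf Z).mkQ

/-! ## Tropical affine space, polyhedral domains -/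

/-- Tropical affine space `𝕋ᴺ = [-∞,∞)ᴺ`, with the product of the order topologies. -/
abbrev TSpace (N : ℕ) := Fin N → WithBot ℝ

/-- The refined sedentarity of a point: the set of its infinite coordinates. -/
def sed {N : ℕ} (y : TSpace N) : Finset (Fin N) :=
  Finset.univ.filter fun i => y i = ⊥

/-- The half-space `j x ≤ a` of `𝕋ᴺ`, with the negative terms of `j x` moved to the right-hand
side so that both sides are elements of `𝕋` at every point of `𝕋ᴺ`. -/
def halfSpace {N : ℕ} (h : (Fin N → ℤ) × ℝ) : Set (TSpace N) :=
  {x | ∑ i, (h.1 i).toNat • x i ≤ ∑ i, (-h.1 i).toNat • x i + (h.2 : WithBot ℝ)}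

/-- The boundary `j x = a` of a half-space. -/
def bdry {N : ℕ} (h : (Fin N → ℤ) × ℝ) : Set (TSpace N) :=
  {x | ∑ i, (h.1 i).toNat • x i = ∑ i, (-h.1 i).toNat • x i + (h.2 : WithBot ℝ)}

/-- The convex polyhedral domain cut out by finitely many half-spaces. -/
def domain {N : ℕ} (S : Finset ((Fin N → ℤ) × ℝ)) : Set (TSpace N) :=
  {x | ∀ h ∈ S, x ∈ halfSpace h}

/-- The part of `D` in the stratum `𝕋°_I` of `𝕋ᴺ`. This stratum is identified with the space of
the real vectors whose coordinates in `I` vanish; `I = ∅` gives the non-infinite part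
`D° = D ∩ ℝᴺ`. -/
def slice {N : ℕ} (I : Finset (Fin N)) (D : Set (TSpace N)) : Set (Fin N → ℝ) :=
  {u | (∀ i ∈ I, u i = 0) ∧ (fun i => if i ∈ I then (⊥ : WithBot ℝ) else (u i : WithBot ℝ)) ∈ D}

/-- The linear space parallel to (the affine span of) `D ∩ 𝕋°_I`. -/
def tangent {N : ℕ} (I : Finset (Fin N)) (D : Set (TSpace N)) : Submodule ℝ (Fin N → ℝ) :=
  vectorSpan ℝ (slice I D)

/-- `E` is a mobile face of the domain defined by `S`: the intersection of that domain with the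
boundaries of some of the defining half-spaces, with a non-empty non-infinite part. -/
def IsMobileFace {N : ℕ} (S : Finset ((Fin N → ℤ) × ℝ)) (E : Set (TSpace N)) : Prop :=
  (∃ K ⊆ S, E = {x | x ∈ domain S ∧ ∀ h ∈ K, x ∈ bdry h}) ∧ (slice ∅ E).Nonempty

/-- An integer vector regarded as a real vector. -/
def realVec {N : ℕ} (v : Fin N → ℤ) : Fin N → ℝ := fun i => (v i : ℝ)

/-- `v` represents the primitive integer vector of `ℝᴺ / V`, `V` the linear space parallel to `E`,
which generates the ray that is the direction of `D` in this quotient, from `E` into `D`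
(`E` a face of codimension one of `D`). -/
def IsPrimitiveOutward {N : ℕ} (E D : Set (TSpace N)) (v : Fin N → ℤ) : Prop :=
  realVec v ∉ tangent ∅ E ∧
  (∃ x ∈ slice ∅ E, ∃ y ∈ slice ∅ D, ∃ c : ℝ, 0 < c ∧ y - x - c • realVec v ∈ tangent ∅ E) ∧
  ∀ (w : Fin N → ℤ) (m : ℕ), realVec v - (m : ℝ) • realVec w ∈ tangent ∅ E → m = 1

/-! ## Polyhedral complexes -/

/-- A polyhedral complex in `𝕋ᴺ` all of whose facets have dimension `dim`; each facet comes with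
its defining half-spaces. -/
structure PolyComplex (N : ℕ) where
  dim : ℕ
  numFacets : ℕ
  constr : Fin numFacets → Finset ((Fin N → ℤ) × ℝ)
  facet_injective : Function.Injective fun i => domain (constr i)
  facet_nonempty : ∀ i, (slice ∅ (domain (constr i))).Nonempty
  facet_dim : ∀ i, Module.finrank ℝ (tangent ∅ (domain (constr i))) = dim
  inter_isFace : ∀ J : Finset (Fin numFacets), J.Nonempty →
    (⋂ j ∈ J, domain (constr j)) = ∅ ∨
      ∀ i ∈ J, IsMobileFace (constr i) (⋂ j ∈ J, domain (constr j))

namespace PolyComplex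

variable {N : ℕ} (Y : PolyComplex N)

/-- The facets of `Y`. -/
def facet (i : Fin Y.numFacets) : Set (TSpace N) := domain (Y.constr i)

/-- The underlying set of `Y`. -/
def support : Set (TSpace N) := ⋃ i, Y.facet i

/-- The mobile faces of `Y` are the mobile faces of its facets. -/
def IsFace (E : Set (TSpace N)) : Prop := ∃ i, IsMobileFace (Y.constr i) E

/-- Regularity at infinity: for every mobile face `E` and every `I`, the intersection
`E ∩ 𝕋°_I` is empty or has dimension `dim E - |I|`. -/
def IsRegular : Prop :=
  ∀ E, Y.IsFace E → ∀ I : Finset (Fin N),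
    slice I E = ∅ ∨
      Module.finrank ℝ (tangent I E) + I.card = Module.finrank ℝ (tangent ∅ E)

open scoped Classical in
/-- The balancing condition at every mobile face of codimension one. -/
def IsBalanced : Prop :=
  ∀ E, Y.IsFace E → Module.finrank ℝ (tangent ∅ E) + 1 = Y.dim →
    ∃ v : Fin Y.numFacets → Fin N → ℤ,
      (∀ i, E ⊆ Y.facet i → IsPrimitiveOutward E (Y.facet i) (v i)) ∧
      ∑ i ∈ Finset.univ.filter (fun i => E ⊆ Y.facet i), realVec (v i) ∈ tangent ∅ E

/-! ## Tangent spaces -/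

/-- The cone `Σ(y)` of the vectors `u` in `𝕋°_I`, `I` the refined sedentarity of `y`, such that
`y + ε u ∈ Y` for all sufficiently small `ε > 0`. -/
def tangentCone (y : TSpace N) : Set (Fin N → ℝ) :=
  {u | (∀ i ∈ sed y, u i = 0) ∧ ∃ ε₀ : ℝ, 0 < ε₀ ∧ ∀ ε : ℝ, 0 < ε → ε < ε₀ →
    (fun i => y i + ((ε * u i : ℝ) : WithBot ℝ)) ∈ Y.support}

/-- The space `W'(y)`: the largest linear space along which the cone `Σ(y)` is invariant. -/
def lineality (y : TSpace N) : Submodule ℝ (Fin N → ℝ) where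
  carrier := {v | ∀ u ∈ Y.tangentCone y, ∀ t : ℝ, u + t • v ∈ Y.tangentCone y}
  zero_mem' := by
    intro u hu t
    simpa using hu
  add_mem' := by
    intro v w hv hw u hu t
    have h := hw _ (hv u hu t) t
    rwa [add_assoc, ← smul_add] at h
  smul_mem' := by
    intro c v hv u hu t
    have h := hv u hu (t * c)
    rwa [mul_smul] at h

/-- `y` lies in the mobile face `E` and in no smaller mobile face. For `y` of refined sedentarity
`I` this says that `y` is in the relative interior of the face `E ∩ 𝕋_I`, whose parent is `E`. -/
def InRelInt (E : Set (TSpace N)) (y : TSpace N) : Prop :=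
  Y.IsFace E ∧ y ∈ E ∧ ∀ E', Y.IsFace E' → E' ⊂ E → y ∉ E'

/-- `z` is a nearby mobile point to `y`: a finite point in the relative interior of the parent
of the face that has `y` in its relative interior. -/
def NearbyMobile (y z : TSpace N) : Prop :=
  (∀ i, z i ≠ ⊥) ∧ ∃ E, Y.InRelInt E y ∧ Y.InRelInt E z

/-- The wave tangent space `W(y)`, a subspace of `ℝᴺ`: the space `W'(z)` for a nearby mobile
point `z` (it is the same for all of them). -/
def waveSpace (y : TSpace N) : Submodule ℝ (Fin N → ℝ) :=
  ⨅ z ∈ {z | Y.NearbyMobile y z}, Y.lineality z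

/-- The group `F_p(y)`, in the `p`-th exterior power of `ℝᴺ`: it is generated by the products
`v₁ ∧ ⋯ ∧ v_p` of integer vectors which are all tangent to one facet through `y`, more precisely
to its part of the same refined sedentarity as `y`. -/
def latticeF (p : ℕ) (y : TSpace N) : AddSubgroup (ExteriorAlgebra ℝ (Fin N → ℝ)) :=
  AddSubgroup.closure
    {w | ∃ i, y ∈ Y.facet i ∧ ∃ v : Fin p → Fin N → ℤ,
      (∀ l, realVec (v l) ∈ tangent (sed y) (Y.facet i)) ∧
      w = ExteriorAlgebra.ιMulti ℝ p fun l => realVec (v l)}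

/-- `F_p(y) ⊗ ℝ`, realised as the real span of the group `F_p(y)`, which is contained in the
lattice of integer `p`-vectors. -/
def realF (p : ℕ) (y : TSpace N) : Submodule ℝ (ExteriorAlgebra ℝ (Fin N → ℝ)) :=
  Submodule.span ℝ (Y.latticeF p y : Set (ExteriorAlgebra ℝ (Fin N → ℝ)))

/-- `W_k(y)`, the `k`-th exterior power of `W(y)`, in the `k`-th exterior power of `ℝᴺ`. -/
def waveK (k : ℕ) (y : TSpace N) : Submodule ℝ (ExteriorAlgebra ℝ (Fin N → ℝ)) :=
  Submodule.span ℝ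
    {w | ∃ v : Fin k → Fin N → ℝ, (∀ l, v l ∈ Y.waveSpace y) ∧ w = ExteriorAlgebra.ιMulti ℝ k v}

end PolyComplex

/-! ## Integral affine maps and tropical spaces -/

/-- `y` is the image of `x` under the integral affine map `𝕋ᴺ ⇢ 𝕋ᴹ` with linear part `A` and
translation part `b`; this includes that the map is defined at `x` (by continuity). -/
def IsAffineImage {N M : ℕ} (A : Matrix (Fin M) (Fin N) ℤ) (b : Fin M → ℝ)
    (x : TSpace N) (y : TSpace M) : Prop :=
  (∀ i j, x j = ⊥ → 0 ≤ A i j) ∧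
  ∀ i, y i + ∑ j, (-A i j).toNat • x j = ∑ j, (A i j).toNat • x j + (b i : WithBot ℝ)

/-- The real linear map given by an integer matrix. -/
def realLin {N M : ℕ} (A : Matrix (Fin M) (Fin N) ℤ) : (Fin N → ℝ) →ₗ[ℝ] (Fin M → ℝ) :=
  (A.map (Int.cast : ℤ → ℝ)).mulVecLin

/-- The projection of `ℝᴺ` along the divisorial directions indexed by `I` onto the tangent space
of `𝕋°_I` (vectors whose coordinates in `I` vanish). -/
def divProj {N : ℕ} (I : Finset (Fin N)) : (Fin N → ℝ) →ₗ[ℝ] (Fin N → ℝ) :=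
  LinearMap.pi fun i => if i ∈ I then 0 else LinearMap.proj i

/-- A tropical space (regular at infinity): a topological space with a finite cover by compatible
charts to balanced polyhedral complexes regular at infinity, subject to the finite type
condition. Only the values of `φ α` on `U α` matter. -/
structure TropicalSpace (X : Type*) [TopologicalSpace X] where
  numCharts : ℕ
  N : Fin numCharts → ℕ
  Y : ∀ α, PolyComplex (N α)
  regular : ∀ α, (Y α).IsRegular
  balanced : ∀ α, (Y α).IsBalanced
  U : Fin numCharts → Set X
  φ : ∀ α, X → TSpace (N α)
  isOpen_U : ∀ α, IsOpen (U α)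
  cover : ⋃ α, U α = univ
  mapsTo : ∀ α, MapsTo (φ α) (U α) (Y α).support
  isOpenEmbedding : ∀ α, IsOpenEmbedding ((mapsTo α).restrict (φ α) (U α) (Y α).support)
  compatible : ∀ α β, ∀ x ∈ U α ∩ U β, ∃ A b, ∀ᶠ z in 𝓝 x, IsAffineImage A b (φ α z) (φ β z)
  finite_type : ∀ (α) (x : ℕ → X), (∀ n, x n ∈ U α) →
    ∀ y : TSpace (N α), Tendsto (fun n => φ α (x n)) atTop (𝓝 y) →
      (∃ x₀, Tendsto x atTop (𝓝 x₀)) ∨ ∃ i, y i = ⊥ ∧ ∀ z ∈ U α, φ α z i ≠ ⊥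

namespace TropicalSpace

variable {X : Type*} [TopologicalSpace X] (T : TropicalSpace X)

/-- `A` is the linear part of an integral affine map which induces the overlapping map from the
chart `α` to the chart `β` near `x`. -/
def IsTransition (α β : Fin T.numCharts) (x : X)
    (A : Matrix (Fin (T.N β)) (Fin (T.N α)) ℤ) : Prop :=
  ∃ b, ∀ᶠ z in 𝓝 x, IsAffineImage A b (T.φ α z) (T.φ β z)

/-- The wave tangent space at `x` has dimension `w`, and `x` has sedentarity `s`. -/
def HasType (x : X) (w s : ℕ) : Prop :=
  ∀ α, x ∈ T.U α →
    Module.finrank ℝ ((T.Y α).waveSpace (T.φ α x)) = w ∧ (sed (T.φ α x)).card = s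

/-- Combinatorial equivalence; its classes are the combinatorial strata. -/
def CombEquiv (x x' : X) : Prop :=
  ∃ (w s : ℕ) (γ : Path x x'), ∀ t, T.HasType (γ t) w s

/-- A compatible singular `q`-simplex together with a chart that contains its image: every
relatively open face of the standard simplex (the points with a given set of positive barycentric
coordinates) is mapped into a single combinatorial stratum. -/
structure ChartedSimplex (q : ℕ) where
  toMap : C(stdSimplex ℝ (Fin (q + 1)), X)
  chart : Fin T.numCharts
  mem_chart : ∀ t, toMap t ∈ T.U chart
  compat : ∀ t t' : stdSimplex ℝ (Fin (q + 1)), (∀ i, 0 < t i ↔ 0 < t' i) →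
    T.CombEquiv (toMap t) (toMap t')

lemma map_pos_iff {m q : ℕ} (f : Fin (m + 1) → Fin (q + 1)) (t : stdSimplex ℝ (Fin (m + 1)))
    (j : Fin (q + 1)) : 0 < stdSimplex.map f t j ↔ ∃ i, f i = j ∧ 0 < t i := by
  rw [stdSimplex.map_coe, FunOnFinite.linearMap_apply_apply]
  constructor
  · intro h
    obtain ⟨i, hi, hpos⟩ := Finset.exists_lt_of_sum_lt
      (f := fun _ => (0 : ℝ)) (s := Finset.univ.filter fun i => f i = j) (g := fun i => t i)
      (by simpa using h)
    exact ⟨i, by simpa using hi, hpos⟩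
  · rintro ⟨i, hi, hpos⟩
    exact Finset.sum_pos' (fun l _ => t.2.1 l) ⟨i, by simpa using hi, hpos⟩

namespace ChartedSimplex

variable {T}

/-- The singular simplex spanned by the vertices of `s` with the numbers `f 0, f 1, …, f m`. -/
def restrict {m q : ℕ} (s : T.ChartedSimplex q) (f : Fin (m + 1) → Fin (q + 1)) :
    T.ChartedSimplex m where
  toMap := s.toMap.comp ⟨stdSimplex.map f, stdSimplex.continuous_map f⟩
  chart := s.chart
  mem_chart t := s.mem_chart _
  compat t t' h := s.compat _ _ fun i => by
    simp only [ContinuousMap.coe_mk, map_pos_iff, h]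

/-- The `i`-th face of codimension one (omit the `i`-th vertex). -/
def face {q : ℕ} (s : T.ChartedSimplex (q + 1)) (i : Fin (q + 2)) : T.ChartedSimplex q :=
  s.restrict i.succAbove

/-- The first `r`-face `σ_{0…r}`. -/
def front {r q : ℕ} (h : r ≤ q) (s : T.ChartedSimplex q) : T.ChartedSimplex r :=
  s.restrict (Fin.castLE (Nat.succ_le_succ h))

/-- The last `(q-r)`-face `σ_{r…q}`. -/
def back {r q : ℕ} (h : r ≤ q) (s : T.ChartedSimplex q) : T.ChartedSimplex (q - r) :=
  s.restrict fun i => ⟨r + i, by omega⟩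

/-- The image of the barycenter, a point in the stratum that contains the interior of the simplex;
the coefficients of the simplex are taken there. -/
def center {q : ℕ} (s : T.ChartedSimplex q) : X := s.toMap stdSimplex.barycenter

/-- The coordinates of the center in the chart of the simplex. -/
def pt {q : ℕ} (s : T.ChartedSimplex q) : TSpace (T.N s.chart) := T.φ s.chart s.center

/-- The exterior algebra of `ℝᴺ`, for the chart of the simplex. -/
abbrev Coeff {q : ℕ} (s : T.ChartedSimplex q) : Type := ExteriorAlgebra ℝ (Fin (T.N s.chart) → ℝ)

/-- `F_p(σ) ⊗ ℝ`. -/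
def coeffF (p : ℕ) {q : ℕ} (s : T.ChartedSimplex q) : Submodule ℝ s.Coeff :=
  (T.Y s.chart).realF p s.pt

/-- `W_k(σ)`. -/
def coeffW (k : ℕ) {q : ℕ} (s : T.ChartedSimplex q) : Submodule ℝ s.Coeff :=
  (T.Y s.chart).waveK k s.pt

/-- The map induced on exterior algebras by the projection along the divisorial directions of
the stratum of `s`. -/
def project {q : ℕ} (s : T.ChartedSimplex q) : s.Coeff →ₗ[ℝ] s.Coeff :=
  (ExteriorAlgebra.map (divProj (sed s.pt))).toLinearMap

end ChartedSimplex

/-! ## Tropical chains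

A tropical chain is a finite formal sum `∑ β σ`. The coefficient `β` is written in a chart that
contains `σ`; writing it in another such chart, through the differential of the overlapping map,
gives the same chain. -/

/-- Finite formal sums of charted simplices, with arbitrary multivectors as coefficients. -/
abbrev FormalSum (q : ℕ) := Π₀ s : T.ChartedSimplex q, s.Coeff

/-- The finite formal sums `∑ β σ` with `β ∈ F_p(σ) ⊗ ℝ`. -/
def chains (p q : ℕ) : Submodule ℝ (T.FormalSum q) where
  carrier := {c | ∀ s, c s ∈ s.coeffF p}
  zero_mem' s := by simp
  add_mem' hc hd s := by simpa using add_mem (hc s) (hd s)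
  smul_mem' a c hc s := by simpa using Submodule.smul_mem _ a (hc s)

open scoped Classical in
/-- The span of the differences between the two ways to write `β σ` in two charts that contain
`σ`. The differential of an overlapping map on the tangent spaces at points of a stratum `𝕋°_I` is
induced by `A` on the quotients by the divisorial directions. The tropical chain group
`C_q(X; F_p ⊗ ℝ)` is `chains p q` modulo `chartRel p q`. -/
def chartRel (p q : ℕ) : Submodule ℝ (T.FormalSum q) :=
  Submodule.span ℝ
    {c | ∃ s s' : T.ChartedSimplex q, s.toMap = s'.toMap ∧
      ∃ A, T.IsTransition s.chart s'.chart s.center A ∧ ∃ β ∈ s.coeffF p,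
        c = DFinsupp.single s β -
          DFinsupp.single s' (s'.project (ExteriorAlgebra.map (realLin A) β))}

open scoped Classical in
/-- The boundary map: the singular one, followed by the maps `F_p(σ) → F_p(τ)` for the faces `τ`
of `σ` (inclusion, or projection along divisorial directions if the sedentarity changes). -/
def boundary (q : ℕ) : T.FormalSum (q + 1) →ₗ[ℝ] T.FormalSum q :=
  DFinsupp.lsum ℝ fun s => ∑ i : Fin (q + 2),
    (-1 : ℝ) ^ (i : ℕ) • (DFinsupp.lsingle (s.face i)).comp (s.face i).project

/-- The formal sums that represent cycles of `C_•(X; F_p ⊗ ℝ)`. -/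
def cycles (p : ℕ) : ∀ q : ℕ, Submodule ℝ (T.FormalSum q)
  | 0 => T.chains p 0
  | q + 1 => T.chains p (q + 1) ⊓ (T.chartRel p q).comap (T.boundary q)

/-- The formal sums that represent boundaries of `C_•(X; F_p ⊗ ℝ)`. -/
def boundaries (p q : ℕ) : Submodule ℝ (T.FormalSum q) :=
  (T.chains p (q + 1)).map (T.boundary q) ⊔ T.chartRel p q

/-- The tropical homology `H_q(X; F_p ⊗ ℝ)`. -/
abbrev TropHomology (p q : ℕ) : Type _ :=
  SubQuot (T.cycles p q) (T.boundaries p q)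

/-- The homology class of a cycle. -/
def tropClass (p q : ℕ) : T.cycles p q →ₗ[ℝ] T.TropHomology p q :=
  SubQuot.mk (T.cycles p q) (T.boundaries p q)

/-! ## Wave cochains -/

/-- Functions which assign to every charted simplex a multivector. -/
abbrev FormalCochain (r : ℕ) := ∀ s : T.ChartedSimplex r, s.Coeff

/-- The wave cochain group `C^r(X; W_k)`: the value at `σ` lies in `W_k(σ)`, and the values in two
charts that contain `σ` correspond via the differential of the overlapping map. -/
def cochains (k r : ℕ) : Submodule ℝ (T.FormalCochain r) where
  carrier := {a | (∀ s, a s ∈ s.coeffW k) ∧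
    ∀ s s' : T.ChartedSimplex r, s.toMap = s'.toMap →
      ∀ A, T.IsTransition s.chart s'.chart s.center A →
        a s' = ExteriorAlgebra.map (realLin A) (a s)}
  zero_mem' := ⟨fun s => by simp, fun s s' _ A _ => by simp⟩
  add_mem' ha hb := ⟨fun s => add_mem (ha.1 s) (hb.1 s), fun s s' h A hA => by
    simp [ha.2 s s' h A hA, hb.2 s s' h A hA]⟩
  smul_mem' c a ha := ⟨fun s => Submodule.smul_mem _ c (ha.1 s), fun s s' h A hA => by
    simp [ha.2 s s' h A hA]⟩

/-- The coboundary map: the value on each face `τ` of `σ` is mapped by `W_k(τ) → W_k(σ)`, which is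
an inclusion of spaces of multivectors in the chart. -/
def coboundary (r : ℕ) : T.FormalCochain r →ₗ[ℝ] T.FormalCochain (r + 1) :=
  LinearMap.pi fun s => ∑ i : Fin (r + 2), (-1 : ℝ) ^ (i : ℕ) • LinearMap.proj (s.face i)

/-- The cocycles of `C^•(X; W_k)`. -/
def cocycles (k r : ℕ) : Submodule ℝ (T.FormalCochain r) :=
  T.cochains k r ⊓ LinearMap.ker (T.coboundary r)

/-- The coboundaries of `C^•(X; W_k)`. -/
def coboundaries (k : ℕ) : ∀ r : ℕ, Submodule ℝ (T.FormalCochain r)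
  | 0 => ⊥
  | r + 1 => (T.cochains k r).map (T.coboundary r)

/-- The wave group `H^r(X; W_k)`. -/
abbrev WaveCohomology (k r : ℕ) : Type _ :=
  SubQuot (T.cocycles k r) (T.coboundaries k r)

/-- The cohomology class of a cocycle. -/
def waveClass (k r : ℕ) : T.cocycles k r →ₗ[ℝ] T.WaveCohomology k r :=
  SubQuot.mk (T.cocycles k r) (T.coboundaries k r)

/-! ## The cap product -/

open scoped Classical in
/-- The cap product `a ∩ ∑ β σ = ∑ (a(σ_{0…r}) ∧ β) σ_{r…q}`: the value `a(σ_{0…r})` is mapped to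
`W_k(σ)` (an inclusion) and projected along the divisorial directions of `σ`, the product with `β`
is taken, and the result is pushed from `σ` to `σ_{r…q}`. -/
def cap {r q : ℕ} (h : r ≤ q) (a : T.FormalCochain r) : T.FormalSum q →ₗ[ℝ] T.FormalSum (q - r) :=
  DFinsupp.lsum ℝ fun s =>
    (DFinsupp.lsingle (s.back h)).comp
      ((s.back h).project.comp (LinearMap.mulLeft ℝ (s.project (a (s.front h)))))

end TropicalSpace

end TropWave

end

noncomputable section

namespace TropWave

/-! ## Continuity of the tropical product -/

/-! The formal half of the theorem is the Leibniz formula `a ∩ ∂c = δa ∩ c + (-1)^r ∂(a ∩ c)`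
(`capLin_boundary`). It is the singular computation: coefficients on all faces of a simplex are
written in its one chart, and a projection to a face absorbs the projections made before it. The
other half concerns coefficients: for a face `τ` of `σ`, `W_k(τ)` must lie in `W_k(σ)` and `F_p(σ)`
must project into `F_p(τ)`; `W_k(σ) ∧ F_p(σ)` must lie in `F_{p+k}(σ) ⊗ ℝ`; and all this must
respect changes of chart.

These facts are read off one object, `localCone y`: the union, over the facets through `y`, of the
cones cut out by the active constraints that do not involve the infinite directions `I` of `y`. By a
dimension count, regularity makes the tangent space of a face that reaches `𝕋°_I` contain `ℝᴵ`
(`IsFace.tangent_infinity`). So a constraint with a negative coefficient in `I` is active at no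
finite point (`form_lt_of_neg`), and a point at infinity can be replaced by a finite point far out
in the directions `I`. This gives `waveSpace_eq`: `W(y)` is the lineality space of `localCone y`.

For `y'` close to `y`, the cone at `y'` consists of the directions at `y' - y` that stay in the cone
at `y`. Hence lineality can only grow from `y` to `y'`, and if it does not grow the two cones
coincide (`Near.linealitySpace_le`, `Near.localCone_eq`). Along a segment towards the barycenter the
dimension of `W` and the sedentarity are constant, so the cone is too, and each point of the closed
simplex is a specialisation of a point with the invariants of the center (`exists_near`). This gives
the maps between faces. The wedge product exists since wave vectors are tangent to every facet
(`waveSpace_le_tangent`) and tangent spaces of facets are spanned by integer vectors. Charts are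
compatible since the differential of an overlap map is determined on the span of the local cone,
where all coefficients live, and is constant there along a simplex (`ChartedSimplex.realLin_eq`).

Cycles are closed only modulo `chartRel`, so descent to homology needs both the Leibniz formula and
`capLin_mem_chartRel`. -/

instance continuousAdd_withBot_real : ContinuousAdd (WithBot ℝ) := by
  refine ⟨continuous_iff_continuousAt.2 ?_⟩
  -- Near `b` the second summand stays below a real number `c`, so the sum falls below `a'` as soon
  -- as the first summand is below `a' - c`.
  have key : ∀ b : WithBot ℝ, ContinuousAt (fun p : WithBot ℝ × WithBot ℝ => p.1 + p.2) (⊥, b) := by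
    intro b
    obtain ⟨c, hc⟩ : ∃ c : ℝ, b < c := by
      induction b with
      | bot => exact ⟨0, WithBot.bot_lt_coe 0⟩
      | coe x => exact ⟨x + 1, by exact_mod_cast lt_add_one x⟩
    change Tendsto _ _ (𝓝 (⊥ + b))
    rw [WithBot.bot_add]
    refine tendsto_order.2 ⟨fun a ha => absurd ha not_lt_bot, fun a ha => ?_⟩
    obtain ⟨a', ha'⟩ : ∃ a' : ℝ, (a' : WithBot ℝ) ≤ a := by
      induction a with
      | bot => exact absurd ha (lt_irrefl _)
      | coe x => exact ⟨x, le_rfl⟩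
    have h1 : ∀ᶠ x : WithBot ℝ in 𝓝 ⊥, x < ((a' - c : ℝ) : WithBot ℝ) :=
      Iio_mem_nhds (WithBot.bot_lt_coe _)
    have h2 : ∀ᶠ x : WithBot ℝ in 𝓝 b, x < (c : WithBot ℝ) := Iio_mem_nhds hc
    rw [nhds_prod_eq]
    filter_upwards [h1.prod_mk h2] with p hp
    refine lt_of_lt_of_le ?_ ha'
    obtain ⟨p, q⟩ := p
    obtain ⟨hp, hq⟩ : p < ((a' - c : ℝ) : WithBot ℝ) ∧ q < (c : WithBot ℝ) := hp
    change p + q < (a' : WithBot ℝ)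
    induction p with
    | bot => simp
    | coe p =>
      induction q with
      | bot => simp
      | coe q =>
        have hp' : p < a' - c := by exact_mod_cast hp
        have hq' : q < c := by exact_mod_cast hq
        have : p + q < a' := by linarith
        exact_mod_cast this
  rintro ⟨a, b⟩
  induction a with
  | bot => exact key b
  | coe a =>
    induction b with
    | bot =>
      have h : ContinuousAt (fun p : WithBot ℝ × WithBot ℝ => p.1 + p.2)
          (Prod.swap ((a : WithBot ℝ), (⊥ : WithBot ℝ))) := key a
      have h' := h.comp (f := Prod.swap) (x := ((a : WithBot ℝ), (⊥ : WithBot ℝ)))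
        continuous_swap.continuousAt
      refine h'.congr (Eventually.of_forall fun p => ?_)
      simp [add_comm]
    | coe b =>
      unfold ContinuousAt
      rw [nhds_prod_eq, WithBot.nhds_coe, WithBot.nhds_coe, Filter.prod_map_map_eq,
        tendsto_map'_iff]
      have : Tendsto (fun p : ℝ × ℝ => ((p.1 + p.2 : ℝ) : WithBot ℝ)) (𝓝 a ×ˢ 𝓝 b)
          (𝓝 ((a + b : ℝ) : WithBot ℝ)) := by
        rw [← nhds_prod_eq]
        exact (WithBot.continuous_coe.comp continuous_add).tendsto (a, b)
      simpa [Function.comp_def] using this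

lemma continuous_sum_nsmul {N : ℕ} (n : Fin N → ℕ) :
    Continuous fun x : TSpace N => ∑ i, n i • x i :=
  continuous_finsetSum _ fun i _ => (continuous_apply i).nsmul (n i)

/-- The left-hand side of the half-space `h` is smaller than its right-hand side at `x`. -/
def StrictAt {N : ℕ} (h : (Fin N → ℤ) × ℝ) (x : TSpace N) : Prop :=
  ∑ i, (h.1 i).toNat • x i < ∑ i, (-h.1 i).toNat • x i + (h.2 : WithBot ℝ)

lemma isOpen_strictAt {N : ℕ} (h : (Fin N → ℤ) × ℝ) : IsOpen {x : TSpace N | StrictAt h x} :=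
  isOpen_lt (continuous_sum_nsmul _) ((continuous_sum_nsmul _).add continuous_const)

lemma isClosed_halfSpace {N : ℕ} (h : (Fin N → ℤ) × ℝ) : IsClosed (halfSpace h) :=
  isClosed_le (continuous_sum_nsmul _) ((continuous_sum_nsmul _).add continuous_const)

lemma isClosed_bdry {N : ℕ} (h : (Fin N → ℤ) × ℝ) : IsClosed (bdry h) :=
  isClosed_eq (continuous_sum_nsmul _) ((continuous_sum_nsmul _).add continuous_const)

lemma isClosed_domain {N : ℕ} (S : Finset ((Fin N → ℤ) × ℝ)) : IsClosed (domain S) := by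
  have : domain S = ⋂ h ∈ S, halfSpace h := by ext; simp [domain]
  rw [this]
  exact isClosed_biInter fun h _ => isClosed_halfSpace h

/-! ## Evaluation of affine forms at points of a stratum -/

/-- The point of `𝕋°_I` with finite coordinates `u i`, `i ∉ I`. -/
def emb {N : ℕ} (I : Finset (Fin N)) (u : Fin N → ℝ) : TSpace N :=
  fun i => if i ∈ I then ⊥ else (u i : WithBot ℝ)

/-- The finite coordinates of a point, with `0` in place of `-∞`. -/
def realPart {N : ℕ} (y : TSpace N) : Fin N → ℝ := fun i => (y i).unbotD 0

lemma emb_realPart {N : ℕ} (y : TSpace N) : emb (sed y) (realPart y) = y := by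
  funext i
  simp only [emb, sed, realPart, Finset.mem_filter, Finset.mem_univ, true_and]
  split_ifs with h
  · exact h.symm
  · lift y i to ℝ using h with c
    rfl

@[simp] lemma sed_emb {N : ℕ} (I : Finset (Fin N)) (u : Fin N → ℝ) : sed (emb I u) = I := by
  ext i
  simp [sed, emb]

/-- The linear form on `ℝᴺ` with integer coefficients `j`. -/
def form {N : ℕ} (j : Fin N → ℤ) : (Fin N → ℝ) →ₗ[ℝ] ℝ :=
  ∑ i, (j i : ℝ) • LinearMap.proj i

lemma form_apply {N : ℕ} (j : Fin N → ℤ) (u : Fin N → ℝ) : form j u = ∑ i, (j i : ℝ) * u i := by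
  simp [form]

lemma form_congr {N : ℕ} {j : Fin N → ℤ} {I : Finset (Fin N)} (hj : ∀ i ∈ I, j i = 0)
    {u v : Fin N → ℝ} (h : ∀ i ∉ I, u i = v i) : form j u = form j v := by
  rw [form_apply, form_apply]
  refine Finset.sum_congr rfl fun i _ => ?_
  by_cases hi : i ∈ I
  · simp [hj i hi]
  · rw [h i hi]

lemma form_single {N : ℕ} (j : Fin N → ℤ) (i : Fin N) : form j (Pi.single i 1) = j i := by
  rw [form_apply, Finset.sum_eq_single i]
  · simp
  · intro b _ hb
    simp [hb]
  · simp

lemma continuous_form {N : ℕ} (j : Fin N → ℤ) : Continuous (form j) :=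
  LinearMap.continuous_of_finiteDimensional _

lemma sum_nsmul_emb {N : ℕ} {I : Finset (Fin N)} (n : Fin N → ℕ) (hn : ∀ i ∈ I, n i = 0)
    (u : Fin N → ℝ) :
    ∑ i, n i • emb I u i = ((∑ i, (n i : ℝ) * u i : ℝ) : WithBot ℝ) := by
  have h : ((∑ i, (n i : ℝ) * u i : ℝ) : WithBot ℝ)
      = ∑ i, (((n i : ℝ) * u i : ℝ) : WithBot ℝ) :=
    map_sum (WithBot.addHom : ℝ →+ WithBot ℝ) _ _
  rw [h]
  refine Finset.sum_congr rfl fun i _ => ?_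
  by_cases hi : i ∈ I
  · simp [hn i hi]
  · simp only [emb, hi, if_false]
    rw [← nsmul_eq_mul]
    exact (map_nsmul (WithBot.addHom : ℝ →+ WithBot ℝ) _ _).symm

lemma nsmul_bot {n : ℕ} (hn : n ≠ 0) : n • (⊥ : WithBot ℝ) = ⊥ := by
  obtain ⟨m, rfl⟩ := Nat.exists_eq_succ_of_ne_zero hn
  rw [Nat.succ_eq_add_one, succ_nsmul, WithBot.add_bot]

lemma sum_nsmul_eq_bot {N : ℕ} (n : Fin N → ℕ) {x : TSpace N} {i : Fin N} (hx : x i = ⊥)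
    (hn : n i ≠ 0) : ∑ i, n i • x i = ⊥ := by
  rw [← Finset.add_sum_erase _ _ (Finset.mem_univ i), hx, nsmul_bot hn, WithBot.bot_add]

lemma form_eq_sub {N : ℕ} (j : Fin N → ℤ) (u : Fin N → ℝ) :
    form j u = ∑ i, ((j i).toNat : ℝ) * u i - ∑ i, ((-j i).toNat : ℝ) * u i := by
  rw [form_apply, ← Finset.sum_sub_distrib]
  refine Finset.sum_congr rfl fun i _ => ?_
  rw [← sub_mul]
  congr 1
  have := Int.toNat_sub_toNat_neg (j i)
  exact_mod_cast this.symm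

section Emb

variable {N : ℕ} {I : Finset (Fin N)} {h : (Fin N → ℤ) × ℝ} {u : Fin N → ℝ}

/-- A positive coefficient in a direction of `I` makes the left-hand side `-∞`, and the inequality
is automatic. Without one, a negative coefficient makes only the right-hand side `-∞`, and the
inequality fails. -/
lemma emb_mem_halfSpace :
    emb I u ∈ halfSpace h ↔ (∃ i ∈ I, 0 < h.1 i) ∨ ((∀ i ∈ I, h.1 i = 0) ∧ form h.1 u ≤ h.2) := by
  have hb : ∀ i ∈ I, emb I u i = ⊥ := fun i hi => by simp [emb, hi]
  unfold halfSpace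
  rw [mem_ofPred_eq]
  by_cases hp : ∃ i ∈ I, 0 < h.1 i
  · obtain ⟨i, hi, hpos⟩ := hp
    rw [sum_nsmul_eq_bot _ (hb i hi) (by omega)]
    simp only [bot_le, true_iff]
    exact Or.inl ⟨i, hi, hpos⟩
  · have hp' := hp
    push Not at hp'
    rw [sum_nsmul_emb _ (fun i hi => by have := hp' i hi; omega)]
    by_cases hn : ∃ i ∈ I, h.1 i < 0
    · obtain ⟨i, hi, hneg⟩ := hn
      rw [sum_nsmul_eq_bot _ (hb i hi) (by omega)]
      simp only [WithBot.bot_add, le_bot_iff, WithBot.coe_ne_bot, false_iff, not_or, hp,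
        not_false_eq_true, true_and, not_and]
      intro h0
      have := h0 i hi
      omega
    · push Not at hn
      have h0 : ∀ i ∈ I, h.1 i = 0 := fun i hi => le_antisymm (hp' i hi) (hn i hi)
      rw [sum_nsmul_emb _ (fun i hi => by simp [h0 i hi]), form_eq_sub, ← WithBot.coe_add,
        WithBot.coe_le_coe]
      simp only [hp, false_or]
      constructor
      · intro hle
        exact ⟨h0, by linarith⟩
      · rintro ⟨-, hle⟩
        linarith

/-- The first alternative is the equality `-∞ = -∞`, which carries no information on the finite
coordinates; `IsFace.flat` excludes it for a boundary that contains a whole face. -/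
lemma emb_mem_bdry :
    emb I u ∈ bdry h ↔ ((∃ i ∈ I, 0 < h.1 i) ∧ ∃ i ∈ I, h.1 i < 0) ∨
      ((∀ i ∈ I, h.1 i = 0) ∧ form h.1 u = h.2) := by
  have hb : ∀ i ∈ I, emb I u i = ⊥ := fun i hi => by simp [emb, hi]
  unfold bdry
  rw [mem_ofPred_eq]
  by_cases hp : ∃ i ∈ I, 0 < h.1 i <;> by_cases hn : ∃ i ∈ I, h.1 i < 0
  · simp only [hp, hn, and_self, true_or, iff_true]
    obtain ⟨i, hi, hpos⟩ := hp
    obtain ⟨l, hl, hneg⟩ := hn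
    rw [sum_nsmul_eq_bot _ (hb i hi) (by omega), sum_nsmul_eq_bot _ (hb l hl) (by omega),
      WithBot.bot_add]
  · simp only [hn, and_false, false_or]
    push Not at hn
    obtain ⟨i, hi, hpos⟩ := hp
    rw [sum_nsmul_eq_bot _ (hb i hi) (by omega),
      sum_nsmul_emb _ (fun i hi => by have := hn i hi; omega), ← WithBot.coe_add]
    constructor
    · intro h'
      exact absurd h' (WithBot.bot_ne_coe)
    · rintro ⟨h0, -⟩
      have := h0 i hi
      omega
  · simp only [hp, false_and, false_or]
    push Not at hp
    obtain ⟨i, hi, hneg⟩ := hn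
    rw [sum_nsmul_eq_bot (fun i => (-h.1 i).toNat) (hb i hi) (by omega),
      sum_nsmul_emb _ (fun i hi => by have := hp i hi; omega), WithBot.bot_add]
    constructor
    · intro h'
      exact absurd h' (WithBot.coe_ne_bot)
    · rintro ⟨h0, -⟩
      have := h0 i hi
      omega
  · simp only [hp, false_and, false_or]
    push Not at hp hn
    have h0 : ∀ i ∈ I, h.1 i = 0 := fun i hi => le_antisymm (hp i hi) (hn i hi)
    rw [sum_nsmul_emb _ (fun i hi => by simp [h0 i hi]),
      sum_nsmul_emb _ (fun i hi => by simp [h0 i hi]), form_eq_sub, ← WithBot.coe_add,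
      WithBot.coe_inj]
    constructor
    · intro hle
      exact ⟨h0, by linarith⟩
    · rintro ⟨-, hle⟩
      linarith

lemma strictAt_emb :
    StrictAt h (emb I u) ↔
      (∀ i ∈ I, 0 ≤ h.1 i) ∧ ((∃ i ∈ I, 0 < h.1 i) ∨ form h.1 u < h.2) := by
  have h1 : StrictAt h (emb I u) ↔ emb I u ∈ halfSpace h ∧ emb I u ∉ bdry h :=
    ⟨fun hs => ⟨le_of_lt hs, ne_of_lt hs⟩, fun hs => lt_of_le_of_ne hs.1 hs.2⟩
  rw [h1, emb_mem_halfSpace, emb_mem_bdry]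
  constructor
  · rintro ⟨h2 | ⟨h2, h3⟩, h4⟩
    · push Not at h4
      exact ⟨h4.1 h2, Or.inl h2⟩
    · refine ⟨fun i hi => (h2 i hi).ge, Or.inr (lt_of_le_of_ne h3 fun h5 => h4 (Or.inr ⟨h2, h5⟩))⟩
  · rintro ⟨h2, h3⟩
    by_cases hp : ∃ i ∈ I, 0 < h.1 i
    · refine ⟨Or.inl hp, ?_⟩
      rintro (⟨-, i, hi, h4⟩ | ⟨h4, -⟩)
      · exact absurd (h2 i hi) (not_le.2 h4)
      · obtain ⟨i, hi, h5⟩ := hp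
        exact absurd (h4 i hi) h5.ne'
    · have h4 : form h.1 u < h.2 := h3.resolve_left hp
      have hp' := hp
      push Not at hp'
      refine ⟨Or.inr ⟨fun i hi => le_antisymm (hp' i hi) (h2 i hi), h4.le⟩, ?_⟩
      rintro (⟨h5, -⟩ | ⟨-, h5⟩)
      · exact hp h5
      · exact h4.ne h5

end Emb

/-! ## Slices, lifts and tangent spaces -/

section Slice

variable {N : ℕ}

lemma mem_slice {I : Finset (Fin N)} {D : Set (TSpace N)} {u : Fin N → ℝ} :
    u ∈ slice I D ↔ (∀ i ∈ I, u i = 0) ∧ emb I u ∈ D := Iff.rfl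

lemma mem_slice_empty {D : Set (TSpace N)} {u : Fin N → ℝ} : u ∈ slice ∅ D ↔ emb ∅ u ∈ D := by
  simp [mem_slice]

lemma divProj_apply (I : Finset (Fin N)) (u : Fin N → ℝ) (i : Fin N) :
    divProj I u i = if i ∈ I then 0 else u i := by
  simp only [divProj, LinearMap.pi_apply]
  split_ifs <;> rfl

lemma emb_congr {I : Finset (Fin N)} {u v : Fin N → ℝ} (h : ∀ i ∉ I, u i = v i) :
    emb I u = emb I v := by
  funext i
  by_cases hi : i ∈ I
  · simp [emb, hi]
  · simp [emb, hi, h i hi]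

lemma emb_divProj (I : Finset (Fin N)) (u : Fin N → ℝ) : emb I (divProj I u) = emb I u :=
  emb_congr fun i hi => by simp [divProj_apply, hi]

lemma divProj_mem_slice {I : Finset (Fin N)} {D : Set (TSpace N)} {u : Fin N → ℝ}
    (h : emb I u ∈ D) : divProj I u ∈ slice I D :=
  mem_slice.2 ⟨fun i hi => by simp [divProj_apply, hi], by rwa [emb_divProj]⟩

lemma form_divProj {I : Finset (Fin N)} {j : Fin N → ℤ} (hj : ∀ i ∈ I, j i = 0)
    (u : Fin N → ℝ) : form j (divProj I u) = form j u :=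
  form_congr hj fun i hi => by simp [divProj_apply, hi]

lemma emb_empty_mem_halfSpace {h : (Fin N → ℤ) × ℝ} {u : Fin N → ℝ} :
    emb ∅ u ∈ halfSpace h ↔ form h.1 u ≤ h.2 := by
  simp [emb_mem_halfSpace]

lemma emb_empty_mem_bdry {h : (Fin N → ℤ) × ℝ} {u : Fin N → ℝ} :
    emb ∅ u ∈ bdry h ↔ form h.1 u = h.2 := by
  simp [emb_mem_bdry]

lemma emb_empty_mem_domain {S : Finset ((Fin N → ℤ) × ℝ)} {u : Fin N → ℝ} :
    emb ∅ u ∈ domain S ↔ ∀ h ∈ S, form h.1 u ≤ h.2 := by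
  simp only [domain, mem_ofPred_eq, emb_empty_mem_halfSpace]

lemma sub_mem_tangent {E : Set (TSpace N)} {u v : Fin N → ℝ} (hu : emb ∅ u ∈ E)
    (hv : emb ∅ v ∈ E) : u - v ∈ tangent ∅ E :=
  vsub_mem_vectorSpan ℝ (mem_slice_empty.2 hu) (mem_slice_empty.2 hv)

lemma tangent_le {I : Finset (Fin N)} {E : Set (TSpace N)} {W : Submodule ℝ (Fin N → ℝ)}
    (h : ∀ u ∈ slice I E, ∀ v ∈ slice I E, u - v ∈ W) : tangent I E ≤ W := by
  rw [tangent, vectorSpan_def, Submodule.span_le]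
  rintro _ ⟨u, hu, v, hv, rfl⟩
  exact h u hu v hv

lemma form_eq_zero_of_mem_tangent {E : Set (TSpace N)} {h : (Fin N → ℤ) × ℝ} (hE : E ⊆ bdry h)
    {v : Fin N → ℝ} (hv : v ∈ tangent ∅ E) : form h.1 v = 0 := by
  have : tangent ∅ E ≤ LinearMap.ker (form h.1) := by
    refine tangent_le fun x hx y hy => ?_
    have h1 := emb_empty_mem_bdry.1 (hE (mem_slice_empty.1 hx))
    have h2 := emb_empty_mem_bdry.1 (hE (mem_slice_empty.1 hy))
    simp [h1, h2]
  exact this hv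

/-- The finite point which is obtained from `u` by moving far in the divisorial directions `I`. -/
def lift (I : Finset (Fin N)) (R : ℝ) (u : Fin N → ℝ) : Fin N → ℝ :=
  fun i => if i ∈ I then u i - R else u i

lemma lift_add (I : Finset (Fin N)) (R : ℝ) (u v : Fin N → ℝ) :
    lift I R (u + v) = lift I R u + v := by
  funext i
  by_cases hi : i ∈ I
  · simp only [lift, hi, if_true, Pi.add_apply]
    ring
  · simp [lift, hi]

lemma form_lift (I : Finset (Fin N)) (R : ℝ) (j : Fin N → ℤ) (u : Fin N → ℝ) :
    form j (lift I R u) = form j u - R * ∑ i ∈ I, (j i : ℝ) := by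
  rw [form_apply, form_apply, Finset.mul_sum]
  have : ∑ i ∈ I, R * (j i : ℝ) = ∑ i, if i ∈ I then R * (j i : ℝ) else 0 := by simp
  rw [this, ← Finset.sum_sub_distrib]
  refine Finset.sum_congr rfl fun i _ => ?_
  simp only [lift]
  split_ifs <;> ring

lemma form_lift_of_flat {I : Finset (Fin N)} (R : ℝ) {j : Fin N → ℤ} (hj : ∀ i ∈ I, j i = 0)
    (u : Fin N → ℝ) : form j (lift I R u) = form j u :=
  form_congr hj fun i hi => by simp [lift, hi]

lemma eventually_form_lift_lt {I : Finset (Fin N)} {j : Fin N → ℤ} (hj : ∀ i ∈ I, 0 ≤ j i)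
    (hpos : ∃ i ∈ I, 0 < j i) (u : Fin N → ℝ) (a : ℝ) :
    ∀ᶠ R in atTop, form j (lift I R u) < a := by
  have hs : 0 < ∑ i ∈ I, (j i : ℝ) := by
    refine Finset.sum_pos' (fun i hi => by exact_mod_cast hj i hi) ?_
    obtain ⟨i, hi, h⟩ := hpos
    exact ⟨i, hi, by exact_mod_cast h⟩
  filter_upwards [eventually_gt_atTop ((form j u - a) / ∑ i ∈ I, (j i : ℝ))] with R hR
  rw [div_lt_iff₀ hs] at hR
  rw [form_lift]
  linarith

lemma tendsto_emb_lift (I : Finset (Fin N)) (u : Fin N → ℝ) :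
    Tendsto (fun R => emb ∅ (lift I R u)) atTop (𝓝 (emb I u)) := by
  refine tendsto_pi_nhds.2 fun i => ?_
  by_cases hi : i ∈ I
  · simp only [emb, lift, hi, if_true, Finset.notMem_empty, if_false]
    refine tendsto_order.2 ⟨fun a ha => absurd ha not_lt_bot, fun a ha => ?_⟩
    induction a with
    | bot => exact absurd ha (lt_irrefl _)
    | coe a =>
      filter_upwards [eventually_gt_atTop (u i - a)] with R hR
      have : u i - R < a := by linarith
      exact_mod_cast this
  · simp only [emb, lift, hi, if_false, Finset.notMem_empty]
    exact tendsto_const_nhds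

lemma continuous_emb (I : Finset (Fin N)) : Continuous (emb I : (Fin N → ℝ) → TSpace N) := by
  refine continuous_pi fun i => ?_
  by_cases hi : i ∈ I
  · simp only [emb, hi, if_true]
    exact continuous_const
  · simp only [emb, hi, if_false]
    exact WithBot.continuous_coe.comp (continuous_apply i)

lemma finrank_ker_divProj_le (I : Finset (Fin N)) :
    Module.finrank ℝ (LinearMap.ker (divProj I)) ≤ I.card := by
  classical
  have h : LinearMap.ker (divProj I) ≤
      Submodule.span ℝ ((I.image fun i => (Pi.single i 1 : Fin N → ℝ)) : Set (Fin N → ℝ)) := by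
    intro v hv
    have hv' : ∀ i ∉ I, v i = 0 := fun i hi => by
      have := congrFun (LinearMap.mem_ker.1 hv) i
      simpa [divProj_apply, hi] using this
    have : v = ∑ i ∈ I, v i • (Pi.single i 1 : Fin N → ℝ) := by
      funext l
      simp only [Finset.sum_apply, Pi.smul_apply, Pi.single_apply, smul_eq_mul, mul_ite, mul_one,
        mul_zero, Finset.sum_ite_eq]
      split_ifs with hl
      · rfl
      · exact hv' l hl
    rw [this]
    refine Submodule.sum_mem _ fun i hi => Submodule.smul_mem _ _ (Submodule.subset_span ?_)
    simp only [Finset.coe_image]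
    exact ⟨i, hi, rfl⟩
  exact (Submodule.finrank_mono h).trans
    ((finrank_span_finset_le_card _).trans Finset.card_image_le)

lemma single_mem_ker_divProj {I : Finset (Fin N)} {i : Fin N} (hi : i ∈ I) :
    (Pi.single i 1 : Fin N → ℝ) ∈ LinearMap.ker (divProj I) := by
  rw [LinearMap.mem_ker]
  funext l
  rw [divProj_apply]
  split_ifs with hl
  · rfl
  · have : l ≠ i := fun h => hl (h ▸ hi)
    simp [this]

/-- If a space is mapped by the projection along `ℝᴵ` into a space whose dimension is smaller by
`|I|`, then it contains `ℝᴵ` and its projection is the whole space. -/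
lemma ker_divProj_le_of_finrank {I : Finset (Fin N)} {A B : Submodule ℝ (Fin N → ℝ)}
    (hAB : A.map (divProj I) ≤ B) (hd : Module.finrank ℝ B + I.card = Module.finrank ℝ A) :
    LinearMap.ker (divProj I) ≤ A ∧ B = A.map (divProj I) := by
  -- Rank-nullity on `A`: the image has dimension at most `dim B` and the kernel at most `|I|`.
  -- Since `dim A` is the sum of these bounds, both are attained.
  have h1 := LinearMap.finrank_range_add_finrank_ker ((divProj I).domRestrict A)
  rw [LinearMap.range_domRestrict, LinearMap.ker_domRestrict, ← Submodule.finrank_map_subtype_eq,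
    Submodule.map_comap_subtype] at h1
  have h2 := Submodule.finrank_mono hAB
  have h3 := finrank_ker_divProj_le I
  have h4 : Module.finrank ℝ ↥(A ⊓ LinearMap.ker (divProj I)) ≤
      Module.finrank ℝ (LinearMap.ker (divProj I)) := Submodule.finrank_mono inf_le_right
  constructor
  · have := Submodule.eq_of_le_of_finrank_le
      (inf_le_right : A ⊓ LinearMap.ker (divProj I) ≤ LinearMap.ker (divProj I)) (by omega)
    rw [← this]
    exact inf_le_left
  · exact (Submodule.eq_of_le_of_finrank_le hAB (by omega)).symm

end Slice

/-! ## The structure of regular complexes at infinity -/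

namespace PolyComplex

variable {N : ℕ} {Y : PolyComplex N}

lemma isMobileFace_facet (i : Fin Y.numFacets) : IsMobileFace (Y.constr i) (Y.facet i) :=
  ⟨⟨∅, by simp, by simp [facet]⟩, Y.facet_nonempty i⟩

lemma isFace_facet (i : Fin Y.numFacets) : Y.IsFace (Y.facet i) := ⟨i, isMobileFace_facet i⟩

lemma IsFace.isClosed {E : Set (TSpace N)} (hE : Y.IsFace E) : IsClosed E := by
  obtain ⟨i, ⟨K, -, rfl⟩, -⟩ := hE
  have : {x | x ∈ domain (Y.constr i) ∧ ∀ h ∈ K, x ∈ bdry h} =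
      domain (Y.constr i) ∩ ⋂ h ∈ K, bdry h := by
    ext; simp
  rw [this]
  exact (isClosed_domain _).inter (isClosed_biInter fun h _ => isClosed_bdry h)

variable (Y) in
lemma finite_setOf_isFace : {E | Y.IsFace E}.Finite := by
  have : {E | Y.IsFace E} ⊆ ⋃ i, (fun K : Finset ((Fin N → ℤ) × ℝ) =>
      {x | x ∈ domain (Y.constr i) ∧ ∀ h ∈ K, x ∈ bdry h}) '' (Y.constr i).powerset := by
    rintro E ⟨i, ⟨K, hK, rfl⟩, -⟩
    exact mem_iUnion.2 ⟨i, K, by simpa using hK, rfl⟩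
  exact (finite_iUnion fun i => (Finset.finite_toSet _).image _).subset this

/-- The tangent space of a face of a regular complex which reaches the stratum `𝕋°_I` contains
the divisorial directions, and projects onto the tangent space in that stratum. -/
lemma IsFace.tangent_infinity (hY : Y.IsRegular) {E : Set (TSpace N)} (hE : Y.IsFace E)
    {I : Finset (Fin N)} {u : Fin N → ℝ} (hu : emb I u ∈ E) :
    LinearMap.ker (divProj I) ≤ tangent ∅ E ∧ tangent I E = (tangent ∅ E).map (divProj I) := by
  refine ker_divProj_le_of_finrank ?_ ((hY E hE I).resolve_left
    (nonempty_iff_ne_empty.1 ⟨_, divProj_mem_slice hu⟩))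
  obtain ⟨i, ⟨K, -, rfl⟩, -⟩ := hE
  rw [Submodule.map_le_iff_le_comap]
  -- Sending the coordinates in `I` to `-∞` keeps a finite point in `E`: a condition satisfied at
  -- `emb I u` either holds by its coefficients in `I` alone or does not involve these coordinates.
  have key : ∀ x ∈ slice ∅ {x | x ∈ domain (Y.constr i) ∧ ∀ h ∈ K, x ∈ bdry h},
      divProj I x ∈ slice I {x | x ∈ domain (Y.constr i) ∧ ∀ h ∈ K, x ∈ bdry h} := by
    intro x hx
    refine divProj_mem_slice ⟨fun h hh => ?_, fun h hh => ?_⟩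
    · rw [emb_mem_halfSpace]
      refine (emb_mem_halfSpace.1 (hu.1 h hh)).imp_right fun h1 => ⟨h1.1, ?_⟩
      exact emb_empty_mem_domain.1 (mem_slice_empty.1 hx).1 h hh
    · rw [emb_mem_bdry]
      refine (emb_mem_bdry.1 (hu.2 h hh)).imp_right fun h1 => ⟨h1.1, ?_⟩
      exact emb_empty_mem_bdry.1 ((mem_slice_empty.1 hx).2 h hh)
  refine tangent_le fun x hx y hy => ?_
  rw [Submodule.mem_comap, map_sub]
  exact vsub_mem_vectorSpan ℝ (key x hx) (key y hy)

/-- By regularity the basis vectors in the directions `I` are tangent to `E`, and a form that is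
constant on `E` vanishes on them. -/
lemma IsFace.flat (hY : Y.IsRegular) {E : Set (TSpace N)} (hE : Y.IsFace E)
    {I : Finset (Fin N)} {u : Fin N → ℝ} (hu : emb I u ∈ E) {h : (Fin N → ℤ) × ℝ}
    (hb : E ⊆ bdry h) : ∀ l ∈ I, h.1 l = 0 := by
  intro l hl
  have := form_eq_zero_of_mem_tangent hb
    ((hE.tangent_infinity hY hu).1 (single_mem_ker_divProj hl))
  rw [form_single] at this
  exact_mod_cast this

lemma isMobileFace_inter_bdry {i : Fin Y.numFacets} {E : Set (TSpace N)}
    (hE : IsMobileFace (Y.constr i) E) {h : (Fin N → ℤ) × ℝ} (hh : h ∈ Y.constr i)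
    {x : Fin N → ℝ} (hx : emb ∅ x ∈ E) (hxh : form h.1 x = h.2) :
    IsMobileFace (Y.constr i) (E ∩ bdry h) := by
  classical
  obtain ⟨⟨K, hK, rfl⟩, -⟩ := hE
  refine ⟨⟨insert h K, Finset.insert_subset hh hK, ?_⟩,
    ⟨x, mem_slice_empty.2 ⟨hx, emb_empty_mem_bdry.2 hxh⟩⟩⟩
  ext z
  simp only [mem_inter_iff, mem_ofPred_eq, Finset.mem_insert, forall_eq_or_imp]
  tauto

/-- If a facet reaches the stratum `𝕋°_I`, then the defining half-spaces with a negative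
coefficient in the directions `I` are not active at any finite point. -/
lemma form_lt_of_neg (hY : Y.IsRegular) {i : Fin Y.numFacets} {I : Finset (Fin N)}
    {u : Fin N → ℝ} (hu : emb I u ∈ Y.facet i) {h : (Fin N → ℤ) × ℝ} (hh : h ∈ Y.constr i)
    {l : Fin N} (hl : l ∈ I) (hneg : h.1 l < 0) {x : Fin N → ℝ} (hx : emb ∅ x ∈ Y.facet i) :
    form h.1 x < h.2 := by
  refine lt_of_le_of_ne (emb_empty_mem_domain.1 hx h hh) fun heq => ?_
  -- If `h` were active at `x`, it would cut out a mobile face. This face also contains `emb I u`,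
  -- where both sides of `h` are `-∞`, so `IsFace.flat` contradicts the negative coefficient.
  have hF := isMobileFace_inter_bdry (isMobileFace_facet i) hh hx heq
  have hub : emb I u ∈ bdry h := by
    rw [emb_mem_bdry]
    rcases emb_mem_halfSpace.1 (hu h hh) with h1 | h1
    · exact Or.inl ⟨h1, l, hl, hneg⟩
    · exact absurd (h1.1 l hl) hneg.ne
  have := IsFace.flat hY ⟨i, hF⟩ ⟨hu, hub⟩ inter_subset_right l hl
  omega

end PolyComplex

/-- A domain is cut out in `ℝᴺ` by those half-spaces whose boundary it meets. -/
lemma mem_domain_of_forall_active {N : ℕ} {S : Finset ((Fin N → ℤ) × ℝ)}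
    {P : (Fin N → ℤ) × ℝ → Prop} {x₀ x : Fin N → ℝ} (hx₀ : emb ∅ x₀ ∈ domain S)
    (hP : ∀ h ∈ S, ¬ P h → ∀ z, emb ∅ z ∈ domain S → form h.1 z < h.2)
    (hx : ∀ h ∈ S, P h → form h.1 x ≤ h.2) : emb ∅ x ∈ domain S := by
  classical
  set B := S.filter fun h => ¬ P h with hB
  by_cases hne : B.Nonempty
  swap
  · rw [Finset.not_nonempty_iff_eq_empty] at hne
    refine emb_empty_mem_domain.2 fun h hh => hx h hh ?_
    by_contra hp
    have : h ∈ B := Finset.mem_filter.2 ⟨hh, hp⟩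
    simp [hne] at this
  let γ : ℝ → Fin N → ℝ := fun t => x₀ + t • (x - x₀)
  -- `g` is the largest violation of the never-active constraints along the segment from `x₀` to
  -- `x`. If `x` were outside, `g` would vanish somewhere, and there a never-active constraint would
  -- be active at a point of the domain.
  let g : ℝ → ℝ := fun t => B.sup' hne fun h => form h.1 (γ t) - h.2
  have hγ : Continuous γ := by fun_prop
  have hg : Continuous g := Continuous.finset_sup'_apply hne fun h _ =>
    ((continuous_form h.1).comp hγ).sub continuous_const
  have h0 : g 0 < 0 := by
    refine (Finset.sup'_lt_iff hne).2 fun h hh => ?_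
    have hh' := Finset.mem_filter.1 hh
    have := hP h hh'.1 hh'.2 x₀ hx₀
    simpa [γ] using this
  by_contra hcon
  have h1 : 0 ≤ g 1 := by
    by_contra hlt
    push Not at hlt
    refine hcon (emb_empty_mem_domain.2 fun h hh => ?_)
    by_cases hp : P h
    · exact hx h hh hp
    · have := (Finset.sup'_lt_iff hne).1 hlt h (Finset.mem_filter.2 ⟨hh, hp⟩)
      simp only [γ, one_smul, add_sub_cancel] at this
      linarith
  obtain ⟨t, ht, hgt⟩ := intermediate_value_Icc (zero_le_one' ℝ) hg.continuousOn
    (show (0 : ℝ) ∈ Icc (g 0) (g 1) from ⟨h0.le, h1⟩)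
  have hmem : emb ∅ (γ t) ∈ domain S := by
    refine emb_empty_mem_domain.2 fun h hh => ?_
    by_cases hp : P h
    · have e1 := emb_empty_mem_domain.1 hx₀ h hh
      have e2 := hx h hh hp
      simp only [γ, map_add, map_smul, map_sub, smul_eq_mul]
      nlinarith [ht.1, ht.2, mul_nonneg ht.1 (sub_nonneg.2 e2),
        mul_nonneg (sub_nonneg.2 ht.2) (sub_nonneg.2 e1)]
    · have := Finset.le_sup' (fun h => form h.1 (γ t) - h.2)
        (show h ∈ B from Finset.mem_filter.2 ⟨hh, hp⟩)
      have hgt' : B.sup' hne (fun h => form h.1 (γ t) - h.2) = 0 := hgt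
      rw [hgt'] at this
      linarith
  obtain ⟨h, hh, heq⟩ := Finset.exists_mem_eq_sup' hne fun h => form h.1 (γ t) - h.2
  have hgt' : B.sup' hne (fun h => form h.1 (γ t) - h.2) = 0 := hgt
  have hh' := Finset.mem_filter.1 hh
  have := hP h hh'.1 hh'.2 _ hmem
  linarith

namespace PolyComplex

variable {N : ℕ} {Y : PolyComplex N}

/-- Points near the stratum `𝕋°_I`, which is reached by a facet, are in this facet as soon as
they satisfy the inequalities without negative coefficients in the directions `I`. -/
lemma eventually_lift_mem_facet (hY : Y.IsRegular) {i : Fin Y.numFacets} {I J : Finset (Fin N)}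
    (hJ : J ⊆ I) {u₀ u : Fin N → ℝ} (hu₀ : emb I u₀ ∈ Y.facet i)
    (hu : ∀ h ∈ Y.constr i, (∀ l ∈ I, 0 ≤ h.1 l) → (∃ l ∈ J, 0 < h.1 l) ∨ form h.1 u ≤ h.2) :
    ∀ᶠ R in atTop, emb ∅ (lift J R u) ∈ Y.facet i := by
  obtain ⟨x₀, hx₀⟩ := Y.facet_nonempty i
  have key : ∀ h ∈ Y.constr i, ∀ᶠ R in atTop,
      (∀ l ∈ I, 0 ≤ h.1 l) → form h.1 (lift J R u) ≤ h.2 := by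
    intro h hh
    by_cases h0 : ∀ l ∈ I, 0 ≤ h.1 l
    · by_cases hp : ∃ l ∈ J, 0 < h.1 l
      · filter_upwards [eventually_form_lift_lt (fun l hl => h0 l (hJ hl)) hp u h.2] with R hR _
        exact hR.le
      · have hf : ∀ l ∈ J, h.1 l = 0 := fun l hl => by
          by_contra hne
          exact hp ⟨l, hl, lt_of_le_of_ne (h0 l (hJ hl)) (Ne.symm hne)⟩
        refine Eventually.of_forall fun R _ => ?_
        rw [form_lift_of_flat R hf]
        exact (hu h hh h0).resolve_left hp
    · exact Eventually.of_forall fun R h1 => absurd h1 h0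
  filter_upwards [(eventually_all_finset (Y.constr i)).2 key] with R hR
  refine mem_domain_of_forall_active (P := fun h => ∀ l ∈ I, 0 ≤ h.1 l) (mem_slice_empty.1 hx₀)
    (fun h hh hn z hz => ?_) hR
  push Not at hn
  obtain ⟨l, hl, hneg⟩ := hn
  exact form_lt_of_neg hY hu₀ hh hl hneg hz

lemma eventually_lift_mem_facet_of_flat (hY : Y.IsRegular) {i : Fin Y.numFacets}
    {I : Finset (Fin N)} {u₀ u : Fin N → ℝ} (hu₀ : emb I u₀ ∈ Y.facet i)
    (hu : ∀ h ∈ Y.constr i, (∀ l ∈ I, h.1 l = 0) → form h.1 u ≤ h.2) :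
    ∀ᶠ R in atTop, emb ∅ (lift I R u) ∈ Y.facet i := by
  refine eventually_lift_mem_facet hY subset_rfl hu₀ fun h hh h0 => ?_
  by_cases hp : ∃ l ∈ I, 0 < h.1 l
  · exact Or.inl hp
  · push Not at hp
    exact Or.inr (hu h hh fun l hl => le_antisymm (hp l hl) (h0 l hl))

lemma form_le_of_emb_mem {i : Fin Y.numFacets} {I : Finset (Fin N)} {u : Fin N → ℝ}
    (hu : emb I u ∈ Y.facet i) {h : (Fin N → ℤ) × ℝ} (hh : h ∈ Y.constr i)
    (hf : ∀ l ∈ I, h.1 l = 0) : form h.1 u ≤ h.2 := by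
  rcases emb_mem_halfSpace.1 (hu h hh) with ⟨l, hl, hpos⟩ | h1
  · exact absurd (hf l hl) hpos.ne'
  · exact h1.2

/-- The activity of a constraint at a lift of a point of a facet. -/
lemma eventually_form_lift_eq_iff (hY : Y.IsRegular) {i : Fin Y.numFacets} {I : Finset (Fin N)}
    {u : Fin N → ℝ} (hu : emb I u ∈ Y.facet i) {h : (Fin N → ℤ) × ℝ} (hh : h ∈ Y.constr i) :
    ∀ᶠ R in atTop, (form h.1 (lift I R u) = h.2 ↔ (∀ l ∈ I, h.1 l = 0) ∧ form h.1 u = h.2) := by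
  by_cases h0 : ∀ l ∈ I, h.1 l = 0
  · refine Eventually.of_forall fun R => ?_
    rw [form_lift_of_flat R h0]
    tauto
  · have key : ∀ᶠ R in atTop, form h.1 (lift I R u) < h.2 := by
      by_cases hn : ∃ l ∈ I, h.1 l < 0
      · obtain ⟨l, hl, hneg⟩ := hn
        filter_upwards [eventually_lift_mem_facet_of_flat hY hu
          fun h hh hf => form_le_of_emb_mem hu hh hf] with R hR
        exact form_lt_of_neg hY hu hh hl hneg hR
      · push Not at hn
        refine eventually_form_lift_lt hn ?_ u h.2
        by_contra hp
        push Not at hp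
        exact h0 fun l hl => le_antisymm (hp l hl) (hn l hl)
    filter_upwards [key] with R hR
    exact iff_of_false hR.ne fun h1 => h0 h1.1

end PolyComplex

/-! ## Relative interiors and rationality of tangent spaces -/

section Rational

variable {N : ℕ}

/-- A finite point of a domain at which only those constraints are active that are active on the
whole domain. -/
lemma exists_relInt {S : Finset ((Fin N → ℤ) × ℝ)} (hS : (slice ∅ (domain S)).Nonempty) :
    ∃ x₀, emb ∅ x₀ ∈ domain S ∧ ∀ h ∈ S, form h.1 x₀ = h.2 →
      ∀ x, emb ∅ x ∈ domain S → form h.1 x = h.2 := by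
  classical
  suffices H : ∀ S' ⊆ S, ∃ x₀, emb ∅ x₀ ∈ domain S ∧ ∀ h ∈ S', form h.1 x₀ = h.2 →
      ∀ x, emb ∅ x ∈ domain S → form h.1 x = h.2 from H S subset_rfl
  intro S'
  induction S' using Finset.induction_on with
  | empty =>
    intro _
    obtain ⟨x, hx⟩ := hS
    exact ⟨x, mem_slice_empty.1 hx, by simp⟩
  | insert g S' _ ih =>
    intro hsub
    rw [Finset.insert_subset_iff] at hsub
    obtain ⟨x₀, hx₀, h₀⟩ := ih hsub.2
    by_cases hg : ∀ x, emb ∅ x ∈ domain S → form g.1 x = g.2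
    · refine ⟨x₀, hx₀, fun h hh => ?_⟩
      rcases Finset.mem_insert.1 hh with rfl | hh
      · exact fun _ => hg
      · exact h₀ h hh
    · push Not at hg
      obtain ⟨z, hz, hzg⟩ := hg
      have hle := emb_empty_mem_domain.1 hx₀
      have hlez := emb_empty_mem_domain.1 hz
      have hform : ∀ j : Fin N → ℤ, form j ((1 / 2 : ℝ) • (x₀ + z)) =
          (form j x₀ + form j z) / 2 := fun j => by
        simp only [map_smul, map_add, smul_eq_mul]
        ring
      -- A constraint active at the midpoint is active at both ends, so the midpoint keeps the slack
      -- of `x₀` and gains that of `z`.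
      refine ⟨(1 / 2 : ℝ) • (x₀ + z), emb_empty_mem_domain.2 fun h hh => ?_, fun h hh heq => ?_⟩
      · rw [hform]
        linarith [hle h hh, hlez h hh]
      · rw [hform] at heq
        rcases Finset.mem_insert.1 hh with rfl | hh'
        · have := lt_of_le_of_ne (hlez h hsub.1) hzg
          linarith [hle h hsub.1]
        · refine h₀ h hh' ?_
          linarith [hle h (hsub.2 hh'), hlez h (hsub.2 hh')]

lemma eventually_form_add_le {h : (Fin N → ℤ) × ℝ} {u v : Fin N → ℝ} (hu : form h.1 u ≤ h.2)
    (hv : form h.1 u = h.2 → form h.1 v ≤ 0) :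
    ∀ᶠ ε : ℝ in 𝓝[>] 0, form h.1 (u + ε • v) ≤ h.2 := by
  rcases hu.lt_or_eq with hlt | heq
  · have : Continuous fun ε : ℝ => form h.1 (u + ε • v) :=
      (continuous_form _).comp (by fun_prop)
    have h0 : form h.1 (u + (0 : ℝ) • v) < h.2 := by simpa using hlt
    filter_upwards [nhdsWithin_le_nhds (this.continuousAt.eventually_lt_const h0)] with ε hε
    exact hε.le
  · filter_upwards [self_mem_nhdsWithin] with ε hε
    simp only [map_add, map_smul, smul_eq_mul, heq]
    nlinarith [hv heq, mem_Ioi.1 hε]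

/-- The tangent space of a domain is the common kernel of the forms constant on the domain. -/
lemma mem_tangent_domain_iff {S : Finset ((Fin N → ℤ) × ℝ)}
    (hS : (slice ∅ (domain S)).Nonempty) {v : Fin N → ℝ} :
    v ∈ tangent ∅ (domain S) ↔
      ∀ h ∈ S, (∀ x, emb ∅ x ∈ domain S → form h.1 x = h.2) → form h.1 v = 0 := by
  constructor
  · intro hv h _ hx
    have : tangent ∅ (domain S) ≤ LinearMap.ker (form h.1) := by
      refine tangent_le fun x hx' y hy => ?_
      simp [hx x (mem_slice_empty.1 hx'), hx y (mem_slice_empty.1 hy)]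
    exact this hv
  · intro hv
    obtain ⟨x₀, hx₀, h₀⟩ := exists_relInt hS
    have key : ∀ h ∈ S, ∀ᶠ ε : ℝ in 𝓝[>] 0, form h.1 (x₀ + ε • v) ≤ h.2 := fun h hh =>
      eventually_form_add_le (emb_empty_mem_domain.1 hx₀ h hh)
        fun heq => (hv h hh (h₀ h hh heq)).le
    obtain ⟨ε, hε, hpos⟩ := (((eventually_all_finset S).2 key).and self_mem_nhdsWithin).exists
    have := sub_mem_tangent (emb_empty_mem_domain.2 hε) hx₀
    rw [add_sub_cancel_left] at this
    exact (Submodule.smul_mem_iff _ (ne_of_gt (mem_Ioi.1 hpos))).1 this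

/-- A real solution of a homogeneous system of linear equations with integer coefficients is a
linear combination of integer solutions. -/
lemma mem_span_realVec_of_form_eq_zero {ι : Type*} (j : ι → Fin N → ℤ) {v : Fin N → ℝ}
    (hv : ∀ a, form (j a) v = 0) :
    v ∈ Submodule.span ℝ (realVec '' {w | ∀ a, form (j a) (realVec w) = 0}) := by
  classical
  -- Expanding the coordinates of `v` in a `ℚ`-basis of `ℝ` splits `v` into real multiples of
  -- rational vectors. The equations have integer coefficients, so each of these vectors solves
  -- them, and clearing denominators makes it integral.
  let b := Module.Basis.ofVectorSpace ℚ ℝ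
  let s := Finset.univ.biUnion fun i => (b.repr (v i)).support
  have hsum : ∀ i, v i = ∑ l ∈ s, ((b.repr (v i) l : ℚ) : ℝ) * b l := by
    intro i
    conv_lhs => rw [← b.linearCombination_repr (v i)]
    rw [Finsupp.linearCombination_apply, Finsupp.sum_of_support_subset (s := s)]
    · exact Finset.sum_congr rfl fun l _ => by rw [Rat.smul_def]
    · exact Finset.subset_biUnion_of_mem (fun i => (b.repr (v i)).support) (Finset.mem_univ i)
    · simp
  have hv' : v = ∑ l ∈ s, (b l : ℝ) • fun i => ((b.repr (v i) l : ℚ) : ℝ) := by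
    funext i
    rw [Finset.sum_apply, hsum i]
    refine Finset.sum_congr rfl fun l _ => ?_
    rw [Pi.smul_apply, smul_eq_mul, mul_comm]
  have hzero : ∀ l a, ∑ i, (j a i : ℚ) * b.repr (v i) l = 0 := by
    intro l a
    have h1 := hv a
    rw [form_apply] at h1
    have h2 : b.repr (∑ i, (j a i : ℝ) * v i) l = 0 := by rw [h1]; simp
    rw [← h2, map_sum, Finsupp.finsetSum_apply]
    refine Finset.sum_congr rfl fun i _ => ?_
    have : (j a i : ℝ) * v i = (j a i : ℚ) • v i := by
      rw [Rat.smul_def]; simp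
    rw [this, map_smul]
    rfl
  rw [hv']
  refine Submodule.sum_mem _ fun l _ => Submodule.smul_mem _ _ ?_
  let q : Fin N → ℚ := fun i => b.repr (v i) l
  obtain ⟨d, hd⟩ := IsLocalization.exist_integer_multiples_of_finset (nonZeroDivisors ℤ)
    (Finset.univ.image q)
  have hd' : ∀ i, ∃ z : ℤ, (z : ℚ) = (d : ℤ) * q i := by
    intro i
    obtain ⟨z, hz⟩ := hd (q i) (Finset.mem_image_of_mem _ (Finset.mem_univ i))
    exact ⟨z, by simpa using hz⟩
  choose z hz using hd'
  have hd0 : ((d : ℤ) : ℝ) ≠ 0 := by exact_mod_cast nonZeroDivisors.coe_ne_zero d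
  have hzr : realVec z = ((d : ℤ) : ℝ) • fun i => ((q i : ℚ) : ℝ) := by
    funext i
    have : ((z i : ℚ) : ℝ) = (((d : ℤ) * q i : ℚ) : ℝ) := by rw [hz i]
    simpa [realVec] using this
  have hmem : realVec z ∈ Submodule.span ℝ
      (realVec '' {w | ∀ a, form (j a) (realVec w) = 0}) := by
    refine Submodule.subset_span ⟨z, fun a => ?_, rfl⟩
    rw [hzr, map_smul, form_apply]
    have := hzero l a
    have h3 : ((∑ i, (j a i : ℚ) * q i : ℚ) : ℝ) = 0 := by rw [this]; simp
    push_cast at h3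
    rw [h3, smul_zero]
  rw [hzr] at hmem
  exact (Submodule.smul_mem_iff _ hd0).1 hmem

/-- The tangent space is the solution space of the integer equations coming from the constraints
active on the whole domain. This rationality lets real wave vectors multiply lattice multivectors.
-/
lemma tangent_domain_le_span {S : Finset ((Fin N → ℤ) × ℝ)}
    (hS : (slice ∅ (domain S)).Nonempty) :
    tangent ∅ (domain S) ≤
      Submodule.span ℝ (realVec '' {w | realVec w ∈ tangent ∅ (domain S)}) := by
  intro v hv
  have := mem_span_realVec_of_form_eq_zero
    (j := fun h : {h // h ∈ S ∧ ∀ x, emb ∅ x ∈ domain S → form h.1 x = h.2} => h.1.1)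
    (v := v) fun h => (mem_tangent_domain_iff hS).1 hv h.1 h.2.1 h.2.2
  refine Submodule.span_mono (image_mono fun w hw => ?_) this
  exact (mem_tangent_domain_iff hS).2 fun h hh hx => hw ⟨h, hh, hx⟩

lemma divProj_realVec (I : Finset (Fin N)) (w : Fin N → ℤ) :
    divProj I (realVec w) = realVec fun i => if i ∈ I then 0 else w i := by
  funext i
  rw [divProj_apply]
  simp only [realVec]
  split_ifs <;> simp

end Rational

namespace PolyComplex

variable {N : ℕ} {Y : PolyComplex N}

lemma tangent_facet_le_span (hY : Y.IsRegular) {i : Fin Y.numFacets} {I : Finset (Fin N)}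
    {u : Fin N → ℝ} (hu : emb I u ∈ Y.facet i) :
    tangent I (Y.facet i) ≤
      Submodule.span ℝ (realVec '' {w | realVec w ∈ tangent I (Y.facet i)}) := by
  rw [((isFace_facet i).tangent_infinity hY hu).2]
  refine (Submodule.map_mono (tangent_domain_le_span (Y.facet_nonempty i))).trans ?_
  rw [Submodule.map_span, Submodule.span_le]
  rintro _ ⟨_, ⟨w, hw, rfl⟩, rfl⟩
  rw [divProj_realVec]
  refine Submodule.subset_span ⟨_, ?_, rfl⟩
  rw [mem_ofPred_eq, ← divProj_realVec]
  exact Submodule.mem_map_of_mem hw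

end PolyComplex

/-! ## Local cones and their lineality spaces -/

/-- The directions allowed by the constraints which are active at a point of the stratum `𝕋°_I`
and do not involve the directions `I`. -/
def activeCone {N : ℕ} (S : Finset ((Fin N → ℤ) × ℝ)) (I : Finset (Fin N)) (u : Fin N → ℝ) :
    Set (Fin N → ℝ) :=
  {v | ∀ h ∈ S, (∀ l ∈ I, h.1 l = 0) → form h.1 u = h.2 → form h.1 v ≤ 0}

/-- The largest linear space along which a set is invariant. -/
def linealitySpace {V : Type*} [AddCommGroup V] [Module ℝ V] (C : Set V) : Submodule ℝ V where
  carrier := {v | ∀ u ∈ C, ∀ t : ℝ, u + t • v ∈ C}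
  zero_mem' := by
    intro u hu t
    simpa using hu
  add_mem' := by
    intro v w hv hw u hu t
    have h := hw _ (hv u hu t) t
    rwa [add_assoc, ← smul_add] at h
  smul_mem' := by
    intro c v hv u hu t
    have h := hv u hu (t * c)
    rwa [mul_smul] at h

lemma add_mem_of_mem_linealitySpace {V : Type*} [AddCommGroup V] [Module ℝ V] {C : Set V} {u w : V}
    (hu : u ∈ C) (hw : w ∈ linealitySpace C) : u + w ∈ C := by
  simpa using hw u hu 1

lemma frequently_exists_of_finite {α ι : Type*} [Finite ι] {l : Filter α} {p : ι → α → Prop}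
    (h : ∃ᶠ x in l, ∃ i, p i x) : ∃ i, ∃ᶠ x in l, p i x := by
  by_contra hcon
  push Not at hcon
  refine h ?_
  filter_upwards [eventually_all.2 hcon] with x hx
  simpa using hx

lemma form_le_zero_of_frequently {N : ℕ} {j : Fin N → ℤ} {u v : Fin N → ℝ}
    (h : ∃ᶠ ε : ℝ in 𝓝[>] 0, form j (u + ε • v) ≤ 0) :
    form j u ≤ 0 ∧ (form j u = 0 → form j v ≤ 0) := by
  constructor
  · by_contra hlt
    push Not at hlt
    have hc : Continuous fun ε : ℝ => form j (u + ε • v) := (continuous_form _).comp (by fun_prop)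
    have h0 : 0 < form j (u + (0 : ℝ) • v) := by simpa using hlt
    refine h ?_
    filter_upwards [nhdsWithin_le_nhds (hc.continuousAt.eventually_const_lt h0)] with ε hε
    exact not_le.2 hε
  · intro h0
    obtain ⟨ε, hε, hpos⟩ := (h.and_eventually self_mem_nhdsWithin).exists
    simp only [map_add, h0, zero_add, map_smul, smul_eq_mul] at hε
    exact nonpos_of_mul_nonpos_right hε (mem_Ioi.1 hpos)

lemma form_realPart_emb {N : ℕ} {I : Finset (Fin N)} {j : Fin N → ℤ} (hj : ∀ l ∈ I, j l = 0)
    (u : Fin N → ℝ) : form j (realPart (emb I u)) = form j u :=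
  form_congr hj fun i hi => by simp [realPart, emb, hi]

namespace PolyComplex

variable {N : ℕ} {Y : PolyComplex N}

variable (Y) in
/-- The union of the cones of the facets at `y`, invariant in the divisorial directions. -/
def localCone (y : TSpace N) : Set (Fin N → ℝ) :=
  {v | ∃ i, y ∈ Y.facet i ∧ v ∈ activeCone (Y.constr i) (sed y) (realPart y)}

lemma mem_localCone_emb {I : Finset (Fin N)} {u v : Fin N → ℝ} :
    v ∈ Y.localCone (emb I u) ↔ ∃ i, emb I u ∈ Y.facet i ∧ v ∈ activeCone (Y.constr i) I u := by
  refine exists_congr fun i => and_congr_right fun _ => ?_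
  simp only [activeCone, sed_emb, mem_ofPred_eq]
  refine forall₂_congr fun h _ => forall_congr' fun hf => ?_
  rw [form_realPart_emb hf]

lemma smul_mem_localCone {y : TSpace N} {v : Fin N → ℝ} (hv : v ∈ Y.localCone y) {c : ℝ}
    (hc : 0 ≤ c) : c • v ∈ Y.localCone y := by
  obtain ⟨i, hi, h⟩ := hv
  refine ⟨i, hi, fun g hg hf ha => ?_⟩
  rw [map_smul, smul_eq_mul]
  exact mul_nonpos_of_nonneg_of_nonpos hc (h g hg hf ha)

lemma zero_mem_localCone {y : TSpace N} (hy : y ∈ Y.support) : 0 ∈ Y.localCone y := by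
  obtain ⟨i, hi⟩ := mem_iUnion.1 hy
  exact ⟨i, hi, fun g _ _ _ => by simp⟩

lemma mem_facet_iff_emb {y : TSpace N} {i : Fin Y.numFacets} :
    y ∈ Y.facet i ↔ emb (sed y) (realPart y) ∈ Y.facet i := by rw [emb_realPart]

lemma facet_inter_facet {y : TSpace N} {i k : Fin Y.numFacets} (hi : y ∈ Y.facet i)
    (hk : y ∈ Y.facet k) : IsMobileFace (Y.constr i) (Y.facet i ∩ Y.facet k) := by
  classical
  have h := Y.inter_isFace {i, k} (by simp)
  have he : (⋂ j ∈ ({i, k} : Finset (Fin Y.numFacets)), domain (Y.constr j)) =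
      Y.facet i ∩ Y.facet k := by
    ext z
    simp [facet]
  rw [he] at h
  rcases h with h | h
  · exact absurd (show y ∈ Y.facet i ∩ Y.facet k from ⟨hi, hk⟩) (h ▸ notMem_empty y)
  · exact h i (by simp)

/-! ## Specialisation of nearby points -/

variable (Y) in
/-- A point `y'` which is so close to `y` that closed conditions at `y'` hold at `y`. -/
structure Near (y y' : TSpace N) : Prop where
  sed_subset : sed y' ⊆ sed y
  facet_mem : ∀ i, y' ∈ Y.facet i → y ∈ Y.facet i
  strict : ∀ i, ∀ h ∈ Y.constr i, StrictAt h y → StrictAt h y'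

variable (Y) in
lemma eventually_near (y : TSpace N) : ∀ᶠ y' in 𝓝 y, Y.Near y y' := by
  have h1 : ∀ᶠ y' : TSpace N in 𝓝 y, ∀ i, y i ≠ ⊥ → y' i ≠ ⊥ := by
    refine eventually_all.2 fun i => ?_
    by_cases hi : y i = ⊥
    · exact Eventually.of_forall fun _ h => absurd hi h
    · filter_upwards [(continuous_apply i).continuousAt.eventually_ne hi] with y' hy' _
      exact hy'
  have h2 : ∀ᶠ y' : TSpace N in 𝓝 y, ∀ i, y' ∈ Y.facet i → y ∈ Y.facet i := by
    refine eventually_all.2 fun i => ?_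
    by_cases hi : y ∈ Y.facet i
    · exact Eventually.of_forall fun _ _ => hi
    · filter_upwards [(isClosed_domain (Y.constr i)).isOpen_compl.mem_nhds hi] with y' hy' h
      exact absurd h hy'
  have h3 : ∀ᶠ y' : TSpace N in 𝓝 y, ∀ i, ∀ h ∈ Y.constr i, StrictAt h y → StrictAt h y' := by
    refine eventually_all.2 fun i => (eventually_all_finset _).2 fun h _ => ?_
    by_cases hs : StrictAt h y
    · filter_upwards [(isOpen_strictAt h).mem_nhds hs] with y' hy' _
      exact hy'
    · exact Eventually.of_forall fun _ h' => absurd h' hs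
  filter_upwards [h1, h2, h3] with y' h1 h2 h3
  refine ⟨fun i hi => ?_, h2, h3⟩
  simp only [sed, Finset.mem_filter, Finset.mem_univ, true_and] at hi ⊢
  by_contra hne
  exact h1 i hne hi

lemma strictAt_of_not_active {y : TSpace N} {i : Fin Y.numFacets} (hi : y ∈ Y.facet i)
    {h : (Fin N → ℤ) × ℝ} (hh : h ∈ Y.constr i) (h0 : ∀ l ∈ sed y, 0 ≤ h.1 l)
    (hna : ¬ ((∀ l ∈ sed y, h.1 l = 0) ∧ form h.1 (realPart y) = h.2)) : StrictAt h y := by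
  rw [← emb_realPart y, strictAt_emb]
  refine ⟨h0, ?_⟩
  by_cases hf : ∀ l ∈ sed y, h.1 l = 0
  · exact Or.inr (lt_of_le_of_ne (form_le_of_emb_mem (mem_facet_iff_emb.1 hi) hh hf)
      fun h1 => hna ⟨hf, h1⟩)
  · push Not at hf
    obtain ⟨l, hl, hne⟩ := hf
    exact Or.inl ⟨l, hl, lt_of_le_of_ne (h0 l hl) hne.symm⟩

/-- If the coefficients in `sed y` are nonnegative, a constraint not active at `y` is strict there,
and strictness passes to `y'`. If one of them is negative, a finite lift of `y'` in the facet would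
make the constraint active, against `form_lt_of_neg`. -/
lemma Near.active (hY : Y.IsRegular) {y y' : TSpace N} (hn : Y.Near y y') {i : Fin Y.numFacets}
    (hi' : y' ∈ Y.facet i) {h : (Fin N → ℤ) × ℝ} (hh : h ∈ Y.constr i)
    (hf : ∀ l ∈ sed y', h.1 l = 0) (ha : form h.1 (realPart y') = h.2) :
    (∀ l ∈ sed y, h.1 l = 0) ∧ form h.1 (realPart y) = h.2 := by
  have hi := hn.facet_mem i hi'
  by_cases h0 : ∀ l ∈ sed y, 0 ≤ h.1 l
  · by_contra hna
    have hs := hn.strict i h hh (strictAt_of_not_active hi hh h0 hna)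
    rw [← emb_realPart y', strictAt_emb] at hs
    rcases hs.2 with ⟨l, hl, hpos⟩ | hlt
    · exact hpos.ne' (hf l hl)
    · exact hlt.ne ha
  · push Not at h0
    obtain ⟨l, hl, hneg⟩ := h0
    obtain ⟨R, hR⟩ := (eventually_lift_mem_facet_of_flat hY (mem_facet_iff_emb.1 hi')
      fun h hh hf => form_le_of_emb_mem (mem_facet_iff_emb.1 hi') hh hf).exists
    have := form_lt_of_neg hY (mem_facet_iff_emb.1 hi) hh hl hneg hR
    rw [form_lift_of_flat R hf] at this
    exact absurd ha this.ne

/-- Constraints strict at `y` are strict at `y'`, and those with a negative coefficient in `sed y`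
can be dropped for finite points. What remains is tested by `hle`; the finite lifts of `y'` then lie
in the facet, which is closed. -/
lemma Near.mem_facet (hY : Y.IsRegular) {y y' : TSpace N} (hn : Y.Near y y') {i : Fin Y.numFacets}
    (hi : y ∈ Y.facet i) (hle : ∀ h ∈ Y.constr i, (∀ l ∈ sed y, h.1 l = 0) →
      form h.1 (realPart y) = h.2 → form h.1 (realPart y') ≤ h.2) : y' ∈ Y.facet i := by
  have hev := eventually_lift_mem_facet hY hn.sed_subset (mem_facet_iff_emb.1 hi)
    (u := realPart y') fun h hh h0 => by
      by_cases hact : (∀ l ∈ sed y, h.1 l = 0) ∧ form h.1 (realPart y) = h.2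
      · exact Or.inr (hle h hh hact.1 hact.2)
      · have hs := hn.strict i h hh (strictAt_of_not_active hi hh h0 hact)
        rw [← emb_realPart y', strictAt_emb] at hs
        exact hs.2.imp_right le_of_lt
  have := (isClosed_domain (Y.constr i)).mem_of_tendsto
    (tendsto_emb_lift (sed y') (realPart y')) hev
  rwa [emb_realPart] at this

/-- One of the finitely many facets occurs for arbitrarily small `ε`; its inequalities in the limit
put `y'` into the facet, and to first order put `v` into its cone. The default value `0` of
`realPart` at infinite coordinates is harmless, since the forms evaluated here do not involve them.
With `Near.eventually_mem_localCone` this computes the cone at `y'` from the cone at `y`. -/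
lemma Near.mem_localCone_of_frequently (hY : Y.IsRegular) {y y' : TSpace N} (hn : Y.Near y y')
    {v : Fin N → ℝ}
    (h : ∃ᶠ ε : ℝ in 𝓝[>] 0, (realPart y' - realPart y) + ε • v ∈ Y.localCone y) :
    v ∈ Y.localCone y' := by
  obtain ⟨i, hi⟩ := frequently_exists_of_finite h
  have hy : y ∈ Y.facet i := hi.exists.choose_spec.1
  have key : ∀ g ∈ Y.constr i, (∀ l ∈ sed y, g.1 l = 0) → form g.1 (realPart y) = g.2 →
      form g.1 (realPart y' - realPart y) ≤ 0 ∧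
        (form g.1 (realPart y' - realPart y) = 0 → form g.1 v ≤ 0) := fun g hg hf ha =>
    form_le_zero_of_frequently (hi.mono fun ε hε => hε.2 g hg hf ha)
  have hy' : y' ∈ Y.facet i := hn.mem_facet hY hy fun g hg hf ha => by
    have := (key g hg hf ha).1
    rw [map_sub] at this
    linarith
  refine ⟨i, hy', fun g hg hf ha => ?_⟩
  have hact := hn.active hY hy' hg hf ha
  refine (key g hg hact.1 hact.2).2 ?_
  rw [map_sub, ha, hact.2, sub_self]

lemma Near.eventually_mem_localCone {y y' : TSpace N} (hn : Y.Near y y')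
    {v : Fin N → ℝ} (hv : v ∈ Y.localCone y') :
    ∀ᶠ ε : ℝ in 𝓝[>] 0, (realPart y' - realPart y) + ε • v ∈ Y.localCone y := by
  obtain ⟨i, hi', hv⟩ := hv
  have key : ∀ g ∈ Y.constr i, ∀ᶠ ε : ℝ in 𝓝[>] 0, (∀ l ∈ sed y, g.1 l = 0) →
      form g.1 (realPart y) = g.2 → form g.1 ((realPart y' - realPart y) + ε • v) ≤ 0 := by
    intro g hg
    by_cases hf : ∀ l ∈ sed y, g.1 l = 0
    · have hf' : ∀ l ∈ sed y', g.1 l = 0 := fun l hl => hf l (hn.sed_subset hl)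
      filter_upwards [eventually_form_add_le (form_le_of_emb_mem (mem_facet_iff_emb.1 hi') hg hf')
        (hv g hg hf')] with ε hε _ ha
      rw [sub_add_eq_add_sub, map_sub]
      linarith
    · exact Eventually.of_forall fun _ h1 => absurd h1 hf
  filter_upwards [(eventually_all_finset _).2 key] with ε hε
  exact ⟨i, hn.facet_mem i hi', hε⟩

/-- A translation of `v` by `t • w` is a translation of `(y' - y) + ε • v` by `(ε * t) • w`, which
stays in the cone at `y`. This is the source of the inclusion `W_k(τ) → W_k(σ)`. -/
lemma Near.linealitySpace_le (hY : Y.IsRegular) {y y' : TSpace N} (hn : Y.Near y y') :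
    linealitySpace (Y.localCone y) ≤ linealitySpace (Y.localCone y') := by
  intro w hw v hv t
  refine hn.mem_localCone_of_frequently hY (Eventually.frequently ?_)
  filter_upwards [hn.eventually_mem_localCone hv] with ε hε
  have := hw _ hε (ε * t)
  rwa [add_assoc, mul_smul, ← smul_add] at this

/-- Constraints active at `y'` are active at `y` as well, so their forms vanish on `y' - y`. -/
lemma Near.sub_mem_linealitySpace (hY : Y.IsRegular) {y y' : TSpace N} (hn : Y.Near y y') :
    realPart y' - realPart y ∈ linealitySpace (Y.localCone y') := by
  rintro v ⟨i, hi', hv⟩ t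
  refine ⟨i, hi', fun g hg hf ha => ?_⟩
  have hact := hn.active hY hi' hg hf ha
  rw [map_add, map_smul, map_sub, ha, hact.2, sub_self, smul_zero, add_zero]
  exact hv g hg hf ha

/-- Nearby points with lineality spaces of the same dimension have the same local cone. -/
lemma Near.localCone_eq (hY : Y.IsRegular) {y y' : TSpace N} (hn : Y.Near y y')
    (he : linealitySpace (Y.localCone y) = linealitySpace (Y.localCone y')) :
    Y.localCone y = Y.localCone y' := by
  have hu := hn.sub_mem_linealitySpace hY
  -- Now `y' - y` is a lineality direction of the cone at `y` too, so adding or removing it does not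
  -- leave that cone.
  rw [← he] at hu
  refine Subset.antisymm (fun v hv => ?_) (fun v hv => ?_)
  · refine hn.mem_localCone_of_frequently hY (Eventually.frequently ?_)
    filter_upwards [self_mem_nhdsWithin] with ε hε
    rw [add_comm]
    exact add_mem_of_mem_linealitySpace (smul_mem_localCone hv (le_of_lt (mem_Ioi.1 hε))) hu
  · obtain ⟨ε, hε, hpos⟩ := ((hn.eventually_mem_localCone hv).and self_mem_nhdsWithin).exists
    have h1 := add_mem_of_mem_linealitySpace hε (Submodule.neg_mem _ hu)
    rw [add_neg_cancel_comm] at h1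
    have h2 := smul_mem_localCone h1 (inv_nonneg.2 (le_of_lt (mem_Ioi.1 hpos)))
    rwa [smul_smul, inv_mul_cancel₀ (ne_of_gt (mem_Ioi.1 hpos)), one_smul] at h2

/-! ## The wave tangent space -/

variable (Y) in
lemma tangentCone_emb_empty (p : Fin N → ℝ) :
    Y.tangentCone (emb ∅ p) = Y.localCone (emb ∅ p) := by
  have he : ∀ (ε : ℝ) (v : Fin N → ℝ),
      (fun i => emb ∅ p i + ((ε * v i : ℝ) : WithBot ℝ)) = emb ∅ (p + ε • v) := by
    intro ε v
    funext i
    simp [emb]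
  ext v
  rw [mem_localCone_emb]
  simp only [tangentCone, sed_emb, mem_ofPred_eq, he]
  constructor
  · rintro ⟨-, ε₀, hε₀, h⟩
    have hf : ∃ᶠ ε : ℝ in 𝓝[>] 0, ∃ i, emb ∅ (p + ε • v) ∈ Y.facet i := by
      refine Eventually.frequently ?_
      filter_upwards [Ioo_mem_nhdsGT hε₀] with ε hε
      exact mem_iUnion.1 (h ε hε.1 hε.2)
    obtain ⟨i, hi⟩ := frequently_exists_of_finite hf
    have key : ∀ g ∈ Y.constr i, form g.1 p ≤ g.2 ∧ (form g.1 p = g.2 → form g.1 v ≤ 0) := by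
      intro g hg
      constructor
      · by_contra hlt
        push Not at hlt
        have hc : Continuous fun ε : ℝ => form g.1 (p + ε • v) :=
          (continuous_form _).comp (by fun_prop)
        have h0 : g.2 < form g.1 (p + (0 : ℝ) • v) := by simpa using hlt
        refine hi ?_
        filter_upwards [nhdsWithin_le_nhds (hc.continuousAt.eventually_const_lt h0)] with ε hε hm
        exact absurd (emb_empty_mem_domain.1 hm g hg) (not_le.2 hε)
      · intro ha
        obtain ⟨ε, hε, hpos⟩ := (hi.and_eventually self_mem_nhdsWithin).exists
        have := emb_empty_mem_domain.1 hε g hg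
        rw [map_add, ha, map_smul, smul_eq_mul] at this
        exact nonpos_of_mul_nonpos_right (by linarith) (mem_Ioi.1 hpos)
    exact ⟨i, emb_empty_mem_domain.2 fun g hg => (key g hg).1,
      fun g hg _ ha => (key g hg).2 ha⟩
  · rintro ⟨i, hi, hv⟩
    refine ⟨by simp, ?_⟩
    have key : ∀ g ∈ Y.constr i, ∀ᶠ ε : ℝ in 𝓝[>] 0, form g.1 (p + ε • v) ≤ g.2 := fun g hg =>
      eventually_form_add_le (emb_empty_mem_domain.1 hi g hg) (hv g hg (by simp))
    obtain ⟨ε₀, hε₀, h⟩ := mem_nhdsGT_iff_exists_Ioo_subset.1 ((eventually_all_finset _).2 key)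
    exact ⟨ε₀, hε₀, fun ε h1 h2 => mem_iUnion.2 ⟨i, emb_empty_mem_domain.2 (h ⟨h1, h2⟩)⟩⟩

/-- Far out, the lift lies in the same facets as its limit, and the constraints active there are
those active at the limit that do not involve `I`. Cones at infinity can thus be computed at finite
points. -/
lemma eventually_localCone_lift (hY : Y.IsRegular) (I : Finset (Fin N)) (u : Fin N → ℝ) :
    ∀ᶠ R in atTop, Y.localCone (emb ∅ (lift I R u)) = Y.localCone (emb I u) := by
  have key : ∀ i, ∀ᶠ R in atTop,
      (emb ∅ (lift I R u) ∈ Y.facet i ↔ emb I u ∈ Y.facet i) ∧ (emb I u ∈ Y.facet i →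
        activeCone (Y.constr i) ∅ (lift I R u) = activeCone (Y.constr i) I u) := by
    intro i
    by_cases hi : emb I u ∈ Y.facet i
    · have h1 := eventually_lift_mem_facet_of_flat hY hi
        fun h hh hf => form_le_of_emb_mem hi hh hf
      have h2 := (eventually_all_finset (Y.constr i)).2
        fun h hh => eventually_form_lift_eq_iff hY hi hh
      filter_upwards [h1, h2] with R h1 h2
      refine ⟨iff_of_true h1 hi, fun _ => ?_⟩
      ext v
      refine forall₂_congr fun h hh => ?_
      rw [h2 h hh]
      simp
    · have := (tendsto_emb_lift I u).eventually
        ((isClosed_domain (Y.constr i)).isOpen_compl.mem_nhds hi)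
      filter_upwards [this] with R hR
      exact ⟨iff_of_false hR hi, fun h => absurd h hi⟩
  filter_upwards [eventually_all.2 key] with R hR
  ext v
  rw [mem_localCone_emb, mem_localCone_emb]
  refine exists_congr fun i => ?_
  rw [(hR i).1]
  exact and_congr_right fun hi => by rw [(hR i).2 hi]

/-- Two finite points of a facet at which the same constraints of this facet are active have the
same local cone. -/
lemma localCone_subset_of_active_iff {i : Fin Y.numFacets} {p p' : Fin N → ℝ}
    (hp : emb ∅ p ∈ Y.facet i) (hp' : emb ∅ p' ∈ Y.facet i)
    (hact : ∀ h ∈ Y.constr i, form h.1 p = h.2 ↔ form h.1 p' = h.2) :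
    Y.localCone (emb ∅ p) ⊆ Y.localCone (emb ∅ p') := by
  intro v hv
  rw [mem_localCone_emb] at hv ⊢
  obtain ⟨k, hk, hv⟩ := hv
  obtain ⟨⟨K, hK, hE⟩, -⟩ := facet_inter_facet hp hk
  have hpK := fun h hh => emb_empty_mem_bdry.1 ((hE ▸ (⟨hp, hk⟩ : emb ∅ p ∈ Y.facet i ∩ _) :
    emb ∅ p ∈ {x | x ∈ domain (Y.constr i) ∧ ∀ h ∈ K, x ∈ bdry h}).2 h hh)
  have hmem : ∀ z, emb ∅ z ∈ Y.facet i → (∀ h ∈ K, form h.1 z = h.2) → emb ∅ z ∈ Y.facet k := by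
    intro z hz hzK
    have : emb ∅ z ∈ Y.facet i ∩ Y.facet k := by
      rw [hE]
      exact ⟨hz, fun h hh => emb_empty_mem_bdry.2 (hzK h hh)⟩
    exact this.2
  have hp'K : ∀ h ∈ K, form h.1 p' = h.2 := fun h hh => (hact h (hK hh)).1 (hpK h hh)
  refine ⟨k, hmem p' hp' hp'K, fun g hg _ ha => hv g hg (by simp) ?_⟩
  -- The segment from `p` to `p'` can be prolonged a little beyond `p'` inside both facets. A
  -- constraint of facet `k` that is active at `p'` but slack at `p` would be violated there.
  have key : ∀ h ∈ Y.constr i, ∀ᶠ ε : ℝ in 𝓝[>] 0, form h.1 (p' + ε • (p' - p)) ≤ h.2 :=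
    fun h hh => eventually_form_add_le (emb_empty_mem_domain.1 hp' h hh) fun h1 => by
      rw [map_sub, h1, (hact h hh).2 h1, sub_self]
  obtain ⟨ε, hε, hpos⟩ := (((eventually_all_finset _).2 key).and self_mem_nhdsWithin).exists
  have hz := hmem (p' + ε • (p' - p)) (emb_empty_mem_domain.2 hε) fun h hh => by
    rw [map_add, map_smul, map_sub, hp'K h hh, hpK h hh]
    simp
  have h1 := emb_empty_mem_domain.1 hz g hg
  have h2 := emb_empty_mem_domain.1 hk g hg
  rw [map_add, map_smul, map_sub, ha, smul_eq_mul] at h1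
  have h3 : g.2 - form g.1 p ≤ 0 := nonpos_of_mul_nonpos_right (by linarith) (mem_Ioi.1 hpos)
  linarith

/-- A constraint active at `z`, or at a far lift of `y` (and then at `y`), cuts `E` in a face
through `z` or `y`; by minimality it is active on all of `E`. So `z` and the lift have the same
active constraints. -/
lemma localCone_eq_of_nearbyMobile (hY : Y.IsRegular) {y z : TSpace N}
    (hyz : Y.NearbyMobile y z) : Y.localCone z = Y.localCone y := by
  obtain ⟨hz, E, ⟨⟨i, hE⟩, hyE, hymin⟩, -, hzE, hzmin⟩ := hyz
  have hsz : sed z = ∅ := by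
    simp [sed, hz]
  obtain ⟨p, rfl⟩ : ∃ p, z = emb ∅ p := ⟨realPart z, by rw [← hsz, emb_realPart]⟩
  obtain ⟨I, u, rfl⟩ : ∃ I u, y = emb I u := ⟨sed y, realPart y, (emb_realPart y).symm⟩
  have hEi : E ⊆ Y.facet i := by
    obtain ⟨⟨K, -, rfl⟩, -⟩ := hE
    exact fun x hx => hx.1
  have hsub : ∀ h ∈ Y.constr i, ∀ x, emb ∅ x ∈ E → form h.1 x = h.2 →
      (emb I u ∈ bdry h ∨ emb ∅ p ∈ bdry h) → E ⊆ bdry h := by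
    intro h hh x hx hxh hor
    have hF : Y.IsFace (E ∩ bdry h) := ⟨i, isMobileFace_inter_bdry hE hh hx hxh⟩
    by_contra hcon
    have hss : E ∩ bdry h ⊂ E :=
      ⟨inter_subset_left, fun h' => hcon fun w hw => (h' hw).2⟩
    rcases hor with h1 | h1
    · exact hymin _ hF hss ⟨hyE, h1⟩
    · exact hzmin _ hF hss ⟨hzE, h1⟩
  have hflat : ∀ h ∈ Y.constr i, E ⊆ bdry h → ∀ l ∈ I, h.1 l = 0 := fun h _ hb =>
    IsFace.flat hY ⟨i, hE⟩ hyE hb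
  have hliftE : ∀ᶠ R in atTop, emb ∅ (lift I R u) ∈ E := by
    have h1 := eventually_lift_mem_facet_of_flat hY (hEi hyE)
      fun h hh hf => form_le_of_emb_mem (hEi hyE) hh hf
    obtain ⟨⟨K, hK, hE'⟩, -⟩ := id hE
    filter_upwards [h1] with R hR
    rw [hE']
    refine ⟨hR, fun h hh => emb_empty_mem_bdry.2 ?_⟩
    have hb : E ⊆ bdry h := fun x hx => by
      rw [hE'] at hx
      exact hx.2 h hh
    have hf := hflat h (hK hh) hb
    rw [form_lift_of_flat R hf]
    rcases emb_mem_bdry.1 (hb hyE) with ⟨⟨l, hl, hpos⟩, -⟩ | h2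
    · exact absurd (hf l hl) hpos.ne'
    · exact h2.2
  have hall := (eventually_all_finset (Y.constr i)).2
    fun h hh => eventually_form_lift_eq_iff hY (hEi hyE) hh
  obtain ⟨R, hRE, hR, hK⟩ := (hliftE.and (hall.and (eventually_localCone_lift hY I u))).exists
  have hiff : ∀ h ∈ Y.constr i, form h.1 p = h.2 ↔ form h.1 (lift I R u) = h.2 := by
    intro h hh
    constructor
    · intro h1
      have hb := hsub h hh p hzE h1 (Or.inr (emb_empty_mem_bdry.2 h1))
      exact emb_empty_mem_bdry.1 (hb hRE)
    · intro h1
      have h2 := (hR h hh).1 h1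
      have hb := hsub h hh _ hRE h1 (Or.inl (emb_mem_bdry.2 (Or.inr h2)))
      exact emb_empty_mem_bdry.1 (hb hzE)
  rw [← hK]
  exact Subset.antisymm (localCone_subset_of_active_iff (hEi hzE) (hEi hRE) hiff)
    (localCone_subset_of_active_iff (hEi hRE) (hEi hzE) fun h hh => (hiff h hh).symm)

/-- On the smallest face `E` through `y`, a far lift of `y` stays in `E` and avoids every face that
misses `y`, as there are finitely many faces and all are closed. -/
lemma exists_nearbyMobile (hY : Y.IsRegular) {y : TSpace N} (hy : y ∈ Y.support) :
    ∃ z, Y.NearbyMobile y z := by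
  obtain ⟨i₀, hi₀⟩ := mem_iUnion.1 hy
  have hfin : {E | Y.IsFace E ∧ y ∈ E}.Finite := Y.finite_setOf_isFace.subset fun E hE => hE.1
  obtain ⟨E, hmin⟩ := hfin.exists_minimal ⟨_, isFace_facet i₀, hi₀⟩
  obtain ⟨⟨hE, hyE⟩, hmin⟩ := hmin
  have hyE' : Y.InRelInt E y := ⟨hE, hyE, fun E' hE' hss hyE' =>
    hss.2 (hmin ⟨hE', hyE'⟩ hss.1)⟩
  obtain ⟨I, u, rfl⟩ : ∃ I u, y = emb I u := ⟨sed y, realPart y, (emb_realPart y).symm⟩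
  have h1 : ∀ᶠ R in atTop, ∀ E' ∈ {E | Y.IsFace E}, emb ∅ (lift I R u) ∈ E' → emb I u ∈ E' := by
    refine (eventually_all_finite Y.finite_setOf_isFace).2 fun E' hE' => ?_
    by_cases hm : emb I u ∈ E'
    · exact Eventually.of_forall fun _ _ => hm
    · filter_upwards [(tendsto_emb_lift I u).eventually
        ((IsFace.isClosed hE').isOpen_compl.mem_nhds hm)] with R hR h
      exact absurd h hR
  have h2 : ∀ᶠ R in atTop, emb ∅ (lift I R u) ∈ E := by
    obtain ⟨i, ⟨K, hK, rfl⟩, -⟩ := id hE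
    have h1 := eventually_lift_mem_facet_of_flat hY (i := i) hyE.1
      fun h hh hf => form_le_of_emb_mem (i := i) hyE.1 hh hf
    filter_upwards [h1] with R hR
    refine ⟨hR, fun h hh => emb_empty_mem_bdry.2 ?_⟩
    have hf := IsFace.flat hY hE hyE (h := h) fun x hx => hx.2 h hh
    rw [form_lift_of_flat R hf]
    rcases emb_mem_bdry.1 (hyE.2 h hh) with ⟨⟨l, hl, hpos⟩, -⟩ | h2
    · exact absurd (hf l hl) hpos.ne'
    · exact h2.2
  obtain ⟨R, hR1, hR2⟩ := (h1.and h2).exists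
  exact ⟨_, fun i => by simp [emb], E, hyE', hE, hR2, fun E' hE' hss hm =>
    hyE'.2.2 E' hE' hss (hR1 E' hE' hm)⟩

/-- All nearby mobile points give the same space. That one exists matters as well, since an empty
infimum would be the whole of `ℝᴺ`. -/
lemma waveSpace_eq (hY : Y.IsRegular) {y : TSpace N} (hy : y ∈ Y.support) :
    Y.waveSpace y = linealitySpace (Y.localCone y) := by
  have key : ∀ z, Y.NearbyMobile y z → Y.lineality z = linealitySpace (Y.localCone y) := by
    intro z hz
    rw [← localCone_eq_of_nearbyMobile hY hz]
    have hsz : sed z = ∅ := by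
      simp [sed, hz.1]
    have hzp : z = emb ∅ (realPart z) := by rw [← hsz, emb_realPart]
    rw [hzp, ← tangentCone_emb_empty]
    rfl
  obtain ⟨z, hz⟩ := exists_nearbyMobile hY hy
  refine le_antisymm ((iInf₂_le z hz).trans (key z hz).le) (le_iInf₂ fun z hz => (key z hz).ge)

/-! ## Tangent spaces of the facets at a point -/

lemma eventually_lift_add_mem_facet (hY : Y.IsRegular) {i : Fin Y.numFacets} {I : Finset (Fin N)}
    {u v : Fin N → ℝ} (hu : emb I u ∈ Y.facet i) (hv : v ∈ activeCone (Y.constr i) I u) :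
    ∀ᶠ ε : ℝ in 𝓝[>] 0, ∀ᶠ R in atTop, emb ∅ (lift I R u + ε • v) ∈ Y.facet i := by
  have key : ∀ h ∈ Y.constr i, ∀ᶠ ε : ℝ in 𝓝[>] 0, (∀ l ∈ I, h.1 l = 0) →
      form h.1 (u + ε • v) ≤ h.2 := by
    intro h hh
    by_cases hf : ∀ l ∈ I, h.1 l = 0
    · filter_upwards [eventually_form_add_le (form_le_of_emb_mem hu hh hf) (hv h hh hf)]
        with ε hε _
      exact hε
    · exact Eventually.of_forall fun _ h1 => absurd h1 hf
  filter_upwards [(eventually_all_finset _).2 key] with ε hε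
  filter_upwards [eventually_lift_mem_facet_of_flat hY hu hε] with R hR
  rwa [← lift_add]

lemma eventually_lift_mem_facet_self (hY : Y.IsRegular) {i : Fin Y.numFacets}
    {I : Finset (Fin N)} {u : Fin N → ℝ} (hu : emb I u ∈ Y.facet i) :
    ∀ᶠ R in atTop, emb ∅ (lift I R u) ∈ Y.facet i :=
  eventually_lift_mem_facet_of_flat hY hu fun _ hh hf => form_le_of_emb_mem hu hh hf

lemma activeCone_subset_tangent (hY : Y.IsRegular) {i : Fin Y.numFacets} {I : Finset (Fin N)}
    {u : Fin N → ℝ} (hu : emb I u ∈ Y.facet i) :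
    activeCone (Y.constr i) I u ⊆ tangent ∅ (Y.facet i) := by
  intro v hv
  obtain ⟨ε, hε, hpos⟩ :=
    ((eventually_lift_add_mem_facet hY hu hv).and self_mem_nhdsWithin).exists
  obtain ⟨R, hR1, hR2⟩ := (hε.and (eventually_lift_mem_facet_self hY hu)).exists
  have := sub_mem_tangent hR1 hR2
  rw [add_sub_cancel_left] at this
  exact (Submodule.smul_mem_iff _ (ne_of_gt (mem_Ioi.1 hpos))).1 this

variable (Y) in
/-- The cone of a facet at a point contains an inner point of its linear span. -/
lemma exists_inner_activeCone (i : Fin Y.numFacets) (I : Finset (Fin N)) (u : Fin N → ℝ) :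
    ∃ v₀ ∈ activeCone (Y.constr i) I u,
      (∀ h ∈ Y.constr i, (∀ l ∈ I, h.1 l = 0) → form h.1 u = h.2 → form h.1 v₀ = 0 →
        Y.facet i ∩ range (emb ∅) ⊆ bdry h) ∧
      ∀ v ∈ tangent ∅ (Y.facet i), ∀ᶠ ε : ℝ in 𝓝[>] 0,
        v₀ + ε • v ∈ activeCone (Y.constr i) I u := by
  obtain ⟨x₀, hx₀, h₀⟩ := exists_relInt (Y.facet_nonempty i)
  have hmem : x₀ - u ∈ activeCone (Y.constr i) I u := fun h hh _ ha => by
    rw [map_sub, ha]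
    linarith [emb_empty_mem_domain.1 hx₀ h hh]
  have hzero : ∀ h ∈ Y.constr i, form h.1 u = h.2 → form h.1 (x₀ - u) = 0 →
      ∀ x, emb ∅ x ∈ Y.facet i → form h.1 x = h.2 := fun h hh ha hz =>
    h₀ h hh (by rw [map_sub, ha] at hz; linarith)
  -- The direction towards a relative interior point `x₀` of the facet is strictly inside every
  -- active constraint, except those that are active on the whole facet.
  refine ⟨x₀ - u, hmem, fun h hh _ ha hz => ?_, fun v hv => ?_⟩
  · rintro _ ⟨hx, x, rfl⟩
    exact emb_empty_mem_bdry.2 (hzero h hh ha hz x hx)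
  · have key : ∀ h ∈ Y.constr i, ∀ᶠ ε : ℝ in 𝓝[>] 0, (∀ l ∈ I, h.1 l = 0) →
        form h.1 u = h.2 → form h.1 (x₀ - u + ε • v) ≤ 0 := by
      intro h hh
      by_cases hfa : (∀ l ∈ I, h.1 l = 0) ∧ form h.1 u = h.2
      · filter_upwards [eventually_form_add_le (h := (h.1, 0)) (v := v)
          (hmem h hh hfa.1 hfa.2) fun hz =>
            ((mem_tangent_domain_iff (Y.facet_nonempty i)).1 hv h hh
              (hzero h hh hfa.2 hz)).le] with ε hε _ _
        exact hε
      · exact Eventually.of_forall fun _ h1 h2 => absurd ⟨h1, h2⟩ hfa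
    filter_upwards [(eventually_all_finset _).2 key] with ε hε
    exact hε

variable (Y) in
lemma tangent_le_span_activeCone (i : Fin Y.numFacets) (I : Finset (Fin N)) (u : Fin N → ℝ) :
    tangent ∅ (Y.facet i) ≤ Submodule.span ℝ (activeCone (Y.constr i) I u) := by
  intro v hv
  obtain ⟨v₀, hv₀, -, h⟩ := Y.exists_inner_activeCone i I u
  obtain ⟨ε, hε, hpos⟩ := ((h v hv).and self_mem_nhdsWithin).exists
  have := sub_mem (Submodule.subset_span (R := ℝ) hε) (Submodule.subset_span (R := ℝ) hv₀)
  rw [add_sub_cancel_left] at this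
  exact (Submodule.smul_mem_iff _ (ne_of_gt (mem_Ioi.1 hpos))).1 this

lemma tangent_le_span_localCone {i : Fin Y.numFacets} {y : TSpace N} (hy : y ∈ Y.facet i) :
    tangent ∅ (Y.facet i) ≤ Submodule.span ℝ (Y.localCone y) :=
  (Y.tangent_le_span_activeCone i (sed y) (realPart y)).trans
    (Submodule.span_mono fun _ hv => ⟨i, hy, hv⟩)

lemma waveSpace_le_span_localCone (hY : Y.IsRegular) {y : TSpace N} (hy : y ∈ Y.support) :
    Y.waveSpace y ≤ Submodule.span ℝ (Y.localCone y) := by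
  intro w hw
  rw [waveSpace_eq hY hy] at hw
  have := add_mem_of_mem_linealitySpace (zero_mem_localCone hy) hw
  rw [zero_add] at this
  exact Submodule.subset_span this

/-- The wave tangent space is tangent to every facet. -/
lemma waveSpace_le_tangent (hY : Y.IsRegular) {y : TSpace N} {i : Fin Y.numFacets}
    (hi : y ∈ Y.facet i) : Y.waveSpace y ≤ tangent ∅ (Y.facet i) := by
  intro w hw
  rw [waveSpace_eq hY (mem_iUnion.2 ⟨i, hi⟩)] at hw
  obtain ⟨I, u, rfl⟩ : ∃ I u, y = emb I u := ⟨sed y, realPart y, (emb_realPart y).symm⟩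
  obtain ⟨v₀, hv₀, hin, -⟩ := Y.exists_inner_activeCone i I u
  have hf : ∃ᶠ ε : ℝ in 𝓝[>] 0, ∃ k, emb I u ∈ Y.facet k ∧
      v₀ + ε • w ∈ activeCone (Y.constr k) I u :=
    Frequently.of_forall fun ε =>
      mem_localCone_emb.1 (hw v₀ (mem_localCone_emb.2 ⟨i, hi, hv₀⟩) ε)
  obtain ⟨k, hk⟩ := frequently_exists_of_finite hf
  obtain ⟨ε, ⟨hku, hε⟩, hpos⟩ := (hk.and_eventually self_mem_nhdsWithin).exists
  have hv₀k : v₀ ∈ activeCone (Y.constr k) I u := fun h hh hfl ha =>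
    (form_le_zero_of_frequently (hk.mono fun ε hε => hε.2 h hh hfl ha)).1
  have hw' : w ∈ tangent ∅ (Y.facet k) := by
    have := sub_mem (activeCone_subset_tangent hY hku hε) (activeCone_subset_tangent hY hku hv₀k)
    rw [add_sub_cancel_left] at this
    exact (Submodule.smul_mem_iff _ (ne_of_gt (mem_Ioi.1 hpos))).1 this
  -- Facets have equal dimension, so an inclusion of tangent spaces is an equality. The inner
  -- direction `v₀` of facet `i` also belongs to the cone of facet `k`; hence the constraints that
  -- cut out the common face vanish on `v₀` and are active on all finite points of facet `i`.
  suffices hle : tangent ∅ (Y.facet i) ≤ tangent ∅ (Y.facet k) by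
    have := Submodule.eq_of_le_of_finrank_eq hle
      ((Y.facet_dim i).trans (Y.facet_dim k).symm)
    rwa [this]
  obtain ⟨⟨K, hK, hE⟩, hne⟩ := facet_inter_facet hi hku
  have hface : Y.IsFace (Y.facet i ∩ Y.facet k) := ⟨i, ⟨K, hK, hE⟩, hne⟩
  have hbd : ∀ h ∈ K, Y.facet i ∩ Y.facet k ⊆ bdry h := fun h hh x hx => by
    rw [hE] at hx
    exact hx.2 h hh
  have hsub : ∀ x, emb ∅ x ∈ Y.facet i → emb ∅ x ∈ Y.facet k := by
    intro x hx
    have : emb ∅ x ∈ Y.facet i ∩ Y.facet k := by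
      rw [hE]
      refine ⟨hx, fun h hh => hin h (hK hh) (hface.flat hY ⟨hi, hku⟩ (hbd h hh)) ?_ ?_
        ⟨hx, x, rfl⟩⟩
      · rcases emb_mem_bdry.1 (hbd h hh ⟨hi, hku⟩) with ⟨⟨l, hl, hp⟩, -⟩ | h2
        · exact absurd (hface.flat hY ⟨hi, hku⟩ (hbd h hh) l hl) hp.ne'
        · exact h2.2
      · obtain ⟨δ, ⟨h1, h2⟩, hδ⟩ := (((eventually_lift_add_mem_facet hY hi hv₀).and
          (eventually_lift_add_mem_facet hY hku hv₀k)).and self_mem_nhdsWithin).exists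
        obtain ⟨R, ⟨h3, h4⟩, h5, h6⟩ := ((h1.and h2).and ((eventually_lift_mem_facet_self hY hi).and
          (eventually_lift_mem_facet_self hY hku))).exists
        have e1 := emb_empty_mem_bdry.1 (hbd h hh ⟨h3, h4⟩)
        have e2 := emb_empty_mem_bdry.1 (hbd h hh ⟨h5, h6⟩)
        rw [map_add, e2, map_smul, smul_eq_mul] at e1
        exact (mul_eq_zero.1 (by linarith : δ * form h.1 v₀ = 0)).resolve_left
          (ne_of_gt (mem_Ioi.1 hδ))
    exact this.2
  exact vectorSpan_mono ℝ fun x hx => mem_slice_empty.2 (hsub x (mem_slice_empty.1 hx))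

/-- If the local cones at `y` and `y'` agree, then the tangent space of a facet at `y` is contained
in the tangent space of some facet at `y'`. -/
lemma exists_tangent_le (hY : Y.IsRegular) {y y' : TSpace N}
    (hK : Y.localCone y ⊆ Y.localCone y') {i : Fin Y.numFacets} (hi : y ∈ Y.facet i) :
    ∃ k, y' ∈ Y.facet k ∧ tangent ∅ (Y.facet i) ≤ tangent ∅ (Y.facet k) := by
  obtain ⟨v₀, hv₀, -, hin⟩ := Y.exists_inner_activeCone i (sed y) (realPart y)
  set T := tangent ∅ (Y.facet i) with hT
  let p : {k // y' ∈ Y.facet k} → Submodule ℝ T := fun k => (tangent ∅ (Y.facet k.1)).comap T.subtype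
  -- For each `v`, one `k` serves two values of `ε`, and the difference of the two vectors puts `v`
  -- into the tangent space of facet `k`. A real vector space is not a finite union of proper
  -- subspaces, so one `k` serves all of `T`.
  have hcov : ⋃ k, (p k : Set T) = univ := by
    refine eq_univ_of_forall fun v => ?_
    have hf : ∃ᶠ ε : ℝ in 𝓝[>] 0, ∃ k : {k // y' ∈ Y.facet k},
        v₀ + ε • (v : Fin N → ℝ) ∈ tangent ∅ (Y.facet k.1) := by
      refine Eventually.frequently ?_
      filter_upwards [hin v v.2] with ε hε
      obtain ⟨k, hk, hmem⟩ := hK ⟨i, hi, hε⟩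
      exact ⟨⟨k, hk⟩, activeCone_subset_tangent hY (mem_facet_iff_emb.1 hk) hmem⟩
    obtain ⟨k, hk⟩ := frequently_exists_of_finite hf
    obtain ⟨ε, hε, hpos⟩ := (hk.and_eventually self_mem_nhdsWithin).exists
    obtain ⟨δ, hδ, hlt⟩ := (hk.and_eventually (Ioo_mem_nhdsGT (mem_Ioi.1 hpos))).exists
    have := sub_mem hε hδ
    rw [add_sub_add_left_eq_sub, ← sub_smul] at this
    refine mem_iUnion.2 ⟨k, ?_⟩
    exact (Submodule.smul_mem_iff _ (sub_pos.2 hlt.2).ne').1 this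
  by_contra hcon
  push Not at hcon
  classical
  refine Subspace.biUnion_ne_univ_of_top_notMem (k := ℝ) (s := Finset.univ.image p) ?_ ?_
  · simp only [Finset.mem_image, Finset.mem_univ, true_and, not_exists]
    intro k hk
    refine hcon k.1 k.2 fun v hv => ?_
    have : (⟨v, hv⟩ : T) ∈ p k := hk ▸ Submodule.mem_top
    exact this
  · rw [← hcov]
    ext v
    simp

lemma tangent_sed_eq (hY : Y.IsRegular) {y : TSpace N} {i : Fin Y.numFacets}
    (hi : y ∈ Y.facet i) :
    tangent (sed y) (Y.facet i) = (tangent ∅ (Y.facet i)).map (divProj (sed y)) :=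
  ((isFace_facet i).tangent_infinity hY (mem_facet_iff_emb.1 hi)).2

lemma tangent_sed_le (hY : Y.IsRegular) {y : TSpace N} {i : Fin Y.numFacets}
    (hi : y ∈ Y.facet i) : tangent (sed y) (Y.facet i) ≤ tangent ∅ (Y.facet i) := by
  rw [tangent_sed_eq hY hi, Submodule.map_le_iff_le_comap]
  intro v hv
  have hker := ((isFace_facet i).tangent_infinity hY (mem_facet_iff_emb.1 hi)).1
  have h1 : v - divProj (sed y) v ∈ LinearMap.ker (divProj (sed y)) := by
    rw [LinearMap.mem_ker]
    funext l
    simp only [Pi.sub_apply, divProj_apply, Pi.zero_apply]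
    split_ifs <;> simp
  have := sub_mem hv (hker h1)
  rwa [sub_sub_cancel] at this

end PolyComplex

/-! ## Multivectors -/

section Multivectors

variable {E F : Type*} [AddCommGroup E] [Module ℝ E] [AddCommGroup F] [Module ℝ F]

/-- The span of the products of `k` vectors of a subspace. -/
def wedgePower (k : ℕ) (V : Submodule ℝ E) : Submodule ℝ (ExteriorAlgebra ℝ E) :=
  Submodule.span ℝ {w | ∃ v : Fin k → E, (∀ l, v l ∈ V) ∧ w = ExteriorAlgebra.ιMulti ℝ k v}

lemma wedgePower_mono (k : ℕ) {V W : Submodule ℝ E} (h : V ≤ W) :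
    wedgePower k V ≤ wedgePower k W :=
  Submodule.span_mono fun _ ⟨v, hv, hw⟩ => ⟨v, fun l => h (hv l), hw⟩

lemma map_eq_map_of_mem_wedgePower {k : ℕ} {V : Submodule ℝ E} {f g : E →ₗ[ℝ] F}
    (hfg : ∀ v ∈ V, f v = g v) {w : ExteriorAlgebra ℝ E} (hw : w ∈ wedgePower k V) :
    ExteriorAlgebra.map f w = ExteriorAlgebra.map g w := by
  have : wedgePower k V ≤ LinearMap.eqLocus (ExteriorAlgebra.map f).toLinearMap
      (ExteriorAlgebra.map g).toLinearMap := by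
    rw [wedgePower, Submodule.span_le]
    rintro _ ⟨v, hv, rfl⟩
    change ExteriorAlgebra.map f _ = ExteriorAlgebra.map g _
    rw [ExteriorAlgebra.map_apply_ιMulti, ExteriorAlgebra.map_apply_ιMulti]
    congr 1
    funext l
    exact hfg _ (hv l)
  exact this hw

lemma map_map_apply {G : Type*} [AddCommGroup G] [Module ℝ G] (f : E →ₗ[ℝ] F) (g : F →ₗ[ℝ] G)
    (x : ExteriorAlgebra ℝ E) :
    ExteriorAlgebra.map g (ExteriorAlgebra.map f x) = ExteriorAlgebra.map (g ∘ₗ f) x := by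
  rw [← ExteriorAlgebra.map_comp_map]
  rfl

end Multivectors

/-- The span of the products of `k` integer vectors of a subspace of `ℝᴺ`. -/
def latticeWedge {N : ℕ} (k : ℕ) (V : Submodule ℝ (Fin N → ℝ)) :
    Submodule ℝ (ExteriorAlgebra ℝ (Fin N → ℝ)) :=
  Submodule.span ℝ {w | ∃ v : Fin k → Fin N → ℤ, (∀ l, realVec (v l) ∈ V) ∧
    w = ExteriorAlgebra.ιMulti ℝ k fun l => realVec (v l)}

lemma latticeWedge_mono {N : ℕ} (k : ℕ) {V W : Submodule ℝ (Fin N → ℝ)} (h : V ≤ W) :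
    latticeWedge k V ≤ latticeWedge k W :=
  Submodule.span_mono fun _ ⟨v, hv, hw⟩ => ⟨v, fun l => h (hv l), hw⟩

lemma latticeWedge_le_wedgePower {N : ℕ} (k : ℕ) (V : Submodule ℝ (Fin N → ℝ)) :
    latticeWedge k V ≤ wedgePower k V :=
  Submodule.span_mono fun _ ⟨v, hv, hw⟩ => ⟨fun l => realVec (v l), hv, hw⟩

/-- Both sides are linear in `u`, so `hV` reduces to an integer vector, which is prepended to the
generating products. -/
lemma ι_mul_mem_latticeWedge {N k : ℕ} {V : Submodule ℝ (Fin N → ℝ)}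
    (hV : V ≤ Submodule.span ℝ (realVec '' {w | realVec w ∈ V})) {u : Fin N → ℝ} (hu : u ∈ V)
    {x : ExteriorAlgebra ℝ (Fin N → ℝ)} (hx : x ∈ latticeWedge k V) :
    ExteriorAlgebra.ι ℝ u * x ∈ latticeWedge (k + 1) V := by
  have h1 : ∀ w : Fin N → ℤ, realVec w ∈ V → latticeWedge k V ≤
      (latticeWedge (k + 1) V).comap
        (LinearMap.mulLeft ℝ (ExteriorAlgebra.ι ℝ (realVec w))) := by
    intro w hw
    rw [latticeWedge, Submodule.span_le]
    rintro _ ⟨v, hv, rfl⟩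
    refine Submodule.subset_span ⟨Fin.cons w v, Fin.cases hw hv, ?_⟩
    rw [ExteriorAlgebra.ιMulti_succ_apply]
    rfl
  have h2 : V ≤ (latticeWedge (k + 1) V).comap
      ((LinearMap.mulRight ℝ x) ∘ₗ (ExteriorAlgebra.ι ℝ)) := by
    refine hV.trans (Submodule.span_le.2 ?_)
    rintro _ ⟨w, hw, rfl⟩
    exact h1 w hw hx
  exact h2 hu

lemma ιMulti_mul_mem_latticeWedge {N p : ℕ} {V : Submodule ℝ (Fin N → ℝ)}
    (hV : V ≤ Submodule.span ℝ (realVec '' {w | realVec w ∈ V}))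
    {x : ExteriorAlgebra ℝ (Fin N → ℝ)} (hx : x ∈ latticeWedge p V) :
    ∀ (k : ℕ) (v : Fin k → Fin N → ℝ), (∀ l, v l ∈ V) →
      ExteriorAlgebra.ιMulti ℝ k v * x ∈ latticeWedge (p + k) V
  | 0, v, _ => by
    rw [ExteriorAlgebra.ιMulti_zero_apply, one_mul]
    exact hx
  | k + 1, v, hv => by
    rw [ExteriorAlgebra.ιMulti_succ_apply, mul_assoc]
    exact ι_mul_mem_latticeWedge hV (hv 0)
      (ιMulti_mul_mem_latticeWedge hV hx k _ fun l => hv l.succ)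

/-! ### Tangent and wave multivectors at a point, and their wedge product -/

namespace PolyComplex

variable {N : ℕ} {Y : PolyComplex N}

variable (Y) in
lemma realF_eq_iSup (p : ℕ) (y : TSpace N) :
    Y.realF p y = ⨆ i, ⨆ (_ : y ∈ Y.facet i), latticeWedge p (tangent (sed y) (Y.facet i)) := by
  refine le_antisymm (Submodule.span_le.2 ?_) (iSup₂_le fun i hi => Submodule.span_le.2 ?_)
  · let M := ⨆ i, ⨆ (_ : y ∈ Y.facet i), latticeWedge p (tangent (sed y) (Y.facet i))
    change Y.latticeF p y ≤ M.toAddSubgroup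
    refine (AddSubgroup.closure_le _).2 ?_
    rintro _ ⟨i, hi, v, hv, rfl⟩
    exact Submodule.mem_iSup_of_mem i (Submodule.mem_iSup_of_mem hi
      (Submodule.subset_span ⟨v, hv, rfl⟩))
  · rintro _ ⟨v, hv, rfl⟩
    exact Submodule.subset_span (AddSubgroup.subset_closure ⟨i, hi, v, hv, rfl⟩)

lemma latticeWedge_le_realF (p : ℕ) {y : TSpace N} {i : Fin Y.numFacets} (hi : y ∈ Y.facet i) :
    latticeWedge p (tangent (sed y) (Y.facet i)) ≤ Y.realF p y := by
  rw [realF_eq_iSup]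
  exact le_iSup₂_of_le i hi le_rfl

/-- With its symmetric version, this shows that `F_p ⊗ ℝ` depends only on the sedentarity and the
local cone. -/
lemma realF_le_of_localCone (hY : Y.IsRegular) (p : ℕ) {y y' : TSpace N} (hs : sed y = sed y')
    (hK : Y.localCone y ⊆ Y.localCone y') : Y.realF p y ≤ Y.realF p y' := by
  rw [realF_eq_iSup]
  refine iSup₂_le fun i hi => ?_
  obtain ⟨k, hk, hle⟩ := exists_tangent_le hY hK hi
  refine (latticeWedge_mono p ?_).trans (latticeWedge_le_realF p hk)
  rw [tangent_sed_eq hY hi, tangent_sed_eq hY hk, hs]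
  exact Submodule.map_mono hle

lemma divProj_divProj {I J : Finset (Fin N)} (hJ : J ⊆ I) :
    divProj I ∘ₗ divProj J = divProj I := by
  ext1 i
  refine LinearMap.ext fun v => ?_
  funext l
  simp only [LinearMap.comp_apply, divProj_apply]
  by_cases h1 : l ∈ I
  · simp [h1]
  · have h2 : l ∉ J := fun h => h1 (hJ h)
    simp [h1, h2]

lemma map_divProj_map_divProj {I J : Finset (Fin N)} (hJ : J ⊆ I)
    (x : ExteriorAlgebra ℝ (Fin N → ℝ)) :
    ExteriorAlgebra.map (divProj I) (ExteriorAlgebra.map (divProj J) x) =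
      ExteriorAlgebra.map (divProj I) x := by
  rw [map_map_apply, divProj_divProj hJ]

/-- The projection along divisorial directions maps the tangent multivectors at a nearby point
to tangent multivectors. -/
lemma Near.map_divProj_mem_realF (hY : Y.IsRegular) {p : ℕ} {y y' : TSpace N} (hn : Y.Near y y')
    {β : ExteriorAlgebra ℝ (Fin N → ℝ)} (hβ : β ∈ Y.realF p y') :
    ExteriorAlgebra.map (divProj (sed y)) β ∈ Y.realF p y := by
  have : Y.realF p y' ≤
      (Y.realF p y).comap (ExteriorAlgebra.map (divProj (sed y))).toLinearMap := by
    rw [realF_eq_iSup Y p y']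
    refine iSup₂_le fun i hi' => Submodule.span_le.2 ?_
    have hi := hn.facet_mem i hi'
    rintro _ ⟨v, hv, rfl⟩
    refine latticeWedge_le_realF p hi (Submodule.subset_span ⟨fun l i =>
      if i ∈ sed y then 0 else v l i, fun l => ?_, ?_⟩)
    · rw [← divProj_realVec, tangent_sed_eq hY hi]
      refine Submodule.mem_map_of_mem ?_
      exact tangent_sed_le hY hi' (hv l)
    · change ExteriorAlgebra.map (divProj (sed y)) _ = _
      rw [ExteriorAlgebra.map_apply_ιMulti]
      congr 1
      funext l
      exact divProj_realVec _ _
  exact this hβ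

lemma waveK_mono (k : ℕ) {y y' : TSpace N} (h : Y.waveSpace y ≤ Y.waveSpace y') :
    Y.waveK k y ≤ Y.waveK k y' :=
  wedgePower_mono k h

/-- The wedge product `W_k(y) ⊗ F_p(y) → F_{p+k}(y) ⊗ ℝ`. -/
lemma map_divProj_mul_mem_realF (hY : Y.IsRegular) {p k : ℕ} {y : TSpace N}
    {w β : ExteriorAlgebra ℝ (Fin N → ℝ)} (hw : w ∈ Y.waveK k y) (hβ : β ∈ Y.realF p y) :
    ExteriorAlgebra.map (divProj (sed y)) w * β ∈ Y.realF (p + k) y := by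
  have h1 : ∀ v : Fin k → Fin N → ℝ, (∀ l, v l ∈ Y.waveSpace y) → Y.realF p y ≤
      (Y.realF (p + k) y).comap (LinearMap.mulLeft ℝ
        (ExteriorAlgebra.map (divProj (sed y)) (ExteriorAlgebra.ιMulti ℝ k v))) := by
    intro v hv
    rw [realF_eq_iSup Y p y]
    refine iSup₂_le fun i hi x hx => ?_
    rw [Submodule.mem_comap, LinearMap.mulLeft_apply, ExteriorAlgebra.map_apply_ιMulti]
    refine latticeWedge_le_realF (p + k) hi (ιMulti_mul_mem_latticeWedge
      (tangent_facet_le_span hY (mem_facet_iff_emb.1 hi)) hx k _ fun l => ?_)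
    rw [tangent_sed_eq hY hi]
    exact Submodule.mem_map_of_mem (waveSpace_le_tangent hY hi (hv l))
  have h2 : Y.waveK k y ≤ (Y.realF (p + k) y).comap ((LinearMap.mulRight ℝ β) ∘ₗ
      (ExteriorAlgebra.map (divProj (sed y))).toLinearMap) := by
    rw [waveK, Submodule.span_le]
    rintro _ ⟨v, hv, rfl⟩
    exact h1 v hv hβ
  exact h2 hw

lemma waveK_le_wedgePower (hY : Y.IsRegular) (k : ℕ) {y : TSpace N} (hy : y ∈ Y.support) :
    Y.waveK k y ≤ wedgePower k (Submodule.span ℝ (Y.localCone y)) :=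
  wedgePower_mono k (waveSpace_le_span_localCone hY hy)

lemma realF_le_wedgePower (hY : Y.IsRegular) (p : ℕ) (y : TSpace N) :
    Y.realF p y ≤ wedgePower p (Submodule.span ℝ (Y.localCone y)) := by
  rw [realF_eq_iSup]
  exact iSup₂_le fun i hi => (latticeWedge_le_wedgePower p _).trans
    (wedgePower_mono p ((tangent_sed_le hY hi).trans (tangent_le_span_localCone hi)))

end PolyComplex

/-! ## Differentials of overlapping maps -/

lemma realLin_apply {N M : ℕ} (A : Matrix (Fin M) (Fin N) ℤ) (u : Fin N → ℝ) (i : Fin M) :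
    realLin A u i = form (A i) u := by
  rw [form_apply]
  simp [realLin, Matrix.mulVec, dotProduct]

lemma IsAffineImage.realPart_eq {N M : ℕ} {A : Matrix (Fin M) (Fin N) ℤ} {b : Fin M → ℝ}
    {p : Fin N → ℝ} {y : TSpace M} (h : IsAffineImage A b (emb ∅ p) y) :
    realPart y = realLin A p + b := by
  funext i
  have hi := h.2 i
  rw [sum_nsmul_emb _ (by simp), sum_nsmul_emb _ (by simp)] at hi
  rw [Pi.add_apply, realLin_apply, form_eq_sub]
  simp only [realPart]
  generalize y i = c at hi ⊢
  induction c with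
  | bot =>
    rw [WithBot.bot_add, ← WithBot.coe_add] at hi
    exact absurd hi.symm WithBot.coe_ne_bot
  | coe c =>
    rw [← WithBot.coe_add, ← WithBot.coe_add, WithBot.coe_inj] at hi
    rw [WithBot.unbotD_coe]
    linarith

/-- Entries in infinite columns are nonnegative. A positive one would make the right-hand side of
the defining equation `-∞`, while the left-hand side is finite. -/
lemma IsAffineImage.apply_eq_zero {N M : ℕ} {A : Matrix (Fin M) (Fin N) ℤ} {b : Fin M → ℝ}
    {x : TSpace N} {y : TSpace M} (h : IsAffineImage A b x y) {i : Fin M} (hi : i ∉ sed y)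
    {j : Fin N} (hj : j ∈ sed x) : A i j = 0 := by
  have hx : ∀ l ∈ sed x, 0 ≤ A i l := fun l hl => h.1 i l (by simpa [sed] using hl)
  by_contra hne
  have hpos : 0 < A i j := lt_of_le_of_ne (hx j hj) (Ne.symm hne)
  have hxj : x j = ⊥ := by simpa [sed] using hj
  have hyi : y i ≠ ⊥ := by simpa [sed] using hi
  have he := h.2 i
  rw [sum_nsmul_eq_bot (fun l => (A i l).toNat) hxj (by omega), WithBot.bot_add,
    WithBot.add_eq_bot] at he
  refine he.elim hyi fun h0 => ?_
  rw [← emb_realPart x, sum_nsmul_emb _ fun l hl => by have := hx l hl; omega] at h0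
  exact WithBot.coe_ne_bot h0

lemma IsAffineImage.divProj_comp {N M : ℕ} {A : Matrix (Fin M) (Fin N) ℤ} {b : Fin M → ℝ}
    {x : TSpace N} {y : TSpace M} (h : IsAffineImage A b x y) :
    divProj (sed y) ∘ₗ realLin A ∘ₗ divProj (sed x) = divProj (sed y) ∘ₗ realLin A := by
  refine LinearMap.ext fun v => funext fun i => ?_
  simp only [LinearMap.comp_apply, divProj_apply]
  split_ifs with hi
  · rfl
  · rw [realLin_apply, realLin_apply]
    exact form_divProj (fun j hj => h.apply_eq_zero hi hj) v

namespace TropicalSpace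

variable {X : Type*} [TopologicalSpace X] (T : TropicalSpace X)

lemma continuousOn_φ (α : Fin T.numCharts) : ContinuousOn (T.φ α) (T.U α) :=
  continuousOn_iff_continuous_domRestrict.2
    (continuous_subtype_val.comp (T.isOpenEmbedding α).continuous)

/-- The chart is open onto the complex, so the images of the points near `x` fill a neighbourhood in
the complex. Properties of overlap maps can then be tested at chosen points of the polyhedra. -/
lemma eventually_nhdsWithin_support {α : Fin T.numCharts} {x : X} (hx : x ∈ T.U α) {P : X → Prop}
    (hP : ∀ᶠ z in 𝓝 x, P z) :
    ∀ᶠ w in 𝓝[(T.Y α).support] (T.φ α x), ∃ z, P z ∧ T.φ α z = w := by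
  have h1 : ∀ᶠ z : T.U α in 𝓝 ⟨x, hx⟩, P z := continuous_subtype_val.continuousAt.eventually hP
  have h2 : ∀ᶠ w : (T.Y α).support in 𝓝 ((T.mapsTo α).restrict (T.φ α) (T.U α) (T.Y α).support ⟨x, hx⟩),
      ∃ z, P z ∧ T.φ α z = (w : TSpace (T.N α)) := by
    rw [← (T.isOpenEmbedding α).map_nhds_eq, eventually_map]
    exact h1.mono fun z hz => ⟨z, hz, rfl⟩
  rw [eventually_nhds_subtype_iff (T.Y α).support _
    (fun w => ∃ z, P z ∧ T.φ α z = w)] at h2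
  exact h2

/-- The differential of the overlapping map is determined on the span of the local cone. -/
lemma realLin_eq_of_isTransition {α β : Fin T.numCharts} {x : X} (hx : x ∈ T.U α)
    {A B : Matrix (Fin (T.N β)) (Fin (T.N α)) ℤ} (hA : T.IsTransition α β x A)
    (hB : T.IsTransition α β x B) :
    ∀ v ∈ Submodule.span ℝ ((T.Y α).localCone (T.φ α x)), realLin A v = realLin B v := by
  have hY := T.regular α
  suffices H : Submodule.span ℝ ((T.Y α).localCone (T.φ α x)) ≤
      LinearMap.eqLocus (realLin A) (realLin B) from H
  refine Submodule.span_le.2 fun v hv => ?_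
  obtain ⟨a, hA⟩ := hA
  obtain ⟨b, hB⟩ := hB
  have hev := T.eventually_nhdsWithin_support hx (hA.and hB)
  obtain ⟨I, u, hy⟩ : ∃ I u, T.φ α x = emb I u := ⟨_, _, (emb_realPart _).symm⟩
  rw [hy] at hv hev
  obtain ⟨i, hi, hv⟩ := PolyComplex.mem_localCone_emb.1 hv
  obtain ⟨O, hOP, hO, hmem⟩ := eventually_nhds_iff.1 (eventually_nhdsWithin_iff.1 hev)
  have hc : ContinuousAt (fun ε : ℝ => emb I (u + ε • v)) 0 :=
    ((continuous_emb I).comp (by fun_prop)).continuousAt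
  have h1 : ∀ᶠ ε : ℝ in 𝓝[>] 0, emb I (u + ε • v) ∈ O :=
    nhdsWithin_le_nhds (hc.eventually_mem (hO.mem_nhds (by simpa using hmem)))
  -- First `ε` is chosen so that the displaced point of the stratum stays in `O`, then `R` so that
  -- both points have finite lifts in `O` and in the facet. Comparing the two affine maps at both
  -- lifts and subtracting cancels the translation parts.
  obtain ⟨ε, ⟨hε1, hε2⟩, hpos⟩ := ((h1.and
    (PolyComplex.eventually_lift_add_mem_facet hY hi hv)).and self_mem_nhdsWithin).exists
  have h2 := (tendsto_emb_lift I (u + ε • v)).eventually_mem (hO.mem_nhds hε1)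
  have h3 := (tendsto_emb_lift I u).eventually_mem (hO.mem_nhds hmem)
  obtain ⟨R, ⟨hR1, hR2⟩, hR3, hR4⟩ := ((h2.and h3).and (hε2.and
    (PolyComplex.eventually_lift_mem_facet_self hY hi))).exists
  rw [lift_add] at hR1
  obtain ⟨z, ⟨hzA, hzB⟩, hz⟩ := hOP _ hR1 (mem_iUnion.2 ⟨i, hR3⟩)
  obtain ⟨z', ⟨hzA', hzB'⟩, hz'⟩ := hOP _ hR2 (mem_iUnion.2 ⟨i, hR4⟩)
  rw [hz] at hzA hzB
  rw [hz'] at hzA' hzB'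
  have e1 := hzA.realPart_eq.symm.trans hzB.realPart_eq
  have e2 := hzA'.realPart_eq.symm.trans hzB'.realPart_eq
  rw [map_add, map_add, map_smul, map_smul] at e1
  have e3 : ε • realLin A v = ε • realLin B v := by
    have := congrArg₂ (· - ·) e1 e2
    simpa [add_sub_add_right_eq_sub] using this
  exact smul_right_injective _ (ne_of_gt (mem_Ioi.1 hpos)) e3

lemma IsTransition.eventually {α β : Fin T.numCharts} {x : X}
    {A : Matrix (Fin (T.N β)) (Fin (T.N α)) ℤ} (hA : T.IsTransition α β x A) :
    ∀ᶠ z in 𝓝 x, T.IsTransition α β z A := by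
  obtain ⟨b, hb⟩ := hA
  exact (eventually_eventually_nhds.2 hb).mono fun z hz => ⟨b, hz⟩

lemma IsTransition.divProj_comp {α β : Fin T.numCharts} {x : X}
    {A : Matrix (Fin (T.N β)) (Fin (T.N α)) ℤ} (hA : T.IsTransition α β x A) :
    divProj (sed (T.φ β x)) ∘ₗ realLin A ∘ₗ divProj (sed (T.φ α x)) =
      divProj (sed (T.φ β x)) ∘ₗ realLin A := by
  obtain ⟨b, hb⟩ := hA
  exact hb.self_of_nhds.divProj_comp

end TropicalSpace

namespace TropicalSpace

variable {X : Type*} [TopologicalSpace X] {T : TropicalSpace X}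

/-! ## Coefficients along a simplex -/

/-- The segment from a point of the standard simplex to the barycenter. -/
def toBarycenter {q : ℕ} (t : stdSimplex ℝ (Fin (q + 1))) (ε : unitInterval) :
    stdSimplex ℝ (Fin (q + 1)) :=
  ⟨(1 - (ε : ℝ)) • (t : Fin (q + 1) → ℝ) +
      (ε : ℝ) • ((stdSimplex.barycenter : stdSimplex ℝ (Fin (q + 1))) : Fin (q + 1) → ℝ),
    convex_stdSimplex ℝ (Fin (q + 1)) t.2 (stdSimplex.barycenter (𝕜 := ℝ)).2
      (sub_nonneg.2 ε.2.2) ε.2.1 (sub_add_cancel _ _)⟩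

lemma toBarycenter_zero {q : ℕ} (t : stdSimplex ℝ (Fin (q + 1))) : toBarycenter t 0 = t :=
  Subtype.ext (by simp [toBarycenter]; rfl)

lemma toBarycenter_one {q : ℕ} (t : stdSimplex ℝ (Fin (q + 1))) :
    toBarycenter t 1 = stdSimplex.barycenter :=
  Subtype.ext (by simp [toBarycenter]; rfl)

lemma continuous_toBarycenter {q : ℕ} (t : stdSimplex ℝ (Fin (q + 1))) :
    Continuous (toBarycenter t) := by
  refine Continuous.subtype_mk ?_ _
  fun_prop

lemma barycenter_pos {q : ℕ} (i : Fin (q + 1)) :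
    0 < (stdSimplex.barycenter : stdSimplex ℝ (Fin (q + 1))) i := by
  change 0 < (stdSimplex.barycenter : stdSimplex ℝ (Fin (q + 1))).val i
  rw [stdSimplex.barycenter_apply, Fintype.card_fin]
  positivity

lemma toBarycenter_pos {q : ℕ} (t : stdSimplex ℝ (Fin (q + 1))) {ε : unitInterval} (hε : 0 < ε)
    (i : Fin (q + 1)) : 0 < toBarycenter t ε i := by
  have h1 : 0 ≤ (1 - (ε : ℝ)) * t i := mul_nonneg (sub_nonneg.2 ε.2.2) (t.2.1 i)
  have h2 : 0 < (ε : ℝ) * (stdSimplex.barycenter : stdSimplex ℝ (Fin (q + 1))) i :=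
    mul_pos (by exact_mod_cast hε) (barycenter_pos i)
  exact add_pos_of_nonneg_of_pos h1 h2

namespace ChartedSimplex

lemma mem_support {q : ℕ} (s : T.ChartedSimplex q) (t : stdSimplex ℝ (Fin (q + 1))) :
    T.φ s.chart (s.toMap t) ∈ (T.Y s.chart).support :=
  T.mapsTo s.chart (s.mem_chart t)

lemma continuous_coord {q : ℕ} (s : T.ChartedSimplex q) :
    Continuous fun t => T.φ s.chart (s.toMap t) :=
  (T.continuousOn_φ s.chart).comp_continuous s.toMap.continuous s.mem_chart

/-- Only the endpoints of the path in `CombEquiv` are used; the path itself may leave the chart. -/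
lemma type_eq {q : ℕ} (s : T.ChartedSimplex q) (t : stdSimplex ℝ (Fin (q + 1))) {ε : unitInterval}
    (hε : 0 < ε) :
    Module.finrank ℝ ((T.Y s.chart).waveSpace (T.φ s.chart (s.toMap (toBarycenter t ε)))) =
      Module.finrank ℝ ((T.Y s.chart).waveSpace s.pt) ∧
    (sed (T.φ s.chart (s.toMap (toBarycenter t ε)))).card = (sed s.pt).card := by
  obtain ⟨w, n, γ, hγ⟩ := s.compat (toBarycenter t ε) stdSimplex.barycenter
    fun i => iff_of_true (toBarycenter_pos t hε i) (barycenter_pos i)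
  have h0 := hγ 0 s.chart (by rw [γ.source]; exact s.mem_chart _)
  have h1 := hγ 1 s.chart (by rw [γ.target]; exact s.mem_chart _)
  rw [γ.source] at h0
  rw [γ.target] at h1
  exact ⟨h0.1.trans h1.1.symm, h0.2.trans h1.2.symm⟩

lemma eventually_near {q : ℕ} (s : T.ChartedSimplex q) (t : stdSimplex ℝ (Fin (q + 1)))
    (ε : unitInterval) : ∀ᶠ δ in 𝓝 ε, (T.Y s.chart).Near
      (T.φ s.chart (s.toMap (toBarycenter t ε))) (T.φ s.chart (s.toMap (toBarycenter t δ))) :=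
  (s.continuous_coord.comp (continuous_toBarycenter t)).continuousAt.eventually
    ((T.Y s.chart).eventually_near _)

/-- The sedentarity and the local cone are constant on the open simplex. -/
lemma localCone_eq {q : ℕ} (s : T.ChartedSimplex q) (t : stdSimplex ℝ (Fin (q + 1)))
    {ε : unitInterval} (hε : 0 < ε) :
    sed (T.φ s.chart (s.toMap (toBarycenter t ε))) = sed s.pt ∧
      (T.Y s.chart).localCone (T.φ s.chart (s.toMap (toBarycenter t ε))) =
        (T.Y s.chart).localCone s.pt := by
  have hY := T.regular s.chart
  have h1 : s.pt = T.φ s.chart (s.toMap (toBarycenter t 1)) := by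
    rw [toBarycenter_one]; rfl
  rw [h1]
  -- On the half-open segment the invariants are locally constant: nearness gives inclusions of
  -- sedentarities and of lineality spaces, and the constant type turns them into equalities. The
  -- endpoint `0` is excluded because it may lie on a smaller stratum.
  refine (isPreconnected_Ioi (a := (0 : unitInterval))).induction₂ (fun ε δ =>
    sed (T.φ s.chart (s.toMap (toBarycenter t ε))) =
      sed (T.φ s.chart (s.toMap (toBarycenter t δ))) ∧
    (T.Y s.chart).localCone (T.φ s.chart (s.toMap (toBarycenter t ε))) =
      (T.Y s.chart).localCone (T.φ s.chart (s.toMap (toBarycenter t δ)))) ?_ ?_ ?_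
    (mem_Ioi.2 hε) (mem_Ioi.2 zero_lt_one)
  · intro ε hε
    filter_upwards [nhdsWithin_le_nhds (s.eventually_near t ε), self_mem_nhdsWithin] with δ hn hδ
    have e1 := s.type_eq t hε
    have e2 := s.type_eq t (mem_Ioi.1 hδ)
    refine ⟨(Finset.eq_of_subset_of_card_le hn.sed_subset (e1.2.trans e2.2.symm).le).symm,
      hn.localCone_eq hY (Submodule.eq_of_le_of_finrank_eq (hn.linealitySpace_le hY) ?_)⟩
    rw [← PolyComplex.waveSpace_eq hY (s.mem_support _),
      ← PolyComplex.waveSpace_eq hY (s.mem_support _)]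
    exact e1.1.trans e2.1.symm
  · rintro x y z - - - ⟨h1, h2⟩ ⟨h3, h4⟩
    exact ⟨h1.trans h3, h2.trans h4⟩
  · rintro x y - - ⟨h1, h2⟩
    exact ⟨h1.symm, h2.symm⟩

lemma eventually_pos_near {q : ℕ} (s : T.ChartedSimplex q) (t : stdSimplex ℝ (Fin (q + 1)))
    {P : X → Prop} (hP : ∀ᶠ x in 𝓝 (s.toMap t), P x) :
    ∃ ε : unitInterval, 0 < ε ∧ P (s.toMap (toBarycenter t ε)) ∧ (T.Y s.chart).Near
      (T.φ s.chart (s.toMap t)) (T.φ s.chart (s.toMap (toBarycenter t ε))) := by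
  have h1 := s.eventually_near t 0
  have h2 : ∀ᶠ ε in 𝓝 (0 : unitInterval), P (s.toMap (toBarycenter t ε)) := by
    refine (s.toMap.continuous.comp (continuous_toBarycenter t)).continuousAt.eventually ?_
    simpa [toBarycenter_zero] using hP
  rw [toBarycenter_zero] at h1
  have : (𝓝[>] (0 : unitInterval)).NeBot := nhdsGT_neBot_of_exists_gt ⟨1, zero_lt_one⟩
  obtain ⟨ε, ⟨h4, h5⟩, h6⟩ :=
    (((h2.and h1).filter_mono nhdsWithin_le_nhds).and (self_mem_nhdsWithin (s := Ioi 0))).exists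
  exact ⟨ε, mem_Ioi.1 h6, h4, h5⟩

/-- Every point of the simplex is a specialisation of a point with the invariants of the
center. -/
lemma exists_near {q : ℕ} (s : T.ChartedSimplex q) (t : stdSimplex ℝ (Fin (q + 1))) :
    ∃ y ∈ (T.Y s.chart).support, (T.Y s.chart).Near (T.φ s.chart (s.toMap t)) y ∧
      sed y = sed s.pt ∧ (T.Y s.chart).localCone y = (T.Y s.chart).localCone s.pt := by
  obtain ⟨ε, hε, -, hn⟩ := s.eventually_pos_near t (P := fun _ => True) (by simp)
  exact ⟨_, s.mem_support _, hn, s.localCone_eq t hε⟩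

lemma pt_mem_support {q : ℕ} (s : T.ChartedSimplex q) : s.pt ∈ (T.Y s.chart).support :=
  s.mem_support _

variable {m q : ℕ} (s : T.ChartedSimplex q) (f : Fin (m + 1) → Fin (q + 1))

lemma sed_subset_restrict : sed s.pt ⊆ sed (s.restrict f).pt := by
  obtain ⟨y, -, hn, hs, -⟩ := s.exists_near (stdSimplex.map f stdSimplex.barycenter)
  rw [← hs]
  exact hn.sed_subset

lemma coeffW_restrict_le (k : ℕ) : (s.restrict f).coeffW k ≤ s.coeffW k := by
  have hY := T.regular s.chart
  obtain ⟨y, hy, hn, -, hK⟩ := s.exists_near (stdSimplex.map f stdSimplex.barycenter)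
  have h1 := hn.linealitySpace_le hY
  rw [hK, ← PolyComplex.waveSpace_eq hY s.pt_mem_support,
    ← PolyComplex.waveSpace_eq hY (s.mem_support _)] at h1
  exact PolyComplex.waveK_mono k h1

lemma project_mem_coeffF {p : ℕ} {β : s.Coeff} (hβ : β ∈ s.coeffF p) :
    (s.restrict f).project β ∈ (s.restrict f).coeffF p := by
  have hY := T.regular s.chart
  obtain ⟨y, hy, hn, hs, hK⟩ := s.exists_near (stdSimplex.map f stdSimplex.barycenter)
  exact hn.map_divProj_mem_realF hY (PolyComplex.realF_le_of_localCone hY p hs.symm hK.ge hβ)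

lemma project_mul_mem_coeffF {p k : ℕ} {w β : s.Coeff} (hw : w ∈ s.coeffW k)
    (hβ : β ∈ s.coeffF p) : s.project w * β ∈ s.coeffF (p + k) :=
  PolyComplex.map_divProj_mul_mem_realF (T.regular s.chart) hw hβ

lemma project_mul (x y : s.Coeff) : s.project (x * y) = s.project x * s.project y :=
  map_mul (ExteriorAlgebra.map (divProj (sed s.pt))) x y

lemma project_restrict_project (x : s.Coeff) :
    (s.restrict f).project (s.project x) = (s.restrict f).project x :=
  PolyComplex.map_divProj_map_divProj (s.sed_subset_restrict f) x

/-- The differentials of the overlapping maps at all points of a simplex agree on the span of the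
local cone of the simplex. -/
lemma realLin_eq (s : T.ChartedSimplex q) {β : Fin T.numCharts} (hβ : ∀ t, s.toMap t ∈ T.U β)
    {t t' : stdSimplex ℝ (Fin (q + 1))} {A A' : Matrix (Fin (T.N β)) (Fin (T.N s.chart)) ℤ}
    (hA : T.IsTransition s.chart β (s.toMap t) A)
    (hA' : T.IsTransition s.chart β (s.toMap t') A') :
    ∀ v ∈ Submodule.span ℝ ((T.Y s.chart).localCone s.pt), realLin A v = realLin A' v := by
  have key : ∀ (t : stdSimplex ℝ (Fin (q + 1))) (A B : Matrix (Fin (T.N β)) (Fin (T.N s.chart)) ℤ),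
      T.IsTransition s.chart β (s.toMap t) A → T.IsTransition s.chart β s.center B →
      ∀ v ∈ Submodule.span ℝ ((T.Y s.chart).localCone s.pt), realLin A v = realLin B v := by
    intro t A B hA hB v hv
    have hloc : ∀ {ε : unitInterval}, 0 < ε →
        ∀ {C C' : Matrix (Fin (T.N β)) (Fin (T.N s.chart)) ℤ},
        T.IsTransition s.chart β (s.toMap (toBarycenter t ε)) C →
        T.IsTransition s.chart β (s.toMap (toBarycenter t ε)) C' → realLin C v = realLin C' v := by
      intro ε hε C C' hC hC'
      refine T.realLin_eq_of_isTransition (s.mem_chart _) hC hC' v ?_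
      rwa [(s.localCone_eq t hε).2]
    obtain ⟨ε, hε, hAε, -⟩ := s.eventually_pos_near t (IsTransition.eventually T hA)
    -- The relation quantifies over all matrices that induce the overlap map. It is transitive
    -- because compatibility of charts provides such a matrix at the middle point.
    have hcon := (isPreconnected_Ioi (a := (0 : unitInterval))).induction₂ (fun ε δ =>
      ∀ C C' : Matrix (Fin (T.N β)) (Fin (T.N s.chart)) ℤ,
        T.IsTransition s.chart β (s.toMap (toBarycenter t ε)) C →
        T.IsTransition s.chart β (s.toMap (toBarycenter t δ)) C' → realLin C v = realLin C' v)
      ?_ ?_ ?_ (mem_Ioi.2 hε) (mem_Ioi.2 zero_lt_one)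
    · refine hcon A B hAε ?_
      rw [toBarycenter_one]
      exact hB
    · intro ε hε
      obtain ⟨D, b, hD⟩ := T.compatible s.chart β (s.toMap (toBarycenter t ε))
        ⟨s.mem_chart _, hβ _⟩
      have hD : T.IsTransition s.chart β (s.toMap (toBarycenter t ε)) D := ⟨b, hD⟩
      have hev : ∀ᶠ δ in 𝓝 ε, T.IsTransition s.chart β (s.toMap (toBarycenter t δ)) D :=
        (s.toMap.continuous.comp (continuous_toBarycenter t)).continuousAt.eventually
          (IsTransition.eventually T hD)
      filter_upwards [nhdsWithin_le_nhds hev, self_mem_nhdsWithin] with δ hδ hpos C C' hC hC'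
      exact (hloc hε hC hD).trans (hloc hpos hδ hC')
    · intro x y z hx hy hz hxy hyz C C' hC hC'
      obtain ⟨D, b, hD⟩ := T.compatible s.chart β (s.toMap (toBarycenter t y))
        ⟨s.mem_chart _, hβ _⟩
      exact (hxy C D hC ⟨b, hD⟩).trans (hyz D C' ⟨b, hD⟩ hC')
    · intro x y hx hy hxy C C' hC hC'
      exact (hxy C' C hC' hC).symm
  intro v hv
  obtain ⟨B, b, hB⟩ := T.compatible s.chart β s.center ⟨s.mem_chart _, hβ _⟩
  exact (key t A B hA ⟨b, hB⟩ v hv).trans (key t' A' B hA' ⟨b, hB⟩ v hv).symm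

lemma coeffW_le_wedgePower (k : ℕ) :
    s.coeffW k ≤ wedgePower k (Submodule.span ℝ ((T.Y s.chart).localCone s.pt)) :=
  PolyComplex.waveK_le_wedgePower (T.regular s.chart) k s.pt_mem_support

lemma coeffF_le_wedgePower (p : ℕ) :
    s.coeffF p ≤ wedgePower p (Submodule.span ℝ ((T.Y s.chart).localCone s.pt)) :=
  PolyComplex.realF_le_wedgePower (T.regular s.chart) p s.pt

/-- The differential of an overlapping map is defined on quotients by divisorial directions. -/
lemma project_map_project {s s' : T.ChartedSimplex q} (hs : s.toMap = s'.toMap)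
    {B : Matrix (Fin (T.N s'.chart)) (Fin (T.N s.chart)) ℤ}
    (hB : T.IsTransition s.chart s'.chart s.center B) (x : s.Coeff) :
    s'.project (ExteriorAlgebra.map (realLin B) (s.project x)) =
      s'.project (ExteriorAlgebra.map (realLin B) x) := by
  change ExteriorAlgebra.map (divProj (sed s'.pt)) (ExteriorAlgebra.map _
    (ExteriorAlgebra.map (divProj (sed s.pt)) x)) =
      ExteriorAlgebra.map (divProj (sed s'.pt)) (ExteriorAlgebra.map _ x)
  have hpt : s'.pt = T.φ s'.chart s.center := by
    rw [pt, center, center, hs]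
  rw [map_map_apply, map_map_apply, map_map_apply, hpt]
  have := IsTransition.divProj_comp T hB
  rw [LinearMap.comp_assoc]
  exact congrArg (fun g => ExteriorAlgebra.map g x) this

end ChartedSimplex

end TropicalSpace

/-! ## Bilinear maps of subquotients -/

/-- The product descends in one variable at a time, and surjectivity of the class maps gives
uniqueness. `F` is kept apart from its bilinear form `f` because `cap` is bundled as linear only in
the chain. -/
lemma existsUnique_subQuot_bilinear {M₁ M₂ M₃ : Type*} [AddCommGroup M₁] [Module ℝ M₁]
    [AddCommGroup M₂] [Module ℝ M₂] [AddCommGroup M₃] [Module ℝ M₃]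
    {Z₁ B₁ : Submodule ℝ M₁} {Z₂ B₂ : Submodule ℝ M₂} {Z₃ B₃ : Submodule ℝ M₃}
    (F : M₁ → M₂ →ₗ[ℝ] M₃) (f : M₁ →ₗ[ℝ] M₂ →ₗ[ℝ] M₃) (hF : ∀ a, F a = f a) (hZ : ∀ a ∈ Z₁, ∀ c ∈ Z₂, f a c ∈ Z₃)
    (hB₁ : ∀ a ∈ B₁, ∀ c ∈ Z₂, f a c ∈ B₃) (hB₂ : ∀ a ∈ Z₁, ∀ c ∈ B₂, f a c ∈ B₃) :
    ∃! Φ : SubQuot Z₁ B₁ →ₗ[ℝ] SubQuot Z₂ B₂ →ₗ[ℝ] SubQuot Z₃ B₃,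
      ∀ (a : Z₁) (c : Z₂), ∃ h : F a.1 c.1 ∈ Z₃,
        Φ (SubQuot.mk Z₁ B₁ a) (SubQuot.mk Z₂ B₂ c) = SubQuot.mk Z₃ B₃ ⟨F a.1 c.1, h⟩ := by
  obtain rfl : F = f := funext hF
  have hmk : ∀ (x : M₃) (h : x ∈ Z₃), x ∈ B₃ → SubQuot.mk Z₃ B₃ ⟨x, h⟩ = 0 := fun x h hx =>
    (Submodule.Quotient.mk_eq_zero _).2 hx
  let g : Z₁ →ₗ[ℝ] Z₂ →ₗ[ℝ] SubQuot Z₃ B₃ := LinearMap.mk₂ ℝ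
    (fun a c => SubQuot.mk Z₃ B₃ ⟨f a.1 c.1, hZ _ a.2 _ c.2⟩)
    (fun a a' c => by rw [← map_add]; congr 1; ext; simp)
    (fun t a c => by rw [← map_smul]; congr 1; ext; simp)
    (fun a c c' => by rw [← map_add]; congr 1; ext; simp)
    (fun t a c => by rw [← map_smul]; congr 1; ext; simp)
  let g₁ : SubQuot Z₁ B₁ →ₗ[ℝ] Z₂ →ₗ[ℝ] SubQuot Z₃ B₃ :=
    (B₁.submoduleOf Z₁).liftQ g fun a ha => by
      rw [LinearMap.mem_ker]
      exact LinearMap.ext fun c => hmk _ _ (hB₁ _ ha _ c.2)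
  let g₂ : SubQuot Z₂ B₂ →ₗ[ℝ] SubQuot Z₁ B₁ →ₗ[ℝ] SubQuot Z₃ B₃ :=
    (B₂.submoduleOf Z₂).liftQ g₁.flip fun c hc => by
      rw [LinearMap.mem_ker]
      refine LinearMap.ext fun x => ?_
      obtain ⟨a, rfl⟩ := Submodule.mkQ_surjective _ x
      exact hmk _ _ (hB₂ _ a.2 _ hc)
  refine ⟨g₂.flip, fun a c => ⟨hZ _ a.2 _ c.2, rfl⟩, fun Ψ hΨ => ?_⟩
  refine LinearMap.ext fun x => LinearMap.ext fun y => ?_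
  obtain ⟨a, rfl⟩ := Submodule.mkQ_surjective _ x
  obtain ⟨c, rfl⟩ := Submodule.mkQ_surjective _ y
  obtain ⟨h, he⟩ := hΨ a c
  exact he

namespace TropicalSpace

variable {X : Type*} [TopologicalSpace X] {T : TropicalSpace X}

/-! ## Elementary chains -/

namespace ChartedSimplex

variable {l m q : ℕ}

lemma restrict_restrict (s : T.ChartedSimplex q) (f : Fin (m + 1) → Fin (q + 1))
    (g : Fin (l + 1) → Fin (m + 1)) : (s.restrict f).restrict g = s.restrict (f ∘ g) := by
  have : (s.toMap.comp ⟨stdSimplex.map f, stdSimplex.continuous_map f⟩).comp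
      ⟨stdSimplex.map g, stdSimplex.continuous_map g⟩ =
        s.toMap.comp ⟨stdSimplex.map (f ∘ g), stdSimplex.continuous_map (f ∘ g)⟩ := by
    ext t
    exact congrArg s.toMap (stdSimplex.map_comp_apply g f t)
  unfold restrict
  congr 1

open scoped Classical in
/-- The elementary chain `x τ` on the face `τ` of `s` given by `f`. -/
def faceChain (s : T.ChartedSimplex q) (f : Fin (m + 1) → Fin (q + 1)) :
    s.Coeff →ₗ[ℝ] T.FormalSum m :=
  (DFinsupp.lsingle (s.restrict f)).comp (s.restrict f).project

/-- The value of a cochain on the face of `s` given by `f`. -/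
def faceValue (a : T.FormalCochain m) (s : T.ChartedSimplex q)
    (f : Fin (m + 1) → Fin (q + 1)) : s.Coeff :=
  a (s.restrict f)

/-- Restriction keeps the chart, so `x` is a coefficient on both sides; the simplices are only
propositionally equal, hence the transport through `HEq`. -/
lemma faceChain_restrict (s : T.ChartedSimplex q) (f : Fin (m + 1) → Fin (q + 1))
    (g : Fin (l + 1) → Fin (m + 1)) (x : s.Coeff) :
    (s.restrict f).faceChain g x = s.faceChain (f ∘ g) x := by
  classical
  have key : ∀ (σ τ : T.ChartedSimplex l), σ = τ → ∀ (x : σ.Coeff) (y : τ.Coeff), HEq x y →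
      (DFinsupp.single σ (σ.project x) : T.FormalSum l) = DFinsupp.single τ (τ.project y) := by
    rintro σ _ rfl x y hxy
    rw [eq_of_heq hxy]
  exact key _ _ (s.restrict_restrict f g) x x HEq.rfl

lemma faceValue_restrict (a : T.FormalCochain l) (s : T.ChartedSimplex q)
    (f : Fin (m + 1) → Fin (q + 1)) (g : Fin (l + 1) → Fin (m + 1)) :
    (s.restrict f).faceValue a g = s.faceValue a (f ∘ g) := by
  have key : ∀ (σ τ : T.ChartedSimplex l), σ = τ → HEq (a σ) (a τ) := by
    rintro σ _ rfl
    rfl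
  exact eq_of_heq (key _ _ (s.restrict_restrict f g))

/-- Passing to a face only enlarges the sedentarity, so the projection to the face absorbs the
earlier one. -/
lemma project_restrict_project_mul (s : T.ChartedSimplex q) (f : Fin (m + 1) → Fin (q + 1))
    (x y : s.Coeff) :
    (s.restrict f).project (s.project x * y) = (s.restrict f).project (x * y) := by
  have h1 := (s.restrict f).project_mul (s.project x) y
  have h2 := (s.restrict f).project_mul x y
  rw [s.project_restrict_project f x] at h1
  exact h1.trans h2.symm

lemma project_restrict_mul_project (s : T.ChartedSimplex q) (f : Fin (m + 1) → Fin (q + 1))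
    (x y : s.Coeff) :
    (s.restrict f).project (x * s.project y) = (s.restrict f).project (x * y) := by
  have h1 := (s.restrict f).project_mul x (s.project y)
  have h2 := (s.restrict f).project_mul x y
  rw [s.project_restrict_project f y] at h1
  exact h1.trans h2.symm

end ChartedSimplex

/-- The inclusion of the first `r + 1` vertices. -/
def frontMap {r q : ℕ} (h : r ≤ q) : Fin (r + 1) → Fin (q + 1) := Fin.castLE (Nat.succ_le_succ h)

/-- The inclusion of the last `m + 1` vertices. -/
def backMap {r m q : ℕ} (h : r + m = q) : Fin (m + 1) → Fin (q + 1) := fun i => ⟨r + i, by omega⟩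

variable (T) in
open scoped Classical in
/-- The cap product with a cochain of degree `r` on chains of degree `q = r + m`. -/
def capLin {r m q : ℕ} (h : r + m = q) (a : T.FormalCochain r) :
    T.FormalSum q →ₗ[ℝ] T.FormalSum m :=
  DFinsupp.lsum ℝ fun s =>
    (s.faceChain (backMap h)).comp (LinearMap.mulLeft ℝ
      (s.project (s.faceValue a (frontMap (h ▸ Nat.le_add_right r m)))))

/-- Writing the degree as `r + m = q` avoids truncated subtraction when degrees shift in the Leibniz
formula. -/
lemma cap_eq_capLin {r q : ℕ} (h : r ≤ q) (a : T.FormalCochain r) :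
    T.cap h a = T.capLin (Nat.add_sub_cancel' h) a := rfl

/-! ### Cap product, boundary and coboundary on elementary chains; the Leibniz formula -/

section Formulas

variable {r m q : ℕ}

open scoped Classical in
lemma capLin_single (h : r + m = q) (a : T.FormalCochain r) (s : T.ChartedSimplex q)
    (β : s.Coeff) : T.capLin h a (DFinsupp.single s β) =
      s.faceChain (backMap h) (s.faceValue a (frontMap (h ▸ Nat.le_add_right r m)) * β) := by
  rw [capLin, DFinsupp.lsum_single]
  exact congrArg (DFinsupp.single (s.restrict (backMap h)))
    (s.project_restrict_project_mul _ _ _)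

open scoped Classical in
lemma boundary_single (s : T.ChartedSimplex (q + 1)) (β : s.Coeff) :
    T.boundary q (DFinsupp.single s β) =
      ∑ i : Fin (q + 2), (-1 : ℝ) ^ (i : ℕ) • s.faceChain i.succAbove β := by
  rw [boundary, DFinsupp.lsum_single]
  change (∑ i : Fin (q + 2), (-1 : ℝ) ^ (i : ℕ) • s.faceChain i.succAbove) β = _
  rw [LinearMap.sum_apply]
  rfl

lemma capLin_faceChain {n : ℕ} (h : r + m = n) (a : T.FormalCochain r) (s : T.ChartedSimplex q)
    (f : Fin (n + 1) → Fin (q + 1)) (β : s.Coeff) : T.capLin h a (s.faceChain f β) =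
      s.faceChain (f ∘ backMap h)
        (s.faceValue a (f ∘ frontMap (h ▸ Nat.le_add_right r m)) * β) := by
  classical
  have h1 := capLin_single h a (s.restrict f) ((s.restrict f).project β)
  refine h1.trans ?_
  rw [← s.faceChain_restrict, ← s.faceValue_restrict]
  exact congrArg (DFinsupp.single ((s.restrict f).restrict (backMap h)))
    ((s.restrict f).project_restrict_mul_project _ _ _)

lemma boundary_faceChain {n : ℕ} (s : T.ChartedSimplex q) (f : Fin (n + 1 + 1) → Fin (q + 1))
    (β : s.Coeff) : T.boundary n (s.faceChain f β) =
      ∑ i : Fin (n + 2), (-1 : ℝ) ^ (i : ℕ) • s.faceChain (f ∘ i.succAbove) β := by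
  classical
  have h1 := boundary_single (s.restrict f) ((s.restrict f).project β)
  refine h1.trans (Finset.sum_congr rfl fun i _ => ?_)
  rw [← s.faceChain_restrict]
  exact congrArg _ (congrArg (DFinsupp.single ((s.restrict f).restrict i.succAbove))
    ((s.restrict f).project_restrict_project _ _))

lemma faceValue_coboundary (a : T.FormalCochain r) (s : T.ChartedSimplex q)
    (f : Fin (r + 1 + 1) → Fin (q + 1)) : s.faceValue (T.coboundary r a) f =
      ∑ i : Fin (r + 2), (-1 : ℝ) ^ (i : ℕ) • s.faceValue a (f ∘ i.succAbove) := by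
  have h1 : s.faceValue (T.coboundary r a) f =
      ∑ i : Fin (r + 2), (-1 : ℝ) ^ (i : ℕ) • (s.restrict f).faceValue a i.succAbove := by
    simp only [ChartedSimplex.faceValue, coboundary, LinearMap.pi_apply, LinearMap.sum_apply]
    rfl
  rw [h1]
  exact Finset.sum_congr rfl fun i _ => congrArg _ (s.faceValue_restrict a f i.succAbove)

lemma capLin_add (h : r + m = q) (a b : T.FormalCochain r) :
    T.capLin h (a + b) = T.capLin h a + T.capLin h b := by
  classical
  refine DFinsupp.lhom_ext fun s β => ?_
  rw [LinearMap.add_apply, capLin_single, capLin_single, capLin_single, ← map_add, ← add_mul]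
  rfl

lemma capLin_smul (h : r + m = q) (t : ℝ) (a : T.FormalCochain r) :
    T.capLin h (t • a) = t • T.capLin h a := by
  classical
  refine DFinsupp.lhom_ext fun s β => ?_
  rw [LinearMap.smul_apply, capLin_single, capLin_single, ← map_smul, ← smul_mul_assoc]
  rfl

variable (T) in
/-- The cap product as a bilinear map. -/
def capBilin (h : r + m = q) :
    T.FormalCochain r →ₗ[ℝ] T.FormalSum q →ₗ[ℝ] T.FormalSum m where
  toFun := T.capLin h
  map_add' := capLin_add h
  map_smul' := capLin_smul h

/-- The Leibniz formula for the cap product. -/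
lemma capLin_boundary (h : r + m = q) (h₁ : r + 1 + m = q + 1) (h₂ : r + (m + 1) = q + 1)
    (a : T.FormalCochain r) (c : T.FormalSum (q + 1)) :
    T.capLin h a (T.boundary q c) =
      T.capLin h₁ (T.coboundary r a) c + (-1 : ℝ) ^ r • T.boundary m (T.capLin h₂ a c) := by
  classical
  suffices H : (T.capLin h a).comp (T.boundary q) =
      T.capLin h₁ (T.coboundary r a) + (-1 : ℝ) ^ r • (T.boundary m).comp (T.capLin h₂ a) from
    LinearMap.congr_fun H c
  refine DFinsupp.lhom_ext fun s β => ?_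
  simp only [LinearMap.comp_apply, LinearMap.add_apply, LinearMap.smul_apply]
  rw [boundary_single, capLin_single, capLin_single, map_sum, boundary_faceChain,
    faceValue_coboundary, Finset.sum_mul, map_sum, Fin.sum_univ_castSucc (n := r + 1),
    Fin.sum_univ_succ (n := m + 1)]
  subst h
  -- The faces of the simplex are split by the omitted vertex. The `r + 1` vertices `0, …, r` give
  -- terms of the coboundary, the remaining `m + 1` give terms of the boundary of the cap product.
  rw [← (finCongr (show r + 1 + (m + 1) = r + m + 2 by omega)).sum_comp, Fin.sum_univ_add,
    smul_add, Finset.smul_sum]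
  simp only [map_smul, capLin_faceChain, smul_mul_assoc, smul_smul, finCongr_apply]
  have e1 : ∀ i : Fin (r + 1), (Fin.cast (show r + 1 + (m + 1) = r + m + 2 by omega)
      (Fin.castAdd (m + 1) i)).succAbove ∘ backMap rfl = backMap h₁ := fun i => by
    funext l
    ext
    simp only [Function.comp_apply, backMap, Fin.succAbove, Fin.lt_def,
      Fin.val_castSucc, Fin.val_cast, Fin.val_castAdd]
    have := i.2
    rw [if_neg (by omega)]
    simp only [Fin.val_succ]
    omega
  have e2 : ∀ i : Fin (r + 1), (Fin.cast (show r + 1 + (m + 1) = r + m + 2 by omega)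
      (Fin.castAdd (m + 1) i)).succAbove ∘ frontMap (Nat.le_add_right r m) =
        frontMap (show r + 1 ≤ r + m + 1 by omega) ∘ i.castSucc.succAbove := fun i => by
    funext l
    ext
    simp only [Function.comp_apply, frontMap, Fin.succAbove, Fin.lt_def,
      Fin.val_castSucc, Fin.val_cast, Fin.val_castAdd, Fin.val_castLE]
    split_ifs <;> simp
  have e3 : ∀ j : Fin (m + 1), (Fin.cast (show r + 1 + (m + 1) = r + m + 2 by omega)
      (Fin.natAdd (r + 1) j)).succAbove ∘ backMap rfl = backMap h₂ ∘ j.succ.succAbove := fun j => by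
    funext l
    ext
    simp only [Function.comp_apply, backMap, Fin.succAbove, Fin.lt_def,
      Fin.val_castSucc, Fin.val_cast, Fin.val_natAdd, Fin.val_succ]
    split_ifs <;> simp only [Fin.val_castSucc, Fin.val_succ] <;> omega
  have e4 : ∀ j : Fin (m + 1), (Fin.cast (show r + 1 + (m + 1) = r + m + 2 by omega)
      (Fin.natAdd (r + 1) j)).succAbove ∘ frontMap (Nat.le_add_right r m) =
        frontMap (show r ≤ r + m + 1 by omega) := fun j => by
    funext l
    ext
    simp only [Function.comp_apply, frontMap, Fin.succAbove, Fin.lt_def,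
      Fin.val_castSucc, Fin.val_cast, Fin.val_natAdd, Fin.val_castLE]
    have := l.2
    rw [if_pos (by omega)]
    simp
  -- Two terms on the right remain: the front of the coboundary without its last vertex, and the
  -- back of the boundary without its first. They give the same chain with opposite signs and
  -- cancel.
  have e5 : frontMap (show r + 1 ≤ r + m + 1 by omega) ∘ (Fin.last (r + 1)).succAbove =
      frontMap (show r ≤ r + m + 1 by omega) := by
    funext l
    ext
    simp [frontMap]
  have e6 : backMap h₂ ∘ (0 : Fin (m + 2)).succAbove = backMap h₁ := by
    funext l
    ext
    simp only [Function.comp_apply, backMap, Fin.zero_succAbove, Fin.val_succ]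
    omega
  simp only [e1, e2, e3, e4, e5, e6, Fin.val_cast, Fin.val_castAdd, Fin.val_natAdd,
    Fin.val_castSucc, Fin.val_last, Fin.val_succ, Fin.val_zero, pow_zero, mul_one]
  have e7 : ∀ j : ℕ, (-1 : ℝ) ^ (r + 1 + j) = (-1) ^ r * (-1) ^ (j + 1) := fun j => by ring
  simp only [e7]
  rw [pow_succ (-1 : ℝ) r, mul_neg_one, neg_smul]
  abel

end Formulas

/-! ## The cap product of tropical chains and wave cochains -/

section Cap

variable {k p q r m : ℕ}

open scoped Classical in
lemma single_mem_chains {s : T.ChartedSimplex q} {β : s.Coeff} (hβ : β ∈ s.coeffF p) :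
    (DFinsupp.single s β : T.FormalSum q) ∈ T.chains p q := by
  intro s'
  by_cases h : s = s'
  · subst h
    rwa [DFinsupp.single_eq_same]
  · rw [DFinsupp.single_eq_of_ne (Ne.symm h)]
    exact Submodule.zero_mem _

lemma faceChain_mem_chains {s : T.ChartedSimplex q} (f : Fin (m + 1) → Fin (q + 1))
    {β : s.Coeff} (hβ : β ∈ s.coeffF p) : s.faceChain f β ∈ T.chains p m :=
  single_mem_chains (s.project_mem_coeffF f hβ)

lemma capLin_mem_chains (h : r + m = q) {a : T.FormalCochain r} (ha : a ∈ T.cochains k r)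
    {c : T.FormalSum q} (hc : c ∈ T.chains p q) : T.capLin h a c ∈ T.chains (p + k) m := by
  classical
  rw [← DFinsupp.sum_single (f := c), DFinsupp.sum, map_sum]
  refine Submodule.sum_mem _ fun s _ => ?_
  set f := frontMap (show r ≤ q by omega)
  have haW : s.faceValue a f ∈ s.coeffW k := s.coeffW_restrict_le f k (ha.1 _)
  -- The inner projection is kept here, unlike in `capLin_single`, because the wedge lies in
  -- `F_{p+k}(σ) ⊗ ℝ` after the wave value is projected.
  have h1 : T.capLin h a (DFinsupp.single s (c s)) =
      s.faceChain (backMap h) (s.project (s.faceValue a f) * c s) := by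
    rw [capLin, DFinsupp.lsum_single]
    rfl
  rw [h1]
  exact faceChain_mem_chains (backMap h) (s.project_mul_mem_coeffF haW (hc s))

lemma capLin_mem_chartRel (h : r + m = q) {a : T.FormalCochain r} (ha : a ∈ T.cochains k r)
    {c : T.FormalSum q} (hc : c ∈ T.chartRel p q) : T.capLin h a c ∈ T.chartRel (p + k) m := by
  classical
  suffices H : T.chartRel p q ≤ (T.chartRel (p + k) m).comap (T.capLin h a) from H hc
  refine Submodule.span_le.2 ?_
  rintro _ ⟨s, s', hs, A, hA, β, hβ, rfl⟩
  have hU : ∀ t, s.toMap t ∈ T.U s'.chart := fun t => hs ▸ s'.mem_chart t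
  set f := frontMap (show r ≤ q by omega)
  set b := backMap h
  have hfr : (s.restrict f).toMap = (s'.restrict f).toMap := by
    simp only [ChartedSimplex.restrict, hs]
  have hbk : (s.restrict b).toMap = (s'.restrict b).toMap := by
    simp only [ChartedSimplex.restrict, hs]
  -- Three matrices describe the change of chart: `A` at the center of the simplex, `A'` at that of
  -- the front face and `B` at that of the back face. They agree on the span of the local cone, so
  -- everything is rewritten with `B`, the one needed for the resulting chain.
  obtain ⟨A', b', hA'⟩ := T.compatible s.chart s'.chart (s.restrict f).center
    ⟨s.mem_chart _, hU _⟩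
  have hA' : T.IsTransition s.chart s'.chart (s.restrict f).center A' := ⟨b', hA'⟩
  obtain ⟨B, b'', hB⟩ := T.compatible s.chart s'.chart (s.restrict b).center
    ⟨s.mem_chart _, hU _⟩
  have hB : T.IsTransition s.chart s'.chart (s.restrict b).center B := ⟨b'', hB⟩
  have haW : s.faceValue a f ∈ s.coeffW k := s.coeffW_restrict_le f k (ha.1 _)
  have ha' : s'.faceValue a f = ExteriorAlgebra.map (realLin B) (s.faceValue a f) :=
    (ha.2 _ _ hfr A' hA').trans (map_eq_map_of_mem_wedgePower (s.realLin_eq hU hA' hB)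
      (s.coeffW_le_wedgePower k haW))
  have hβ' : ExteriorAlgebra.map (realLin A) β = ExteriorAlgebra.map (realLin B) β :=
    map_eq_map_of_mem_wedgePower (s.realLin_eq hU hA hB) (s.coeffF_le_wedgePower p hβ)
  refine Submodule.subset_span ⟨s.restrict b, s'.restrict b, hbk, B, hB,
    (s.restrict b).project (s.project (s.faceValue a f) * β), s.project_mem_coeffF b
      (s.project_mul_mem_coeffF haW hβ), ?_⟩
  rw [map_sub, capLin_single, capLin_single]
  have e1 : s.faceChain b (s.faceValue a f * β) = DFinsupp.single (s.restrict b)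
      ((s.restrict b).project (s.project (s.faceValue a f) * β)) :=
    congrArg (DFinsupp.single (s.restrict b)) (s.project_restrict_project_mul _ _ _).symm
  have e2 : s'.faceChain b (s'.faceValue a f *
      s'.project (ExteriorAlgebra.map (realLin A) β)) = DFinsupp.single (s'.restrict b)
        ((s'.restrict b).project (ExteriorAlgebra.map (realLin B)
          ((s.restrict b).project (s.project (s.faceValue a f) * β)))) := by
    refine congrArg (DFinsupp.single (s'.restrict b)) ?_
    refine (s'.project_restrict_mul_project b _ _).trans ?_
    rw [ha', hβ', ← map_mul]
    have h1 := ChartedSimplex.project_map_project hbk hB (s.faceValue a f * β)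
    have h2 := s.project_restrict_project_mul b (s.faceValue a f) β
    refine h1.symm.trans ?_
    exact congrArg (fun x => (s'.restrict b).project (ExteriorAlgebra.map (realLin B) x)) h2.symm
  exact congrArg₂ (· - ·) e1 e2

lemma cycles_le_chains : T.cycles p q ≤ T.chains p q := by
  cases q with
  | zero => exact le_rfl
  | succ q => exact inf_le_left

lemma coboundary_eq_zero {a : T.FormalCochain r} (ha : a ∈ T.cocycles k r) :
    T.coboundary r a = 0 := ha.2

lemma capLin_zero (h : r + m = q) (c : T.FormalSum q) : T.capLin h 0 c = 0 :=
  LinearMap.congr_fun (map_zero (T.capBilin h)) c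

lemma chartRel_le_boundaries : T.chartRel p q ≤ T.boundaries p q := le_sup_right

lemma boundary_mem_boundaries {c : T.FormalSum (q + 1)} (hc : c ∈ T.chains p (q + 1)) :
    T.boundary q c ∈ T.boundaries p q :=
  Submodule.mem_sup_left (Submodule.mem_map_of_mem hc)

/-- For a cocycle, the Leibniz formula equates `∂(a ∩ c)` with `a ∩ ∂c` up to sign, and `∂c` is a
combination of chart relations. In degree `m = 0` there is no boundary condition. -/
lemma capLin_mem_cycles (h : r + m = q) {a : T.FormalCochain r} (ha : a ∈ T.cocycles k r)
    {c : T.FormalSum q} (hc : c ∈ T.cycles p q) : T.capLin h a c ∈ T.cycles (p + k) m := by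
  have hch := capLin_mem_chains h ha.1 (cycles_le_chains hc)
  cases m with
  | zero => exact hch
  | succ m =>
    obtain ⟨q, rfl⟩ : ∃ n, q = n + 1 := ⟨r + m, by omega⟩
    have h1 := capLin_boundary (show r + m = q by omega) (by omega) h a c
    rw [coboundary_eq_zero ha, capLin_zero, zero_add] at h1
    have h2 := capLin_mem_chartRel (show r + m = q by omega) ha.1 hc.2
    rw [h1] at h2
    exact ⟨hch, (Submodule.smul_mem_iff (T.chartRel (p + k) m)
      (pow_ne_zero r (neg_ne_zero.2 one_ne_zero))).1 h2⟩

/-- The Leibniz formula writes `δb ∩ c` as the chart relation `b ∩ ∂c` plus or minus the boundary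
`∂(b ∩ c)`. -/
lemma capLin_mem_boundaries_of_coboundary (h : r + m = q) {a : T.FormalCochain r}
    (ha : a ∈ T.coboundaries k r) {c : T.FormalSum q} (hc : c ∈ T.cycles p q) :
    T.capLin h a c ∈ T.boundaries (p + k) m := by
  cases r with
  | zero =>
    rw [show a = 0 from ha, capLin_zero]
    exact Submodule.zero_mem _
  | succ r =>
    obtain ⟨q, rfl⟩ : ∃ n, q = n + 1 := ⟨r + m, by omega⟩
    obtain ⟨b, hb, rfl⟩ := ha
    have h1 := capLin_boundary (show r + m = q by omega) h (by omega) b c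
    rw [← sub_eq_iff_eq_add] at h1
    rw [← h1]
    exact sub_mem (chartRel_le_boundaries (capLin_mem_chartRel _ hb hc.2))
      (Submodule.smul_mem _ _ (boundary_mem_boundaries (capLin_mem_chains _ hb hc.1)))

lemma capLin_mem_boundaries (h : r + m = q) {a : T.FormalCochain r} (ha : a ∈ T.cocycles k r)
    {c : T.FormalSum q} (hc : c ∈ T.boundaries p q) :
    T.capLin h a c ∈ T.boundaries (p + k) m := by
  obtain ⟨_, ⟨d, hd, rfl⟩, ρ, hρ, rfl⟩ := Submodule.mem_sup.1 hc
  rw [map_add]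
  refine add_mem ?_ (chartRel_le_boundaries (capLin_mem_chartRel h ha.1 hρ))
  rw [capLin_boundary h (by omega) (by omega), coboundary_eq_zero ha, capLin_zero, zero_add]
  exact Submodule.smul_mem _ _ (boundary_mem_boundaries (capLin_mem_chains _ ha.1 hd))

end Cap

end TropicalSpace

end TropWave

end

theorem mainTheorem7 {X : Type*} [TopologicalSpace X] (T : TropWave.TropicalSpace X)
    (k p q r : ℕ) (hrq : r ≤ q) :
    (∀ a ∈ T.cochains k r,
      (∀ c ∈ T.chains p q, T.cap hrq a c ∈ T.chains (p + k) (q - r)) ∧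
      (∀ c ∈ T.chartRel p q, T.cap hrq a c ∈ T.chartRel (p + k) (q - r))) ∧
    ∃! Φ : T.WaveCohomology k r →ₗ[ℝ]
        T.TropHomology p q →ₗ[ℝ] T.TropHomology (p + k) (q - r),
      ∀ (a : T.cocycles k r) (c : T.cycles p q),
        ∃ h : T.cap hrq a.1 c.1 ∈ T.cycles (p + k) (q - r),
          Φ (T.waveClass k r a) (T.tropClass p q c) =
            T.tropClass (p + k) (q - r) ⟨T.cap hrq a.1 c.1, h⟩ := by
  refine ⟨fun a ha => ?_, ?_⟩
  · rw [TropWave.TropicalSpace.cap_eq_capLin]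
    exact ⟨fun c hc => TropWave.TropicalSpace.capLin_mem_chains _ ha hc,
      fun c hc => TropWave.TropicalSpace.capLin_mem_chartRel _ ha hc⟩
  · exact TropWave.existsUnique_subQuot_bilinear (T.cap hrq)
      (T.capBilin (Nat.add_sub_cancel' hrq)) (TropWave.TropicalSpace.cap_eq_capLin hrq)
      (fun a ha c hc => TropWave.TropicalSpace.capLin_mem_cycles _ ha hc)
      (fun a ha c hc => TropWave.TropicalSpace.capLin_mem_boundaries_of_coboundary _ ha hc)
      (fun a ha c hc => TropWave.TropicalSpace.capLin_mem_boundaries _ ha hc)
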